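/- Let $\Gamma$ be an infinite countable set and let $(x,y)\mapsto\mu_{xy}\ge 0$ be a symmetric weight on $\Gamma\times\Gamma$; write $x\sim y$ when $\mu_{xy}>0$ (loops $x\sim x$ are allowed). Assume that the graph $(\Gamma,\mu)$ is connected and locally uniformly finite, i.e. $\sup_{x}\#\{y: y\sim x\}<\infty$. Let $d$ be the graph distance, $m(x)=\sum_{y\sim x}\mu_{xy}$, $m(E)=\sum_{x\in E}m(x)$, $B(x,r)=\{y: d(x,y)<r\}$, $V(x,r)=m(B(x,r))$. Put $p(x,y)=\mu_{xy}/m(x)$, $p_0(x,y)=\delta(x,y)$, $p_{k+1}(x,y)=\sum_z p(x,z)p_k(z,y)$, $Pf(x)=\sum_y p(x,y)f(y)$, $\Delta=I-P$ (a bounded nonnegative self-adjoint operator on $L^2(\Gamma,m)$, functions being complex valued), and $$\nabla f(x)=\Big(\tfrac12\sum_{y}p(x,y)|f(y)-f(x)|^2\Big)^{1/2}.$$ Assume: - (LB) there is $\varepsilon>0$ with $p(x,x)>\varepsilon$ for all $x\in\Gamma$; - (doubling) there is $C$ with $V(x,2r)\le C\,V(x,r)$ for all $x\in\Gamma$, $r>0$;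 - (sub-Gaussian upper estimate) for some real $\beta>2$ there are $C,c>0$ such that for all $x,y\in\Gamma$ and all integers $k\ge1$ $$p_{k-1}(x,y)\le \frac{C\,m(y)}{V(y,k^{1/\beta})}\exp\Big(-c\Big(\frac{d(x,y)^\beta}{k}\Big)^{\frac1{\beta-1}}\Big).$$ Let $T=\nabla\Delta^{-1/2}$ be the Riesz transform on $L^2(\Gamma,m)$: if $R$ denotes the bounded linear operator from $L^2(\Gamma,m)$ to $L^2(\Gamma\times\Gamma,\mu)$ that extends $\Delta^{1/2}g\mapsto \big((x,y)\mapsto g(y)-g(x)\big)$, $g\in L^2(\Gamma,m)$, from the dense range of $\Delta^{1/2}$, then $Tf(x)=\big(\frac12\sum_y p(x,y)|Rf(x,y)|^2\big)^{1/2}$, so that $T\Delta^{1/2}g=\nabla g$. Then $T$ is of weak type $(1,1)$: there is $C$ such that for all $f\in L^1(\Gamma,m)\cap L^2(\Gamma,m)$ and all $\lambda>0$, $$m(\{x: Tf(x)>\lambda\})\le \frac C\lambda\|f\|_{1}.$$ Moreover, for every $q\in(1,2]$, $T$ is bounded on $L^q$: there is $C_q$ such that $\|Tf\|_q\le C_q\|f\|_q$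 for all $f\in L^q(\Gamma,m)\cap L^2(\Gamma,m)$; and likewise $\|\nabla g\|_q\le C_q\|\Delta^{1/2}g\|_q$ for all finitely supported $g$ on $\Gamma$. -/

import Mathlib

open MeasureTheory
open scoped ENNReal NNReal

noncomputable section

/-- A connected, locally uniformly finite weighted graph with vertex set `Γ`: a nonnegative
symmetric weight `mu` on `Γ × Γ`. Two vertices `x`, `y` (possibly equal) are neighbours when
`0 < mu x y`. -/
structure WeightedGraph (Γ : Type*) where
  mu : Γ → Γ → ℝ≥0
  symm : ∀ x y, mu x y = mu y x
  connected : (SimpleGraph.fromRel (fun x y => 0 < mu x y)).Preconnected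
  locUnifFinite : ∃ M₀ : ℕ, ∀ x, {y | 0 < mu x y}.encard ≤ M₀

/-- The nonnegative square root of a nonnegative bounded operator on a Hilbert space, given by the
continuous functional calculus. -/
def operatorSqrt {H : Type*} [NormedAddCommGroup H] [InnerProductSpace ℂ H] [CompleteSpace H]
    (a : H →L[ℂ] H) : H →L[ℂ] H := CFC.sqrt a

namespace WeightedGraph

variable {Γ : Type*} (G : WeightedGraph Γ)

/-- The simple graph of the neighbour relation; loops are irrelevant for distances. -/
def toSimpleGraph : SimpleGraph Γ := SimpleGraph.fromRel (fun x y => 0 < G.mu x y)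

/-- The graph distance: the length of a shortest path. -/
def dist (x y : Γ) : ℕ := G.toSimpleGraph.dist x y

theorem finite_neighbours (x : Γ) : {y | 0 < G.mu x y}.Finite := by
  obtain ⟨M, hM⟩ := G.locUnifFinite
  exact Set.finite_of_encard_le_coe (hM x)

/-- The finite set of neighbours of `x`. -/
def neighbours (x : Γ) : Finset Γ := (G.finite_neighbours x).toFinset

theorem mem_neighbours {x y : Γ} : y ∈ G.neighbours x ↔ 0 < G.mu x y := by
  simp [neighbours]

theorem mu_eq_zero {x y : Γ} (h : y ∉ G.neighbours x) : G.mu x y = 0 := by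
  rw [mem_neighbours] at h
  simpa using h

/-- The weight `m(x) = ∑_{y ∼ x} μ_{xy}` of a vertex. -/
def weight (x : Γ) : ℝ≥0 := ∑ y ∈ G.neighbours x, G.mu x y

theorem weight_eq_tsum (x : Γ) : (G.weight x : ℝ≥0∞) = ∑' y, (G.mu x y : ℝ≥0∞) := by
  rw [tsum_eq_sum (s := G.neighbours x)]
  · simp [weight]
  · intro y hy
    simp [G.mu_eq_zero hy]

theorem mu_eq_zero_of_weight {x : Γ} (h : G.weight x = 0) (y : Γ) : G.mu x y = 0 := by
  by_cases hy : y ∈ G.neighbours x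
  · exact (Finset.sum_eq_zero_iff.1 h) y hy
  · exact G.mu_eq_zero hy

/-- The transition probability `p(x,y) = μ_{xy} / m(x)`. -/
def p (x y : Γ) : ℝ := G.mu x y / G.weight x

open Classical in
/-- The iterated kernel `p_k(x,y)`. The sum defining `p_{k+1}(x,y) = ∑_z p(x,z) p_k(z,y)` runs over
the neighbours `z` of `x`, since `p(x,z) = 0` for the other vertices. -/
def kernel : ℕ → Γ → Γ → ℝ
  | 0, x, y => if x = y then 1 else 0
  | k + 1, x, y => ∑ z ∈ G.neighbours x, G.p x z * kernel k z y

/-- The operator `P` on functions: `Pf(x) = ∑_y p(x,y) f(y)`. -/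
def markov (f : Γ → ℂ) (x : Γ) : ℂ := ∑ y ∈ G.neighbours x, (G.p x y : ℂ) * f y

theorem weight_mul_sq_markov_le (f : Γ → ℂ) (x : Γ) :
    G.weight x * ‖G.markov f x‖₊ ^ 2 ≤ ∑ y ∈ G.neighbours x, G.mu x y * ‖f y‖₊ ^ 2 := by
  by_cases hw : G.weight x = 0
  · simp [hw]
  have h1 : G.weight x * ‖G.markov f x‖₊ ≤ ∑ y ∈ G.neighbours x, G.mu x y * ‖f y‖₊ := by
    calc G.weight x * ‖G.markov f x‖₊
        ≤ G.weight x * ∑ y ∈ G.neighbours x, ‖(G.p x y : ℂ) * f y‖₊ := by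
          gcongr
          exact nnnorm_sum_le _ _
      _ = _ := by
          rw [Finset.mul_sum]
          refine Finset.sum_congr rfl fun y _ => ?_
          have : ‖(G.p x y : ℂ)‖₊ = G.mu x y / G.weight x := by
            ext
            simp [p]
          rw [nnnorm_mul, this, ← mul_assoc, mul_div_cancel₀ _ hw]
  have h2 : (∑ y ∈ G.neighbours x, G.mu x y * ‖f y‖₊) ^ 2 ≤
      (∑ y ∈ G.neighbours x, G.mu x y) * ∑ y ∈ G.neighbours x, G.mu x y * ‖f y‖₊ ^ 2 :=
    Finset.sum_sq_le_sum_mul_sum_of_sq_le_mul _ (fun _ _ => zero_le) (fun _ _ => zero_le)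
      fun y _ => le_of_eq (by ring)
  have h3 : G.weight x * (G.weight x * ‖G.markov f x‖₊ ^ 2) ≤
      G.weight x * ∑ y ∈ G.neighbours x, G.mu x y * ‖f y‖₊ ^ 2 := by
    calc _ = (G.weight x * ‖G.markov f x‖₊) ^ 2 := by ring
      _ ≤ _ := (pow_le_pow_left₀ zero_le h1 2).trans h2
  exact le_of_mul_le_mul_left h3 (pos_iff_ne_zero.2 hw)

/-- The length of the gradient,
`∇f(x) = (½ ∑_y p(x,y) |f(y) - f(x)|²)^{1/2}`. -/
def grad (f : Γ → ℂ) (x : Γ) : ℝ :=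
  Real.sqrt (1 / 2 * ∑ y ∈ G.neighbours x, G.p x y * ‖f y - f x‖ ^ 2)

/-- The length at `x` of a function `h` on ordered pairs of vertices,
`(½ ∑_y p(x,y) |h(x,y)|²)^{1/2}`. For `h(x,y) = f(y) - f(x)` this is `∇f(x)`. -/
def fieldLength (h : Γ × Γ → ℂ) (x : Γ) : ℝ :=
  Real.sqrt (1 / 2 * ∑ y ∈ G.neighbours x, G.p x y * ‖h (x, y)‖ ^ 2)

/-- Condition (LB): `p(x,x)` is bounded below by a positive constant. -/
def LB : Prop := ∃ ε : ℝ, 0 < ε ∧ ∀ x, ε < G.p x x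

section Measure

variable [MeasurableSpace Γ]

/-- The measure on vertices giving mass `m(x)` to `x`. -/
def measure : Measure Γ := Measure.sum fun x => (G.weight x : ℝ≥0∞) • Measure.dirac x

/-- The measure on ordered pairs of vertices giving mass `μ_{xy}` to `(x, y)`. -/
def edgeMeasure : Measure (Γ × Γ) :=
  Measure.sum fun e : Γ × Γ => (G.mu e.1 e.2 : ℝ≥0∞) • Measure.dirac e

/-- The volume `V(x,r)` of the open ball of centre `x` and radius `r`. -/
def vol (x : Γ) (r : ℝ) : ℝ := G.measure.real {y | (G.dist x y : ℝ) < r}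

/-- Volume doubling. -/
def Doubling : Prop := ∃ C : ℝ, ∀ (x : Γ) (r : ℝ), 0 < r → G.vol x (2 * r) ≤ C * G.vol x r

/-- The Markov kernel upper estimate with exponent `m`. -/
def UE (m : ℝ) : Prop :=
  ∃ C c : ℝ, 0 < c ∧ ∀ (x y : Γ) (k : ℕ), 1 ≤ k →
    G.kernel (k - 1) x y ≤ C * (G.weight y / G.vol y ((k : ℝ) ^ (1 / m))) *
      Real.exp (-c * ((G.dist x y : ℝ) ^ m / k) ^ (1 / (m - 1)))

variable [Countable Γ] [DiscreteMeasurableSpace Γ]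

theorem lintegral_measure (f : Γ → ℝ≥0∞) :
    ∫⁻ x, f x ∂G.measure = ∑' x, (G.weight x : ℝ≥0∞) * f x := by
  simp only [measure, lintegral_sum_measure, lintegral_smul_measure, lintegral_dirac, smul_eq_mul]

theorem ae_measure_iff {q : Γ → Prop} : (∀ᵐ x ∂G.measure, q x) ↔ ∀ x, G.weight x ≠ 0 → q x := by
  rw [measure, Measure.ae_sum_iff]
  refine forall_congr' fun x => ?_
  by_cases h : G.weight x = 0
  · simp [h]
  · rw [Measure.ae_ennreal_smul_measure_iff (by simpa using h),
      ae_dirac_iff MeasurableSet.of_discrete]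
    simp [h]

theorem measurePreserving_fst : MeasurePreserving Prod.fst G.edgeMeasure G.measure := by
  refine ⟨measurable_fst, Measure.ext_of_lintegral _ fun f _ => ?_⟩
  rw [lintegral_map Measurable.of_discrete measurable_fst, lintegral_measure, edgeMeasure,
    lintegral_sum_measure, ENNReal.tsum_prod']
  refine tsum_congr fun x => ?_
  simp only [weight_eq_tsum, ENNReal.tsum_mul_right, lintegral_smul_measure, lintegral_dirac,
    smul_eq_mul]

theorem measurePreserving_snd : MeasurePreserving Prod.snd G.edgeMeasure G.measure := by
  refine ⟨measurable_snd, Measure.ext_of_lintegral _ fun f _ => ?_⟩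
  rw [lintegral_map Measurable.of_discrete measurable_snd, lintegral_measure, edgeMeasure,
    lintegral_sum_measure, ENNReal.tsum_prod', ENNReal.tsum_comm]
  refine tsum_congr fun x => ?_
  simp only [weight_eq_tsum, ENNReal.tsum_mul_right, lintegral_smul_measure, lintegral_dirac,
    smul_eq_mul, G.symm x]

/-- The Hilbert space `L²(Γ, m)`. -/
abbrev L2 : Type _ := Lp ℂ 2 G.measure

/-- The Hilbert space of square integrable functions on ordered pairs of vertices. -/
abbrev EdgeL2 : Type _ := Lp ℂ 2 G.edgeMeasure

theorem markov_congr {f g : Γ → ℂ} (h : f =ᵐ[G.measure] g) : G.markov f = G.markov g := by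
  have h' := G.ae_measure_iff.1 h
  funext x
  refine Finset.sum_congr rfl fun y hy => ?_
  rw [h' y]
  intro hw
  have h1 := G.mu_eq_zero_of_weight hw x
  rw [G.symm] at h1
  exact (G.mem_neighbours.1 hy).ne' h1

theorem eLpNorm_markov_le (f : Γ → ℂ) :
    eLpNorm (G.markov f) 2 G.measure ≤ eLpNorm f 2 G.measure := by
  rw [eLpNorm_eq_lintegral_rpow_enorm_toReal two_ne_zero ENNReal.ofNat_ne_top,
    eLpNorm_eq_lintegral_rpow_enorm_toReal two_ne_zero ENNReal.ofNat_ne_top]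
  gcongr ?_ ^ _
  simp only [ENNReal.toReal_ofNat, ENNReal.rpow_ofNat]
  rw [← G.measurePreserving_snd.lintegral_comp (f := fun x => ‖f x‖ₑ ^ 2) Measurable.of_discrete, lintegral_measure,
    edgeMeasure, lintegral_sum_measure, ENNReal.tsum_prod']
  refine ENNReal.tsum_le_tsum fun x => ?_
  rw [tsum_eq_sum (s := G.neighbours x)]
  · have := ENNReal.coe_le_coe.2 (G.weight_mul_sq_markov_le f x)
    push_cast at this
    simpa only [lintegral_smul_measure, lintegral_dirac, smul_eq_mul, enorm_eq_nnnorm] using this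
  · intro y hy
    simp [G.mu_eq_zero hy]

theorem memLp_markov {f : Γ → ℂ} (hf : MemLp f 2 G.measure) : MemLp (G.markov f) 2 G.measure :=
  ⟨(Measurable.of_discrete).aestronglyMeasurable, (G.eLpNorm_markov_le f).trans_lt hf.2⟩

/-- `P` as a bounded operator on `L²(Γ, m)`. -/
def markovL2 : G.L2 →L[ℂ] G.L2 :=
  LinearMap.mkContinuous
    { toFun := fun f => (G.memLp_markov (Lp.memLp f)).toLp (G.markov f)
      map_add' := by
        intro f g
        rw [← MemLp.toLp_add, MemLp.toLp_eq_toLp_iff, G.markov_congr (Lp.coeFn_add f g)]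
        refine Filter.Eventually.of_forall fun x => ?_
        simp [markov, mul_add, Finset.sum_add_distrib]
      map_smul' := by
        intro c f
        rw [RingHom.id_apply, ← MemLp.toLp_const_smul, MemLp.toLp_eq_toLp_iff,
          G.markov_congr (Lp.coeFn_smul c f)]
        refine Filter.Eventually.of_forall fun x => ?_
        simp [markov, Finset.mul_sum, mul_left_comm] } 1 (by
    intro f
    rw [one_mul, LinearMap.coe_mk, AddHom.coe_mk, Lp.norm_toLp, Lp.norm_def]
    exact ENNReal.toReal_mono (Lp.eLpNorm_ne_top f) (G.eLpNorm_markov_le f))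

/-- The Laplacian `Δ = I - P` on `L²(Γ, m)`. -/
def laplacian : G.L2 →L[ℂ] G.L2 := 1 - G.markovL2

/-- `Δ^{1/2}`, the nonnegative square root of `Δ` given by the functional calculus. -/
def sqrtLaplacian : G.L2 →L[ℂ] G.L2 := operatorSqrt G.laplacian

/-- The differential `f ↦ ((x, y) ↦ f(y) - f(x))` on `L²(Γ, m)`. -/
def differential : G.L2 →L[ℂ] G.EdgeL2 :=
  (Lp.compMeasurePreservingₗᵢ ℂ Prod.snd G.measurePreserving_snd).toContinuousLinearMap -
    (Lp.compMeasurePreservingₗᵢ ℂ Prod.fst G.measurePreserving_fst).toContinuousLinearMap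

/-- The linear form `d Δ^{-1/2}` of the Riesz transform: the bounded operator `R` on `L²(Γ, m)` with
`R (Δ^{1/2} g) = dg`, obtained by extension from the (dense) range of `Δ^{1/2}`. -/
def rieszField : G.L2 →L[ℂ] G.EdgeL2 :=
  (G.differential : G.L2 →ₗ[ℂ] G.EdgeL2).extendOfNorm (G.sqrtLaplacian : G.L2 →ₗ[ℂ] G.L2)

/-- The Riesz transform `∇ Δ^{-1/2}`. -/
def riesz (f : G.L2) : Γ → ℝ := G.fieldLength (G.rieszField f)

/-- The Riesz transform is weak `(1,1)`. -/
def RieszWeakOneOne : Prop :=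
  ∃ C : ℝ≥0, ∀ f : G.L2, MemLp f 1 G.measure → ∀ t : ℝ≥0, 0 < t →
    G.measure {x | (t : ℝ) < |G.riesz f x|} ≤ (C / t : ℝ≥0) * eLpNorm f 1 G.measure

/-- The Riesz transform is bounded on `L^q`. -/
def RieszBounded (q : ℝ≥0∞) : Prop :=
  ∃ C : ℝ≥0, ∀ f : G.L2, MemLp f q G.measure →
    eLpNorm (G.riesz f) q G.measure ≤ C * eLpNorm f q G.measure

/-- The inequality `‖∇g‖_q ≤ C ‖Δ^{1/2} g‖_q` for finitely supported `g`. -/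
def RieszInequality (q : ℝ≥0∞) : Prop :=
  ∃ C : ℝ≥0, ∀ g : G.L2, (Function.support g).Finite →
    eLpNorm (G.grad g) q G.measure ≤ C * eLpNorm (G.sqrtLaplacian g) q G.measure

end Measure

end WeightedGraph

end

/-!
The Riesz transform is bounded on `L²` because `‖dg‖² = 2 ⟨Δg, g⟩` (`inner_differential`), and
`Δ^{1/2}` has dense range because doubling on an infinite graph forces infinite total mass
(`measure_univ_eq_top`, `denseRange_sqrtLaplacian`). Weak type `(1,1)` is obtained from a
Calderón–Zygmund decomposition without cancellation, and the `L^q` bounds follow by Marcinkiewicz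
interpolation.

*Gradient of the heat kernel.* The only input on `p_k` is its upper estimate. By (LB), the gradient
of a nonnegative `u` is controlled, with a free parameter, by the Jensen gap `P(u^{3/2}) - (Pu)^{3/2}`
and by the size of `u` (`sqrt_p_mul_abs_sub_le`). For the heat kernels `u_k` the integrals of the
Jensen gaps telescope over `k`, since `P` preserves integrals. Summed over a block of times
`K ≤ k + 1 < 2K`, the `L¹` norm of the gradient at distance at least `r` of the pole is therefore at most
`C √K (1 + r / K^{1/β})^{-1/2}` (`sum_lintegral_gradSum_heat_le`), where `β` is the exponent of the
sub-Gaussian estimate.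

*Regularisation.* Let `A` be the average of the `P ^ j` with `n ≤ j < 2n`. Then
`1 - A = Δ^{1/2} ∑_k c_k P ^ k` with a norm-convergent series (`operatorSqrt_mul_tsum_regCoeff`), where
`|c_k| ≲ min(1, n/k) k^{-1/2}` (`abs_regCoeff_le`). For `n` of the order of `r^β`, summation over dyadic
blocks shows that `∑_k |c_k| |∇u_k|` is integrable at distance at least `r` of the pole, uniformly
(`lintegral_tsum_regCoeff_gradSum_heat_le`). No estimate of `u_{k+1} - u_k` is needed: the
averages replace time differences.

*Decomposition.* At height `t`, write `f = g + ∑ b_z` with `|g| ≤ t` and `b_z` supported near disjoint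
balls `B(z, r_z)` on which the mean of `|f|` is at least `t` (`exists_calderonZygmund_covering`), and
`b_z = A_z b_z + (1 - A_z) b_z` with `n` of the order of `r_z^β`. The functions `A_z b_z` are bounded by a
multiple of `t` times bumps adapted to the balls, and such bumps are almost orthogonal
(`lintegral_sq_sum_decay_le`), so the `L²` bound handles them as it handles `g`. The Riesz transform of
`(1 - A_z) b_z` is the length of the gradient of `∑_k c_k P ^ k b_z`, which is integrable away from the
enlarged balls; the total measure of these is at most a multiple of `‖f‖₁ / t`.
-/

noncomputable section
set_option linter.unusedSectionVars false

namespace WeightedGraph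

variable {Γ : Type*} (G : WeightedGraph Γ)

/-! ### The graph metric -/

theorem toSimpleGraph_connected [Nonempty Γ] : G.toSimpleGraph.Connected :=
  SimpleGraph.connected_iff _ |>.2 ⟨G.connected, ‹_›⟩

theorem dist_self (x : Γ) : G.dist x x = 0 := SimpleGraph.dist_self

theorem dist_comm (x y : Γ) : G.dist x y = G.dist y x := SimpleGraph.dist_comm

theorem dist_triangle (x y z : Γ) : G.dist x z ≤ G.dist x y + G.dist y z :=
  haveI : Nonempty Γ := ⟨x⟩
  G.toSimpleGraph_connected.dist_triangle

theorem dist_triangle_real (x y z : Γ) : (G.dist x z : ℝ) ≤ G.dist x y + G.dist y z :=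
  mod_cast G.dist_triangle x y z

theorem dist_eq_zero {x y : Γ} : G.dist x y = 0 ↔ x = y :=
  haveI : Nonempty Γ := ⟨x⟩
  G.toSimpleGraph_connected.dist_eq_zero_iff

theorem dist_le_one {x y : Γ} (h : y ∈ G.neighbours x) : G.dist x y ≤ 1 := by
  rcases eq_or_ne x y with rfl | hne
  · simp [G.dist_self]
  · refine le_of_eq (SimpleGraph.dist_eq_one_iff_adj.2 ?_)
    rw [toSimpleGraph, SimpleGraph.fromRel_adj]
    exact ⟨hne, Or.inl (G.mem_neighbours.1 h)⟩

/-- The open ball of centre `x` and radius `r` for the graph distance. -/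
def ball (x : Γ) (r : ℝ) : Set Γ := {y | (G.dist x y : ℝ) < r}

theorem mem_ball {x y : Γ} {r : ℝ} : y ∈ G.ball x r ↔ (G.dist x y : ℝ) < r := Iff.rfl

theorem mem_ball_self (x : Γ) {r : ℝ} (hr : 0 < r) : x ∈ G.ball x r := by
  simpa [mem_ball, G.dist_self] using hr

theorem ball_mono (x : Γ) {r s : ℝ} (h : r ≤ s) : G.ball x r ⊆ G.ball x s :=
  fun _ hy => lt_of_lt_of_le hy h

theorem ball_subset_ball (x y : Γ) {r s : ℝ} (h : r + G.dist x y ≤ s) :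
    G.ball x r ⊆ G.ball y s := fun z hz => by
  have h1 := G.dist_triangle_real y x z
  rw [G.dist_comm y x] at h1
  rw [mem_ball] at *
  linarith

theorem ball_one (x : Γ) : G.ball x 1 = {x} := by
  ext y
  rw [mem_ball, Set.mem_singleton_iff, ← Nat.cast_one, Nat.cast_lt, Nat.lt_one_iff,
    G.dist_eq_zero, eq_comm]

theorem finite_ball (x : Γ) (r : ℝ) : (G.ball x r).Finite := by
  have key : ∀ n : ℕ, {y | G.dist x y ≤ n}.Finite := by
    intro n
    induction n with
    | zero =>
      refine (Set.finite_singleton x).subset fun y hy => ?_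
      exact (G.dist_eq_zero.1 (Nat.le_zero.1 hy)).symm
    | succ n ih =>
      refine (ih.union (ih.biUnion fun z _ => (G.neighbours z).finite_toSet)).subset fun y hy => ?_
      rcases Nat.lt_or_ge n (G.dist x y) with h | h
      · right
        have hd : G.dist x y = n + 1 := le_antisymm hy h
        have : Nonempty Γ := ⟨x⟩
        obtain ⟨w, hw⟩ := G.toSimpleGraph_connected.exists_walk_length_eq_dist y x
        cases w with
        | nil => rw [G.dist_self] at hd; omega
        | @cons _ z _ hadj w =>
          rw [SimpleGraph.Walk.length_cons] at hw
          have h1 : G.dist z x ≤ w.length := SimpleGraph.dist_le w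
          have h2 : G.dist y x = n + 1 := by rw [G.dist_comm, hd]
          have h3 : w.length + 1 = G.dist y x := hw
          rw [toSimpleGraph, SimpleGraph.fromRel_adj] at hadj
          refine Set.mem_biUnion (x := z) ?_ ?_
          · change G.dist x z ≤ n
            rw [G.dist_comm]; omega
          · rw [Finset.mem_coe, mem_neighbours]
            rcases hadj.2 with h | h
            · rwa [G.symm]
            · exact h
      · exact Or.inl h
  refine (key ⌈r⌉₊).subset fun y hy => ?_
  exact_mod_cast (lt_of_lt_of_le (G.mem_ball.1 hy) (Nat.le_ceil r)).le

theorem exists_le_dist [Infinite Γ] (x : Γ) (r : ℝ) : ∃ y, r ≤ G.dist x y := by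
  by_contra! h
  exact Set.infinite_univ ((G.finite_ball x r).subset fun y _ => h y)


section Measure

variable [MeasurableSpace Γ] [Countable Γ] [DiscreteMeasurableSpace Γ]

/-! ### Volume growth -/

theorem measure_singleton (x : Γ) : G.measure {x} = G.weight x := by
  rw [← setLIntegral_one, ← lintegral_indicator (measurableSet_singleton x), lintegral_measure,
    tsum_eq_single x]
  · simp
  · intro y hy
    simp [hy]

theorem measure_lt_top_of_finite {s : Set Γ} (hs : s.Finite) : G.measure s < ∞ := by
  rw [← Set.biUnion_of_singleton s]
  refine measure_biUnion_lt_top hs fun x _ => ?_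
  simp [measure_singleton]

theorem vol_eq (x : Γ) (r : ℝ) : G.vol x r = G.measure.real (G.ball x r) := rfl

theorem ofReal_vol (x : Γ) (r : ℝ) : ENNReal.ofReal (G.vol x r) = G.measure (G.ball x r) := by
  rw [vol_eq, Measure.real, ENNReal.ofReal_toReal]
  exact (G.measure_lt_top_of_finite (G.finite_ball x r)).ne

theorem vol_le_vol {x y : Γ} {r s : ℝ} (h : r + G.dist x y ≤ s) : G.vol x r ≤ G.vol y s :=
  measureReal_mono (G.ball_subset_ball x y h)
    (G.measure_lt_top_of_finite (G.finite_ball y s)).ne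

theorem vol_mono (x : Γ) {r s : ℝ} (h : r ≤ s) : G.vol x r ≤ G.vol x s :=
  G.vol_le_vol (by simpa [G.dist_self] using h)

theorem vol_nonneg (x : Γ) (r : ℝ) : 0 ≤ G.vol x r := measureReal_nonneg

theorem vol_pos (hw : ∀ x, 0 < G.weight x) (x : Γ) {r : ℝ} (hr : 0 < r) : 0 < G.vol x r := by
  refine ENNReal.toReal_pos ?_ (G.measure_lt_top_of_finite (G.finite_ball x r)).ne
  refine (lt_of_lt_of_le ?_ (measure_mono (Set.singleton_subset_iff.2 (G.mem_ball_self x hr)))).ne'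
  rw [measure_singleton]
  exact_mod_cast hw x

theorem vol_two_pow {D : ℝ} (hD0 : 0 ≤ D)
    (hD : ∀ (x : Γ) (r : ℝ), 0 < r → G.vol x (2 * r) ≤ D * G.vol x r)
    (x : Γ) {r : ℝ} (hr : 0 < r) (j : ℕ) : G.vol x (2 ^ j * r) ≤ D ^ j * G.vol x r := by
  induction j with
  | zero => simp
  | succ j ih =>
    calc G.vol x (2 ^ (j + 1) * r) = G.vol x (2 * (2 ^ j * r)) := by ring_nf
      _ ≤ D * G.vol x (2 ^ j * r) := hD x _ (by positivity)
      _ ≤ D * (D ^ j * G.vol x r) := by gcongr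
      _ = _ := by ring

/-- The total mass is infinite: a far away ball disjoint from a given one carries, by doubling, a
fixed proportion of its mass. -/
theorem measure_univ_eq_top [Infinite Γ] (hw : ∀ x, 0 < G.weight x) {D : ℝ} (hD0 : 0 < D)
    (hD : ∀ (x : Γ) (r : ℝ), 0 < r → G.vol x (2 * r) ≤ D * G.vol x r) :
    G.measure Set.univ = ∞ := by
  by_contra htop
  have hfin : IsFiniteMeasure G.measure := ⟨lt_top_iff_ne_top.2 htop⟩
  obtain ⟨x⟩ : Nonempty Γ := inferInstance
  set M := G.measure.real Set.univ with hM
  have hlim : Filter.Tendsto (fun n : ℕ => G.vol x n) Filter.atTop (nhds M) := by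
    have h1 : Monotone fun n : ℕ => G.ball x n := fun a b hab =>
      G.ball_mono x (by exact_mod_cast hab)
    have h2 : ⋃ n : ℕ, G.ball x n = Set.univ := by
      refine Set.eq_univ_of_forall fun y => Set.mem_iUnion.2 ⟨G.dist x y + 1, ?_⟩
      rw [mem_ball]; push_cast; linarith
    have h3 := tendsto_measure_iUnion_atTop (μ := G.measure) h1
    rw [h2] at h3
    exact (ENNReal.tendsto_toReal htop).comp h3
  have hMpos : 0 < M := lt_of_lt_of_le (G.vol_pos hw x one_pos)
    (measureReal_mono (Set.subset_univ _))
  have hc : M / (1 + 1 / D ^ 2) < M := by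
    rw [div_lt_iff₀ (by positivity)]
    have : 0 < M * (1 / D ^ 2) := by positivity
    linarith
  obtain ⟨n, hn1, hn2⟩ := ((hlim.eventually (lt_mem_nhds hc)).and
    (Filter.eventually_ge_atTop 1)).exists
  have hn0 : (1 : ℝ) ≤ n := by exact_mod_cast hn2
  obtain ⟨y, hy⟩ := G.exists_le_dist x (2 * n)
  set d : ℝ := (G.dist x y : ℝ) with hd
  have hdisj : Disjoint (G.ball x (d / 2)) (G.ball y (d / 2)) := by
    rw [Set.disjoint_left]
    intro z hz1 hz2
    have h1 := G.dist_triangle_real x z y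
    rw [G.dist_comm z y] at h1
    rw [mem_ball] at hz1 hz2
    linarith
  have h1 : G.vol x (d / 2) + G.vol y (d / 2) ≤ M := by
    rw [vol_eq, vol_eq, ← measureReal_union hdisj MeasurableSet.of_discrete]
    exact measureReal_mono (Set.subset_univ _)
  have h2 : G.vol x n ≤ G.vol x (d / 2) := G.vol_mono x (by linarith)
  have h3 : G.vol x n ≤ G.vol y (2 ^ 2 * (d / 2)) := G.vol_le_vol (by linarith)
  have h4 := h3.trans (G.vol_two_pow hD0.le hD y (by linarith : 0 < d / 2) 2)
  have h5 : G.vol x n / D ^ 2 ≤ G.vol y (d / 2) := by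
    rw [div_le_iff₀ (by positivity)]; linarith
  have h6 : G.vol x n * (1 + 1 / D ^ 2) ≤ M := by
    calc _ = G.vol x n + G.vol x n / D ^ 2 := by ring
      _ ≤ M := by linarith
  rw [div_lt_iff₀ (by positivity)] at hn1
  linarith

theorem tendsto_vol_atTop (hinf : G.measure Set.univ = ∞) (x : Γ) :
    Filter.Tendsto (fun n : ℕ => G.vol x n) Filter.atTop Filter.atTop := by
  have h1 : Monotone fun n : ℕ => G.ball x n := fun a b hab =>
    G.ball_mono x (by exact_mod_cast hab)
  have h2 : ⋃ n : ℕ, G.ball x n = Set.univ := by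
    refine Set.eq_univ_of_forall fun y => Set.mem_iUnion.2 ⟨G.dist x y + 1, ?_⟩
    rw [mem_ball]; push_cast; linarith
  have h3 := tendsto_measure_iUnion_atTop (μ := G.measure) h1
  rw [h2, hinf] at h3
  refine Filter.tendsto_atTop.2 fun b => ?_
  filter_upwards [h3.eventually (lt_mem_nhds (ENNReal.ofReal_lt_top (r := b)))] with n hn
  rw [Function.comp_apply, ← ofReal_vol] at hn
  exact (ENNReal.ofReal_lt_ofReal_iff'.1 hn).1.le

/-! ### Integrals of polynomially decaying functions -/

/-- A function decaying polynomially at scale `ρ` away from `y`, with an exponent that beats the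
doubling constant, has integral comparable with the volume of the ball of radius `ρ`. -/
theorem lintegral_decay_le {D : ℝ} (hD0 : 0 ≤ D)
    (hD : ∀ (x : Γ) (r : ℝ), 0 < r → G.vol x (2 * r) ≤ D * G.vol x r)
    {N : ℕ} (hN : 2 * D ≤ 2 ^ N) (y : Γ) {ρ : ℝ} (hρ : 0 < ρ) :
    ∫⁻ x, ENNReal.ofReal (((1 + (G.dist x y : ℝ) / ρ) ^ N)⁻¹) ∂G.measure ≤
      ENNReal.ofReal (2 ^ (N + 1) * G.vol y ρ) := by
  have hpt : ∀ x, ENNReal.ofReal (((1 + (G.dist x y : ℝ) / ρ) ^ N)⁻¹) ≤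
      ∑' j : ℕ, (G.ball y (2 ^ j * ρ)).indicator
        (fun _ => ENNReal.ofReal (2 ^ N * ((2 ^ N) ^ j)⁻¹)) x := by
    intro x
    have hex : ∃ j : ℕ, x ∈ G.ball y (2 ^ j * ρ) := by
      obtain ⟨j, hj⟩ := pow_unbounded_of_one_lt ((G.dist y x : ℝ) / ρ) one_lt_two
      exact ⟨j, by rw [mem_ball]; rwa [div_lt_iff₀ hρ] at hj⟩
    classical
    obtain ⟨hj, hmin⟩ := (⟨Nat.find_spec hex, fun i hi => Nat.find_min hex hi⟩ :
      x ∈ G.ball y (2 ^ (Nat.find hex) * ρ) ∧ ∀ i < Nat.find hex, x ∉ G.ball y (2 ^ i * ρ))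
    generalize Nat.find hex = j at hj hmin
    refine le_trans ?_ (ENNReal.le_tsum j)
    rw [Set.indicator_of_mem hj]
    refine ENNReal.ofReal_le_ofReal ?_
    have hpos : (0 : ℝ) ≤ (G.dist x y : ℝ) / ρ := by positivity
    rcases j with _ | j
    · rw [pow_zero, inv_one, mul_one]
      exact (inv_le_one_of_one_le₀ (one_le_pow₀ (by linarith))).trans (one_le_pow₀ one_le_two)
    · have h1 := hmin j (Nat.lt_succ_self j)
      rw [mem_ball, not_lt, G.dist_comm, ← le_div_iff₀ hρ] at h1
      have h2 : (2 ^ N * ((2 ^ N) ^ (j + 1))⁻¹ : ℝ) = ((2 ^ j) ^ N)⁻¹ := by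
        rw [pow_succ, mul_inv, ← pow_mul, ← pow_mul, mul_comm j N]
        field_simp
      rw [h2]
      gcongr
      linarith
  calc _ ≤ ∫⁻ x, ∑' j : ℕ, (G.ball y (2 ^ j * ρ)).indicator
        (fun _ => ENNReal.ofReal (2 ^ N * ((2 ^ N) ^ j)⁻¹)) x ∂G.measure := lintegral_mono hpt
    _ = ∑' j : ℕ, ENNReal.ofReal (2 ^ N * ((2 ^ N) ^ j)⁻¹) * G.measure (G.ball y (2 ^ j * ρ)) := by
        rw [lintegral_tsum fun j => Measurable.of_discrete.aemeasurable]
        simp [lintegral_indicator_const MeasurableSet.of_discrete]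
    _ ≤ ∑' j : ℕ, ENNReal.ofReal (2 ^ N * G.vol y ρ * (1 / 2) ^ j) := by
        refine ENNReal.tsum_le_tsum fun j => ?_
        rw [← ofReal_vol, ← ENNReal.ofReal_mul (by positivity)]
        refine ENNReal.ofReal_le_ofReal ?_
        have hv := G.vol_two_pow hD0 hD y hρ j
        have hv0 := G.vol_nonneg y ρ
        have h3 : ((2 ^ N) ^ j)⁻¹ * D ^ j ≤ (1 / 2 : ℝ) ^ j := by
          rw [← inv_pow, ← mul_pow]
          refine pow_le_pow_left₀ (by positivity) ?_ j
          rw [inv_mul_le_iff₀ (by positivity)]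
          linarith
        calc _ ≤ 2 ^ N * ((2 ^ N) ^ j)⁻¹ * (D ^ j * G.vol y ρ) := by gcongr
          _ = 2 ^ N * G.vol y ρ * (((2 ^ N) ^ j)⁻¹ * D ^ j) := by ring
          _ ≤ _ := by gcongr
    _ = _ := by
        have hv0 := G.vol_nonneg y ρ
        rw [← ENNReal.ofReal_tsum_of_nonneg (fun j => by positivity)
          (summable_geometric_two.mul_left _), tsum_mul_left, tsum_geometric_two]
        congr 1
        ring

end Measure

end WeightedGraph

/-! ### A convexity inequality -/

/-- Quantitative strict convexity of `t ↦ t ^ (3 / 2)` on `[0, W]`. -/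
theorem Real.sq_sub_le_sqrt_mul_convexity_gap {t e W : ℝ} (ht : 0 ≤ t) (he : 0 ≤ e)
    (htW : t ≤ W) (heW : e ≤ W) :
    (t - e) ^ 2 ≤ 4 * √W * (t * √t - e * √e - 3 / 2 * √e * (t - e)) := by
  obtain ⟨a, ha, rfl⟩ : ∃ a : ℝ, 0 ≤ a ∧ a ^ 2 = t := ⟨√t, Real.sqrt_nonneg t, Real.sq_sqrt ht⟩
  obtain ⟨b, hb, rfl⟩ : ∃ b : ℝ, 0 ≤ b ∧ b ^ 2 = e := ⟨√e, Real.sqrt_nonneg e, Real.sq_sqrt he⟩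
  rw [Real.sqrt_sq ha, Real.sqrt_sq hb]
  have haw : a ≤ √W := Real.le_sqrt_of_sq_le htW
  have hbw : b ≤ √W := Real.le_sqrt_of_sq_le heW
  have h1 : (a + b) ^ 2 ≤ 4 * √W * (a + b / 2) := by nlinarith
  calc (a ^ 2 - b ^ 2) ^ 2 = (a - b) ^ 2 * (a + b) ^ 2 := by ring
    _ ≤ (a - b) ^ 2 * (4 * √W * (a + b / 2)) := by gcongr
    _ = _ := by ring

/-- The variance of a function bounded by `W` is controlled by its Jensen gap for the convex
function `t ↦ t ^ (3 / 2)`. -/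
theorem Finset.variance_le_sqrt_mul_jensen_gap {ι : Type*} (s : Finset ι) (w u : ι → ℝ) {W : ℝ}
    (hw : ∀ i ∈ s, 0 ≤ w i) (hw1 : ∑ i ∈ s, w i = 1) (hu : ∀ i ∈ s, 0 ≤ u i)
    (huW : ∀ i ∈ s, u i ≤ W) :
    ∑ i ∈ s, w i * (u i - ∑ j ∈ s, w j * u j) ^ 2 ≤
      4 * √W * (∑ i ∈ s, w i * (u i * √(u i)) -
        (∑ j ∈ s, w j * u j) * √(∑ j ∈ s, w j * u j)) := by
  set e := ∑ j ∈ s, w j * u j with he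
  have he0 : 0 ≤ e := Finset.sum_nonneg fun i hi => mul_nonneg (hw i hi) (hu i hi)
  have heW : e ≤ W := by
    calc e ≤ ∑ j ∈ s, w j * W := Finset.sum_le_sum fun i hi =>
          mul_le_mul_of_nonneg_left (huW i hi) (hw i hi)
      _ = W := by rw [← Finset.sum_mul, hw1, one_mul]
  calc _ ≤ ∑ i ∈ s, w i * (4 * √W * (u i * √(u i) - e * √e - 3 / 2 * √e * (u i - e))) :=
        Finset.sum_le_sum fun i hi => mul_le_mul_of_nonneg_left
          (Real.sq_sub_le_sqrt_mul_convexity_gap (hu i hi) he0 (huW i hi) heW) (hw i hi)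
    _ = 4 * √W * (∑ i ∈ s, w i * (u i * √(u i)) - (∑ i ∈ s, w i) * (e * √e)
          - 3 / 2 * √e * (∑ i ∈ s, w i * u i - (∑ i ∈ s, w i) * e)) := by
        simp only [Finset.mul_sum, Finset.sum_mul, ← Finset.sum_sub_distrib]
        exact Finset.sum_congr rfl fun i _ => by ring
    _ = _ := by rw [hw1, ← he]; ring

namespace WeightedGraph

variable {Γ : Type*} (G : WeightedGraph Γ)

/-! ### The heat kernel and its upper estimate -/

theorem p_nonneg (x y : Γ) : 0 ≤ G.p x y := by unfold p; positivity

theorem weight_pos_of_LB {ε : ℝ} (hε : 0 < ε) (h : ∀ x, ε < G.p x x) (x : Γ) :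
    0 < G.weight x := by
  rw [pos_iff_ne_zero]
  intro h0
  have := h x
  rw [p, h0, NNReal.coe_zero, div_zero] at this
  linarith

theorem self_mem_neighbours {ε : ℝ} (hε : 0 < ε) (h : ∀ x, ε < G.p x x) (x : Γ) :
    x ∈ G.neighbours x := by
  by_contra h0
  have := h x
  rw [p, G.mu_eq_zero h0, NNReal.coe_zero, zero_div] at this
  linarith

theorem sum_p (hw : ∀ x, 0 < G.weight x) (x : Γ) : ∑ z ∈ G.neighbours x, G.p x z = 1 := by
  have h1 : (G.weight x : ℝ) ≠ 0 := by exact_mod_cast (hw x).ne'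
  simp only [p, ← Finset.sum_div]
  rw [div_eq_one_iff_eq h1, weight]
  push_cast
  rfl

theorem kernel_nonneg (k : ℕ) (x y : Γ) : 0 ≤ G.kernel k x y := by
  induction k generalizing x with
  | zero => rw [kernel]; split_ifs <;> norm_num
  | succ k ih => exact Finset.sum_nonneg fun z _ => mul_nonneg (G.p_nonneg x z) (ih z)

/-- The heat kernel `p_k(x,y) / m(y)`, a density with respect to the measure `m`, as a function of
`x` for a given pole `y`. -/
def heat (k : ℕ) (y x : Γ) : ℝ := G.kernel k x y / G.weight y

theorem heat_nonneg (k : ℕ) (y x : Γ) : 0 ≤ G.heat k y x :=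
  div_nonneg (G.kernel_nonneg k x y) (NNReal.coe_nonneg _)

theorem heat_succ (k : ℕ) (y x : Γ) :
    G.heat (k + 1) y x = ∑ z ∈ G.neighbours x, G.p x z * G.heat k y z := by
  simp only [heat, kernel, Finset.sum_div, mul_div_assoc]

theorem exp_neg_le_decay {c : ℝ} (hc : 0 < c) (N : ℕ) :
    ∃ C : ℝ, 0 < C ∧ ∀ t : ℝ, 0 ≤ t → Real.exp (-c * ((t - 1) / 2)) ≤ C * ((1 + t) ^ N)⁻¹ := by
  refine ⟨Real.exp c * (N.factorial / (c / 2) ^ N), by positivity, fun t ht => ?_⟩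
  have h1 := Real.pow_div_factorial_le_exp (c / 2 * (1 + t)) (by positivity) N
  have h2 : Real.exp (-c * ((t - 1) / 2)) * Real.exp (c / 2 * (1 + t)) = Real.exp c := by
    rw [← Real.exp_add]; ring_nf
  rw [mul_pow, div_le_iff₀ (by positivity)] at h1
  rw [← div_eq_mul_inv (_ * _), le_div_iff₀ (by positivity),
    mul_div_assoc' (Real.exp c), le_div_iff₀ (by positivity), ← h2]
  calc _ = Real.exp (-c * ((t - 1) / 2)) * ((c / 2) ^ N * (1 + t) ^ N) := by ring
    _ ≤ Real.exp (-c * ((t - 1) / 2)) * (Real.exp (c / 2 * (1 + t)) * N.factorial) := by gcongr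
    _ = _ := by ring

section Measure

variable [MeasurableSpace Γ] [Countable Γ] [DiscreteMeasurableSpace Γ]

/-- The sub-Gaussian estimate, in the form of a polynomial decay at a scale `K ^ (1 / m)` that is
common to all times between `K` and `2 K`. -/
theorem heat_le (hw : ∀ x, 0 < G.weight x) {m : ℝ} (hm : 2 < m) (hUE : G.UE m) (N : ℕ) :
    ∃ C : ℝ, 0 < C ∧ ∀ (x y : Γ) (K l : ℕ), 1 ≤ K → K ≤ l + 1 → l + 1 ≤ 2 * K →
      G.heat l y x ≤ C / G.vol y ((K : ℝ) ^ (1 / m)) *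
        ((1 + (G.dist x y : ℝ) / (K : ℝ) ^ (1 / m)) ^ N)⁻¹ := by
  obtain ⟨C, c, hc, h⟩ := hUE
  obtain ⟨C', hC', h'⟩ := exp_neg_le_decay hc N
  refine ⟨(|C| + 1) * C', by positivity, fun x y K l hK hKl hlK => ?_⟩
  have hm0 : 0 < m := by linarith
  have hK0 : (0 : ℝ) < K := by exact_mod_cast hK
  set ρ : ℝ := (K : ℝ) ^ (1 / m) with hρ
  have hρ0 : 0 < ρ := Real.rpow_pos_of_pos hK0 _
  have hρm : ρ ^ m = K := by
    rw [hρ, ← Real.rpow_mul hK0.le, one_div_mul_cancel hm0.ne', Real.rpow_one]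
  have hk := h x y (l + 1) (by omega)
  rw [Nat.add_sub_cancel] at hk
  have hwy : (0 : ℝ) < G.weight y := by exact_mod_cast hw y
  have hv : 0 < G.vol y ρ := G.vol_pos hw y hρ0
  have hv' : G.vol y ρ ≤ G.vol y (((l + 1 : ℕ) : ℝ) ^ (1 / m)) :=
    G.vol_mono y (Real.rpow_le_rpow hK0.le (by exact_mod_cast hKl) (by positivity))
  set t : ℝ := (G.dist x y : ℝ) / ρ with ht
  have ht0 : 0 ≤ t := by positivity
  have hexp : (t - 1) / 2 ≤ ((G.dist x y : ℝ) ^ m / ((l + 1 : ℕ) : ℝ)) ^ (1 / (m - 1)) := by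
    rcases lt_or_ge t 1 with h1 | h1
    · have : (0 : ℝ) ≤ ((G.dist x y : ℝ) ^ m / ((l + 1 : ℕ) : ℝ)) ^ (1 / (m - 1)) := by positivity
      linarith
    · have h2 : (t / 2) ^ (m - 1) ≤ (G.dist x y : ℝ) ^ m / ((l + 1 : ℕ) : ℝ) := by
        have h3 : (G.dist x y : ℝ) ^ m = t ^ m * K := by
          rw [ht, Real.div_rpow (by positivity) hρ0.le, hρm]
          field_simp
        have h4 : t ^ m / 2 ≤ (G.dist x y : ℝ) ^ m / ((l + 1 : ℕ) : ℝ) := by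
          rw [h3, div_le_div_iff₀ two_pos (by positivity), mul_assoc]
          gcongr
          rw [mul_comm]
          exact_mod_cast hlK
        refine le_trans ?_ h4
        rw [Real.div_rpow ht0 two_pos.le]
        gcongr
        · linarith
        · calc (2 : ℝ) = 2 ^ (1 : ℝ) := (Real.rpow_one 2).symm
            _ ≤ 2 ^ (m - 1) := Real.rpow_le_rpow_of_exponent_le one_le_two (by linarith)
      calc (t - 1) / 2 ≤ t / 2 := by linarith
        _ = ((t / 2) ^ (m - 1)) ^ (1 / (m - 1)) := by
          rw [← Real.rpow_mul (by positivity), mul_one_div_cancel (by linarith), Real.rpow_one]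
        _ ≤ _ := Real.rpow_le_rpow (by positivity) h2
          (one_div_nonneg.2 (by linarith))
  have hexp2 : Real.exp (-c * ((G.dist x y : ℝ) ^ m / ((l + 1 : ℕ) : ℝ)) ^ (1 / (m - 1))) ≤
      C' * ((1 + t) ^ N)⁻¹ :=
    (Real.exp_le_exp.2 (by nlinarith)).trans (h' t ht0)
  rw [heat, div_le_iff₀ hwy]
  calc _ ≤ _ := hk
    _ ≤ (|C| + 1) * (G.weight y / G.vol y ρ) * (C' * ((1 + t) ^ N)⁻¹) := by
        have hC : C ≤ |C| + 1 := by linarith [le_abs_self C]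
        have hv'' : (0 : ℝ) ≤ G.weight y / G.vol y (((l + 1 : ℕ) : ℝ) ^ (1 / m)) :=
          div_nonneg hwy.le (G.vol_nonneg y _)
        gcongr
    _ = _ := by ring

theorem lintegral_edgeMeasure (hw : ∀ x, 0 < G.weight x) (H : Γ × Γ → ℝ≥0∞) :
    ∫⁻ e, H e ∂G.edgeMeasure =
      ∫⁻ x, ∑ z ∈ G.neighbours x, ENNReal.ofReal (G.p x z) * H (x, z) ∂G.measure := by
  rw [lintegral_measure, edgeMeasure, lintegral_sum_measure, ENNReal.tsum_prod']
  refine tsum_congr fun x => ?_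
  rw [tsum_eq_sum (s := G.neighbours x)]
  · simp only [lintegral_smul_measure, lintegral_dirac, smul_eq_mul, Finset.mul_sum, ← mul_assoc]
    refine Finset.sum_congr rfl fun z _ => ?_
    congr 1
    have : G.p x z = ((G.mu x z / G.weight x : ℝ≥0) : ℝ) := by rw [p, NNReal.coe_div]
    rw [this, ENNReal.ofReal_coe_nnreal, ← ENNReal.coe_mul, mul_div_cancel₀ _ (hw x).ne']
  · intro y hy
    simp [G.mu_eq_zero hy]

theorem lintegral_markov (hw : ∀ x, 0 < G.weight x) (F : Γ → ℝ≥0∞) :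
    ∫⁻ x, ∑ z ∈ G.neighbours x, ENNReal.ofReal (G.p x z) * F z ∂G.measure =
      ∫⁻ x, F x ∂G.measure := by
  rw [← G.measurePreserving_snd.lintegral_comp (f := F) Measurable.of_discrete,
    G.lintegral_edgeMeasure hw]

theorem lintegral_heat (hw : ∀ x, 0 < G.weight x) (k : ℕ) (y : Γ) :
    ∫⁻ x, ENNReal.ofReal (G.heat k y x) ∂G.measure = 1 := by
  induction k with
  | zero =>
    rw [lintegral_measure, tsum_eq_single y]
    · have h : (0 : ℝ) < G.weight y := by exact_mod_cast hw y
      rw [heat, kernel, if_pos rfl, ← ENNReal.ofReal_coe_nnreal, ← ENNReal.ofReal_mul h.le,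
        mul_one_div_cancel h.ne', ENNReal.ofReal_one]
    · intro x hx
      simp [heat, kernel, hx]
  | succ k ih =>
    rw [← ih, ← G.lintegral_markov hw fun x => ENNReal.ofReal (G.heat k y x)]
    refine lintegral_congr fun x => ?_
    rw [heat_succ, ENNReal.ofReal_sum_of_nonneg fun z _ =>
      mul_nonneg (G.p_nonneg x z) (G.heat_nonneg k y z)]
    exact Finset.sum_congr rfl fun z _ => ENNReal.ofReal_mul (G.p_nonneg x z)

/-! ### The gradient of the heat kernel -/

/-- An `ℓ¹` variant of the length of the gradient: `∑_z p(x,z)^{1/2} |f(z) - f(x)|`. -/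
def gradSum {E : Type*} [NormedAddCommGroup E] (f : Γ → E) (x : Γ) : ℝ≥0∞ :=
  ∑ z ∈ G.neighbours x, ENNReal.ofReal √(G.p x z) * ‖f z - f x‖ₑ

/-- The defect `P(u^{3/2}) - (Pu)^{3/2}` in Jensen's inequality for the Markov operator. -/
def jensenGap (u : Γ → ℝ) (x : Γ) : ℝ :=
  ∑ z ∈ G.neighbours x, G.p x z * (u z * √(u z)) -
    (∑ z ∈ G.neighbours x, G.p x z * u z) * √(∑ z ∈ G.neighbours x, G.p x z * u z)

theorem jensenGap_nonneg (hw : ∀ x, 0 < G.weight x) {u : Γ → ℝ} (hu : ∀ z, 0 ≤ u z) (x : Γ) :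
    0 ≤ G.jensenGap u x := by
  set W := (∑ z ∈ G.neighbours x, u z) + 1 with hW
  have hs : 0 ≤ ∑ z ∈ G.neighbours x, u z := Finset.sum_nonneg fun z _ => hu z
  have h1 := Finset.variance_le_sqrt_mul_jensen_gap (G.neighbours x) (G.p x) u (W := W)
    (fun z _ => G.p_nonneg x z) (G.sum_p hw x) (fun z _ => hu z) (fun z hz => by
      have := Finset.single_le_sum (fun z _ => hu z) hz
      linarith)
  have h2 : 0 ≤ 4 * √W * G.jensenGap u x :=
    le_trans (Finset.sum_nonneg fun z _ => mul_nonneg (G.p_nonneg x z) (sq_nonneg _)) h1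
  exact nonneg_of_mul_nonneg_right h2 (by positivity)

/-- The lower bound on `p(x,x)` turns the variance bound into a bound of the gradient of `u` by
the Jensen gap; `θ` is a free parameter. -/
theorem sqrt_p_mul_abs_sub_le (hw : ∀ x, 0 < G.weight x) {ε : ℝ} (hε : 0 < ε)
    (hLB : ∀ x, ε < G.p x x) {u : Γ → ℝ} (hu : ∀ z, 0 ≤ u z) {x : Γ} {W : ℝ}
    (huW : ∀ z ∈ G.neighbours x, u z ≤ W) {θ : ℝ} (hθ : 0 < θ) {z : Γ}
    (hz : z ∈ G.neighbours x) :
    √(G.p x z) * |u z - u x| ≤ θ * G.jensenGap u x + (2 + 2 / ε) / θ * √W := by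
  set J := G.jensenGap u x with hJ
  have hJ0 : 0 ≤ J := G.jensenGap_nonneg hw hu x
  set e := ∑ z ∈ G.neighbours x, G.p x z * u z with he
  have h1 : ∑ z ∈ G.neighbours x, G.p x z * (u z - e) ^ 2 ≤ 4 * √W * J :=
    Finset.variance_le_sqrt_mul_jensen_gap (G.neighbours x) (G.p x) u (W := W)
    (fun z _ => G.p_nonneg x z) (G.sum_p hw x) (fun z _ => hu z) huW
  have h2 : ∀ z ∈ G.neighbours x, G.p x z * (u z - e) ^ 2 ≤ 4 * √W * J := fun z hz =>
    (Finset.single_le_sum (f := fun z => G.p x z * (u z - e) ^ 2)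
      (fun z _ => mul_nonneg (G.p_nonneg x z) (sq_nonneg _)) hz).trans h1
  have hp1 : G.p x z ≤ 1 := by
    rw [← G.sum_p hw x]
    exact Finset.single_le_sum (fun z _ => G.p_nonneg x z) hz
  have h3 : (u x - e) ^ 2 ≤ 1 / ε * (4 * √W * J) := by
    rw [one_div, ← div_eq_inv_mul, le_div_iff₀ hε, mul_comm]
    exact (mul_le_mul_of_nonneg_right (hLB x).le (sq_nonneg _)).trans
      (h2 x (G.self_mem_neighbours hε hLB x))
  have h4 : G.p x z * (u z - u x) ^ 2 ≤ (2 + 2 / ε) * (4 * √W * J) := by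
    calc G.p x z * (u z - u x) ^ 2
        ≤ G.p x z * (2 * (u z - e) ^ 2 + 2 * (u x - e) ^ 2) := by
          refine mul_le_mul_of_nonneg_left ?_ (G.p_nonneg x z)
          nlinarith [sq_nonneg (u z - e + (u x - e))]
      _ = 2 * (G.p x z * (u z - e) ^ 2) + 2 * (G.p x z * (u x - e) ^ 2) := by ring
      _ ≤ 2 * (4 * √W * J) + 2 * (1 * (1 / ε * (4 * √W * J))) := by
          have := h2 z hz
          gcongr
      _ = _ := by ring
  rw [← sq_le_sq₀ (by positivity) (by positivity)]
  rw [mul_pow, sq_abs, Real.sq_sqrt (G.p_nonneg x z)]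
  refine h4.trans ?_
  have h5 : (θ * J) * ((2 + 2 / ε) / θ * √W) = (2 + 2 / ε) * (√W * J) := by
    field_simp
  nlinarith [sq_nonneg (θ * J - (2 + 2 / ε) / θ * √W)]

theorem gradSum_le (hw : ∀ x, 0 < G.weight x) {ε : ℝ} (hε : 0 < ε)
    (hLB : ∀ x, ε < G.p x x) {M : ℕ} (hM : ∀ x, (G.neighbours x).card ≤ M) {u : Γ → ℝ}
    (hu : ∀ z, 0 ≤ u z) {x : Γ} {W : ℝ} (huW : ∀ z ∈ G.neighbours x, u z ≤ W) {θ : ℝ}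
    (hθ : 0 < θ) :
    G.gradSum u x ≤ M * (ENNReal.ofReal (θ * G.jensenGap u x) +
      ENNReal.ofReal ((2 + 2 / ε) / θ * √W)) := by
  have hJ0 : 0 ≤ G.jensenGap u x := G.jensenGap_nonneg hw hu x
  calc G.gradSum u x ≤ ∑ z ∈ G.neighbours x, (ENNReal.ofReal (θ * G.jensenGap u x) +
      ENNReal.ofReal ((2 + 2 / ε) / θ * √W)) := by
        refine Finset.sum_le_sum fun z hz => ?_
        rw [← ENNReal.ofReal_add (by positivity) (by positivity), Real.enorm_eq_ofReal_abs,
          ← ENNReal.ofReal_mul (Real.sqrt_nonneg _)]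
        exact ENNReal.ofReal_le_ofReal (G.sqrt_p_mul_abs_sub_le hw hε hLB hu huW hθ hz)
    _ = (G.neighbours x).card * _ := by rw [Finset.sum_const, nsmul_eq_mul]
    _ ≤ _ := by
        gcongr
        exact_mod_cast hM x

/-- One step of the telescoping: as `P` preserves the integral, the integral of the Jensen gap of the
heat kernel is the decrease of the integral of its power `3 / 2` from time `k` to time `k + 1`. -/
theorem lintegral_jensenGap_heat_add (hw : ∀ x, 0 < G.weight x) (k : ℕ) (y : Γ) :
    ∫⁻ x, ENNReal.ofReal (G.jensenGap (G.heat k y) x) ∂G.measure +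
      ∫⁻ x, ENNReal.ofReal (G.heat (k + 1) y x * √(G.heat (k + 1) y x)) ∂G.measure =
      ∫⁻ x, ENNReal.ofReal (G.heat k y x * √(G.heat k y x)) ∂G.measure := by
  rw [← lintegral_add_left Measurable.of_discrete,
    ← G.lintegral_markov hw fun x => ENNReal.ofReal (G.heat k y x * √(G.heat k y x))]
  refine lintegral_congr fun x => ?_
  rw [← ENNReal.ofReal_add (G.jensenGap_nonneg hw (G.heat_nonneg k y) x)
    (mul_nonneg (G.heat_nonneg _ y x) (Real.sqrt_nonneg _)), heat_succ, jensenGap, sub_add_cancel,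
    ENNReal.ofReal_sum_of_nonneg fun z _ => mul_nonneg (G.p_nonneg x z)
      (mul_nonneg (G.heat_nonneg k y z) (Real.sqrt_nonneg _))]
  exact Finset.sum_congr rfl fun z _ => ENNReal.ofReal_mul (G.p_nonneg x z)

theorem sum_lintegral_jensenGap_heat_le (hw : ∀ x, 0 < G.weight x) (k n : ℕ) (y : Γ) :
    ∑ i ∈ Finset.range n, ∫⁻ x, ENNReal.ofReal (G.jensenGap (G.heat (k + i) y) x) ∂G.measure ≤
      ∫⁻ x, ENNReal.ofReal (G.heat k y x * √(G.heat k y x)) ∂G.measure := by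
  suffices h : ∑ i ∈ Finset.range n, ∫⁻ x, ENNReal.ofReal (G.jensenGap (G.heat (k + i) y) x)
      ∂G.measure + ∫⁻ x, ENNReal.ofReal (G.heat (k + n) y x * √(G.heat (k + n) y x)) ∂G.measure =
      ∫⁻ x, ENNReal.ofReal (G.heat k y x * √(G.heat k y x)) ∂G.measure from h ▸ le_self_add
  induction n with
  | zero => simp
  | succ n ih =>
    rw [Finset.sum_range_succ, add_assoc, ← add_assoc k, G.lintegral_jensenGap_heat_add hw, ih]

theorem lintegral_heat_mul_sqrt_le (hw : ∀ x, 0 < G.weight x) (k : ℕ) (y : Γ) {B : ℝ}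
    (hB : ∀ x, G.heat k y x ≤ B) :
    ∫⁻ x, ENNReal.ofReal (G.heat k y x * √(G.heat k y x)) ∂G.measure ≤ ENNReal.ofReal √B := by
  calc _ ≤ ∫⁻ x, ENNReal.ofReal (G.heat k y x) * ENNReal.ofReal √B ∂G.measure := by
        refine lintegral_mono fun x => ?_
        rw [← ENNReal.ofReal_mul (G.heat_nonneg k y x)]
        exact ENNReal.ofReal_le_ofReal (mul_le_mul_of_nonneg_left (Real.sqrt_le_sqrt (hB x))
          (G.heat_nonneg k y x))
    _ = _ := by rw [lintegral_mul_const _ Measurable.of_discrete, G.lintegral_heat hw, one_mul]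

/-- The gradient of the heat kernel away from its pole, summed over a dyadic block of times: the
Jensen gaps telescope over the block, and the bound on each gradient by its Jensen gap is used with
the value of `θ` that balances the two terms. -/
theorem sum_lintegral_gradSum_heat_le (hw : ∀ x, 0 < G.weight x) {ε : ℝ} (hε : 0 < ε)
    (hLB : ∀ x, ε < G.p x x) {M : ℕ} (hM : ∀ x, (G.neighbours x).card ≤ M)
    {D : ℝ} (hD0 : 0 ≤ D)
    (hD : ∀ (x : Γ) (r : ℝ), 0 < r → G.vol x (2 * r) ≤ D * G.vol x r)
    {m : ℝ} (hm : 2 < m) (hUE : G.UE m) :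
    ∃ C : ℝ, 0 < C ∧ ∀ (y : Γ) (K : ℕ) (r : ℝ), 1 ≤ K → 0 ≤ r →
      ∑ i ∈ Finset.range K, ∫⁻ x in {x | r ≤ G.dist x y}, G.gradSum (G.heat (K - 1 + i) y) x
        ∂G.measure ≤ ENNReal.ofReal (C * (√K * (√(1 + r / (K : ℝ) ^ (1 / m)))⁻¹)) := by
  obtain ⟨N, hN⟩ := pow_unbounded_of_one_lt (2 * D) one_lt_two
  obtain ⟨C₀, hC₀, hheat⟩ := G.heat_le hw hm hUE (2 * (N + 1))
  set A : ℝ := 2 + 2 / ε with hA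
  have hA0 : 0 < A := by positivity
  set P : ℝ := 2 ^ (N + 1) with hP
  refine ⟨(M + 1) * (√C₀ * (1 + A * P ^ 2)), by positivity, fun y K r hK hr => ?_⟩
  have hK0 : (0 : ℝ) < K := by exact_mod_cast hK
  set ρ : ℝ := (K : ℝ) ^ (1 / m) with hρ
  have hρ1 : 1 ≤ ρ := Real.one_le_rpow (by exact_mod_cast hK) (by positivity)
  have hρ0 : 0 < ρ := by linarith
  set v := G.vol y ρ with hv
  have hv0 : 0 < v := G.vol_pos hw y hρ0
  set s : ℝ := 1 + r / ρ with hs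
  have hs0 : 0 < s := by positivity
  -- with this value both terms of the bound of the gradient contribute `√K / √s`
  set θ : ℝ := √K * √v / √s with hθ
  have hθ0 : 0 < θ := by positivity
  set B : ℝ := C₀ / v with hB
  have hB0 : 0 < B := by positivity
  -- the upper estimate for the kernel at `x` and at its neighbours
  set W : Γ → ℝ := fun x => B * (P * ((1 + (G.dist x y : ℝ) / ρ) ^ (N + 1))⁻¹) ^ 2 with hW
  have hlW : ∀ i ∈ Finset.range K, ∀ x, ∀ z ∈ G.neighbours x, G.heat (K - 1 + i) y z ≤ W x := by
    intro i hi x z hz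
    rw [Finset.mem_range] at hi
    refine (hheat z y K (K - 1 + i) hK (by omega) (by omega)).trans ?_
    have h1 : (G.dist x y : ℝ) ≤ G.dist z y + 1 := by
      have h2 := G.dist_triangle_real x z y
      have h3 : (G.dist x z : ℝ) ≤ 1 := by exact_mod_cast G.dist_le_one hz
      linarith
    have h4 : 1 + (G.dist x y : ℝ) / ρ ≤ 2 * (1 + (G.dist z y : ℝ) / ρ) := by
      have h5 : (G.dist x y : ℝ) / ρ ≤ G.dist z y / ρ + 1 := by
        rw [div_add_one hρ0.ne']
        gcongr
        linarith
      have h6 : (0 : ℝ) ≤ G.dist z y / ρ := by positivity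
      linarith
    rw [hW]
    refine mul_le_mul_of_nonneg_left ?_ hB0.le
    rw [mul_comm 2 (N + 1), pow_mul, ← inv_pow]
    refine pow_le_pow_left₀ (by positivity) ?_ 2
    rw [← div_eq_mul_inv, le_div_iff₀ (by positivity), inv_mul_le_iff₀ (by positivity), hP,
      ← mul_pow, mul_comm _ (2 : ℝ)]
    exact pow_le_pow_left₀ (by positivity) h4 _
  have hsqrtW : ∀ x, r ≤ G.dist x y → A / θ * √(W x) ≤
      A / θ * (√B * P * s⁻¹) * ((1 + (G.dist x y : ℝ) / ρ) ^ N)⁻¹ := by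
    intro x hx
    have h1 : √(W x) = √B * (P * ((1 + (G.dist x y : ℝ) / ρ) ^ (N + 1))⁻¹) := by
      rw [hW, Real.sqrt_mul hB0.le, Real.sqrt_sq (by positivity)]
    have h2 : (1 + (G.dist x y : ℝ) / ρ)⁻¹ ≤ s⁻¹ := by
      rw [hs]; gcongr
    rw [h1, pow_succ, mul_inv]
    calc _ = A / θ * (√B * P * (1 + (G.dist x y : ℝ) / ρ)⁻¹) *
          ((1 + (G.dist x y : ℝ) / ρ) ^ N)⁻¹ := by ring
      _ ≤ _ := by gcongr
  have hBle : ∀ x, G.heat (K - 1) y x ≤ B := fun x => by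
    refine (hheat x y K (K - 1) hK (by omega) (by omega)).trans ?_
    refine mul_le_of_le_one_right hB0.le (inv_le_one_of_one_le₀ (one_le_pow₀ ?_))
    have h6 : (0 : ℝ) ≤ G.dist x y / ρ := by positivity
    linarith
  have hterm : ∀ i ∈ Finset.range K,
      ∫⁻ x in {x | r ≤ G.dist x y}, G.gradSum (G.heat (K - 1 + i) y) x ∂G.measure ≤
      M * (ENNReal.ofReal θ *
        ∫⁻ x, ENNReal.ofReal (G.jensenGap (G.heat (K - 1 + i) y) x) ∂G.measure +
        ENNReal.ofReal (A / θ * (√B * P * s⁻¹)) * ENNReal.ofReal (P * v)) := by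
    intro i hi
    calc _ ≤ ∫⁻ x in {x | r ≤ G.dist x y}, M * (ENNReal.ofReal θ * ENNReal.ofReal
            (G.jensenGap (G.heat (K - 1 + i) y) x) + ENNReal.ofReal (A / θ * (√B * P * s⁻¹)) *
            ENNReal.ofReal (((1 + (G.dist x y : ℝ) / ρ) ^ N)⁻¹)) ∂G.measure := by
          refine setLIntegral_mono Measurable.of_discrete fun x hx => ?_
          refine (G.gradSum_le hw hε hLB hM (G.heat_nonneg _ y) (hlW i hi x) hθ0).trans ?_
          rw [← ENNReal.ofReal_mul hθ0.le, ← ENNReal.ofReal_mul (by positivity)]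
          gcongr M * (_ + ENNReal.ofReal ?_)
          exact hsqrtW x hx
      _ ≤ ∫⁻ x, M * (ENNReal.ofReal θ * ENNReal.ofReal
            (G.jensenGap (G.heat (K - 1 + i) y) x) + ENNReal.ofReal (A / θ * (√B * P * s⁻¹)) *
            ENNReal.ofReal (((1 + (G.dist x y : ℝ) / ρ) ^ N)⁻¹)) ∂G.measure :=
          setLIntegral_le_lintegral _ _
      _ ≤ _ := by
          rw [lintegral_const_mul _ Measurable.of_discrete,
            lintegral_add_left Measurable.of_discrete,
            lintegral_const_mul _ Measurable.of_discrete,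
            lintegral_const_mul _ Measurable.of_discrete]
          gcongr
          exact G.lintegral_decay_le hD0 hD hN.le y hρ0
  calc _ ≤ ∑ i ∈ Finset.range K, M * (ENNReal.ofReal θ *
        ∫⁻ x, ENNReal.ofReal (G.jensenGap (G.heat (K - 1 + i) y) x) ∂G.measure +
        ENNReal.ofReal (A / θ * (√B * P * s⁻¹)) * ENNReal.ofReal (P * v)) :=
        Finset.sum_le_sum hterm
    _ = M * (ENNReal.ofReal θ * ∑ i ∈ Finset.range K,
        ∫⁻ x, ENNReal.ofReal (G.jensenGap (G.heat (K - 1 + i) y) x) ∂G.measure +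
        K * (ENNReal.ofReal (A / θ * (√B * P * s⁻¹)) * ENNReal.ofReal (P * v))) := by
        rw [← Finset.mul_sum, Finset.sum_add_distrib, ← Finset.mul_sum, Finset.sum_const,
          Finset.card_range, nsmul_eq_mul]
    _ ≤ M * (ENNReal.ofReal θ * ENNReal.ofReal √B +
        K * (ENNReal.ofReal (A / θ * (√B * P * s⁻¹)) * ENNReal.ofReal (P * v))) := by
        gcongr
        exact (G.sum_lintegral_jensenGap_heat_le hw (K - 1) K y).trans
          (G.lintegral_heat_mul_sqrt_le hw _ y hBle)
    _ = ENNReal.ofReal (M * (θ * √B + K * ((A / θ * (√B * P * s⁻¹)) * (P * v)))) := by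
        have hZ : 0 ≤ A / θ * (√B * P * s⁻¹) := by positivity
        have hPv : 0 ≤ P * v := by positivity
        generalize A / θ * (√B * P * s⁻¹) = Z at hZ ⊢
        generalize P * v = Q at hPv ⊢
        rw [ENNReal.ofReal_mul (by positivity), ENNReal.ofReal_natCast,
          ENNReal.ofReal_add (by positivity) (by positivity), ENNReal.ofReal_mul hθ0.le,
          ENNReal.ofReal_mul (by positivity), ENNReal.ofReal_natCast,
          ENNReal.ofReal_mul hZ]
    _ ≤ _ := by
        refine ENNReal.ofReal_le_ofReal ?_
        have h1 : θ * √B + K * ((A / θ * (√B * P * s⁻¹)) * (P * v)) =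
            √C₀ * (1 + A * P ^ 2) * (√K * (√s)⁻¹) := by
          have hsK : √(K : ℝ) ^ 2 = K := Real.sq_sqrt hK0.le
          have hsv : √v ^ 2 = v := Real.sq_sqrt hv0.le
          have hss : √s ^ 2 = s := Real.sq_sqrt hs0.le
          have e1 : √B = √C₀ / √v := by rw [hB, Real.sqrt_div hC₀.le]
          have p1 : 0 < √(K : ℝ) := by positivity
          have p2 : 0 < √v := by positivity
          have p3 : 0 < √s := by positivity
          rw [e1, hθ]
          generalize √(K : ℝ) = a at *
          generalize √v = b at *
          generalize √s = q at *
          rw [← hsK, ← hsv, ← hss]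
          field_simp
        rw [h1, mul_assoc (_ + 1 : ℝ)]
        gcongr
        linarith

end Measure

end WeightedGraph

/-! ### The power series of `(1 - z) ^ (-1 / 2)` -/

/-- The coefficients of the power series `(1 - z) ^ (-1 / 2) = ∑ a_k z ^ k`. -/
def invSqrtCoeff (k : ℕ) : ℝ := Ring.choose ((1 / 2 : ℝ) + k - 1) k

theorem hasSum_invSqrtCoeff {z : ℝ} (hz : |z| < 1) :
    HasSum (fun k => invSqrtCoeff k * z ^ k) (√(1 - z))⁻¹ := by
  have h := (Real.one_div_one_sub_rpow_hasFPowerSeriesOnBall_zero (1 / 2)).hasSum (y := z)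
    (by simpa [enorm_eq_nnnorm, ← NNReal.coe_lt_coe] using hz)
  simp only [FormalMultilinearSeries.ofScalars_apply_eq, smul_eq_mul, zero_add,
    ← Real.sqrt_eq_rpow, one_div (√(1 - z))] at h
  exact h

theorem invSqrtCoeff_zero : invSqrtCoeff 0 = 1 := by
  rw [invSqrtCoeff, Ring.choose_zero_right]

theorem invSqrtCoeff_succ (k : ℕ) :
    invSqrtCoeff (k + 1) = (2 * k + 1) / (2 * k + 2) * invSqrtCoeff k := by
  have h : ∀ k : ℕ, (k.factorial : ℝ) * invSqrtCoeff k = (ascPochhammer ℝ k).eval (1 / 2) := by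
    intro k
    rw [invSqrtCoeff, ← Ring.multichoose_eq, ← nsmul_eq_mul,
      Ring.factorial_nsmul_multichoose_eq_ascPochhammer, Polynomial.ascPochhammer_smeval_eq_eval]
  have h1 := h (k + 1)
  rw [ascPochhammer_succ_eval, ← h k, Nat.factorial_succ] at h1
  push_cast at h1
  have h2 : (k.factorial : ℝ) ≠ 0 := by positivity
  have h3 : (k + 1 : ℝ) * invSqrtCoeff (k + 1) = invSqrtCoeff k * (1 / 2 + k) :=
    mul_left_cancel₀ h2 (by linarith)
  field_simp
  linarith

theorem invSqrtCoeff_pos (k : ℕ) : 0 < invSqrtCoeff k := by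
  induction k with
  | zero => rw [invSqrtCoeff_zero]; exact one_pos
  | succ k ih => rw [invSqrtCoeff_succ]; positivity

theorem invSqrtCoeff_sub_succ (k : ℕ) :
    invSqrtCoeff k - invSqrtCoeff (k + 1) = invSqrtCoeff k / (2 * (k + 1)) := by
  rw [invSqrtCoeff_succ]
  field_simp
  ring

theorem antitone_invSqrtCoeff : Antitone invSqrtCoeff := by
  refine antitone_nat_of_succ_le fun k => ?_
  have h1 := invSqrtCoeff_sub_succ k
  have h2 := invSqrtCoeff_pos k
  have h3 : 0 ≤ invSqrtCoeff k / (2 * (k + 1)) := by positivity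
  linarith

theorem invSqrtCoeff_le (k : ℕ) : invSqrtCoeff k ≤ (√(k + 1))⁻¹ := by
  have h : invSqrtCoeff k ^ 2 * (k + 1) ≤ 1 := by
    induction k with
    | zero => simp [invSqrtCoeff_zero]
    | succ k ih =>
      rw [invSqrtCoeff_succ]
      have h1 : ((2 * k + 1) / (2 * k + 2)) ^ 2 * (k + 2) ≤ (k + 1 : ℝ) := by
        rw [div_pow, div_mul_eq_mul_div, div_le_iff₀ (by positivity)]
        nlinarith
      calc _ = invSqrtCoeff k ^ 2 * (((2 * k + 1) / (2 * k + 2)) ^ 2 * (k + 2)) := by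
            push_cast; ring
        _ ≤ invSqrtCoeff k ^ 2 * (k + 1) := by gcongr
        _ ≤ 1 := ih
  rw [← div_le_div_iff_of_pos_right (c := (√(k + 1 : ℝ))⁻¹) (by positivity), div_self (by positivity),
    div_inv_eq_mul, ← sq_le_one_iff₀ (mul_nonneg (invSqrtCoeff_pos k).le (Real.sqrt_nonneg _)),
    mul_pow, Real.sq_sqrt (by positivity)]
  exact h

theorem sum_invSqrtCoeff (n : ℕ) :
    ∑ i ∈ Finset.range n, invSqrtCoeff i = 2 * n * invSqrtCoeff n := by
  induction n with
  | zero => simp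
  | succ n ih =>
    rw [Finset.sum_range_succ, ih, invSqrtCoeff_succ]
    push_cast
    field_simp

theorem sum_invSqrtCoeff_le (n : ℕ) : ∑ i ∈ Finset.range n, invSqrtCoeff i ≤ 2 * √n := by
  rw [sum_invSqrtCoeff]
  rcases Nat.eq_zero_or_pos n with rfl | hn
  · simp
  have hn' : (0 : ℝ) < n := by exact_mod_cast hn
  have h1 : invSqrtCoeff n ≤ (√n)⁻¹ :=
    (invSqrtCoeff_le n).trans (by gcongr; linarith)
  calc 2 * n * invSqrtCoeff n ≤ 2 * n * (√n)⁻¹ := by gcongr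
    _ = 2 * (n / √n) := by ring
    _ = 2 * √n := by rw [Real.div_sqrt]

theorem invSqrtCoeff_sub_le (q p : ℕ) :
    invSqrtCoeff q - invSqrtCoeff (q + p) ≤ p * (invSqrtCoeff q / (2 * (q + 1))) := by
  induction p with
  | zero => simp
  | succ p ih =>
    have h1 := invSqrtCoeff_sub_succ (q + p)
    have h2 : invSqrtCoeff (q + p) / (2 * ((q + p : ℕ) + 1)) ≤ invSqrtCoeff q / (2 * (q + 1)) := by
      have := (invSqrtCoeff_pos q).le
      have := antitone_invSqrtCoeff (Nat.le_add_right q p)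
      gcongr
      simp
    rw [← add_assoc]
    push_cast at *
    linarith

/-! ### The power series of `(1 - z) ^ (-1 / 2) (1 - A(z))` for an average `A` of powers -/

/-- The average `(1/n) ∑_{n ≤ j < 2n} z ^ j`. -/
def powAverage {R : Type*} [Ring R] [Algebra ℝ R] (n : ℕ) (z : R) : R :=
  (n : ℝ)⁻¹ • ∑ j ∈ Finset.range n, z ^ (n + j)

/-- The coefficients of `(1 - z) ^ (-1 / 2) z ^ j`. -/
def invSqrtShift (j k : ℕ) : ℝ := if j ≤ k then invSqrtCoeff (k - j) else 0

/-- The coefficients of the power series of `(1 - z) ^ (-1 / 2) (1 - A(z))`, where `A(z)` is the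
average of the `z ^ j` for `n ≤ j < 2n`. -/
def regCoeff (n k : ℕ) : ℝ :=
  invSqrtCoeff k - (n : ℝ)⁻¹ * ∑ j ∈ Finset.range n, invSqrtShift (n + j) k

theorem hasSum_invSqrtShift {z : ℝ} (hz : |z| < 1) (j : ℕ) :
    HasSum (fun k => invSqrtShift j k * z ^ k) (z ^ j * (√(1 - z))⁻¹) := by
  have h := (hasSum_invSqrtCoeff hz).mul_left (z ^ j)
  rw [← (add_left_injective j).hasSum_iff]
  · refine h.congr_fun fun k => ?_
    simp [invSqrtShift, pow_add]
    ring
  · intro k hk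
    have : ¬ j ≤ k := fun hjk => hk ⟨k - j, Nat.sub_add_cancel hjk⟩
    simp [invSqrtShift, this]

theorem hasSum_regCoeff {z : ℝ} (hz : |z| < 1) (n : ℕ) :
    HasSum (fun k => regCoeff n k * z ^ k) ((1 - powAverage n z) * (√(1 - z))⁻¹) := by
  have h := (hasSum_invSqrtCoeff hz).sub
    ((hasSum_sum (s := Finset.range n) fun j _ => hasSum_invSqrtShift hz (n + j)).mul_left (n : ℝ)⁻¹)
  have e : (1 - powAverage n z) * (√(1 - z))⁻¹ =
      (√(1 - z))⁻¹ - (n : ℝ)⁻¹ * ∑ j ∈ Finset.range n, z ^ (n + j) * (√(1 - z))⁻¹ := by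
    rw [powAverage, smul_eq_mul, sub_mul, one_mul, mul_assoc, Finset.sum_mul]
  rw [e]
  refine h.congr_fun fun k => ?_
  rw [regCoeff, sub_mul, mul_assoc, Finset.sum_mul]

/-- The coefficients have the size of those of `(1 - z) ^ (-1 / 2)` for `k ≲ n`, and gain a factor
`n / k` for `k ≳ n`, where averages of shifted coefficients differ little from the coefficients. -/
theorem abs_regCoeff_le {n : ℕ} (hn : 1 ≤ n) (k : ℕ) :
    |regCoeff n k| ≤ 36 * (min 1 ((n : ℝ) / (k + 1)) * (√(k + 1))⁻¹) := by
  have hn0 : (0 : ℝ) < n := by exact_mod_cast hn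
  have hk0 : (0 : ℝ) < (k : ℝ) + 1 := by positivity
  have ha := invSqrtCoeff_pos k
  rcases le_or_gt (k + 1) (4 * n) with hk | hk
  · have hk' : (k : ℝ) + 1 ≤ 4 * n := by exact_mod_cast hk
    have h1 : ∑ j ∈ Finset.range n, invSqrtShift (n + j) k ≤ 4 * √n := by
      rcases lt_or_ge k n with hkn | hkn
      · rw [Finset.sum_eq_zero]
        · positivity
        · intro j _
          rw [invSqrtShift, if_neg (by omega)]
      · obtain ⟨q, rfl⟩ := Nat.exists_eq_add_of_le hkn
        calc ∑ j ∈ Finset.range n, invSqrtShift (n + j) (n + q)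
            ≤ ∑ j ∈ Finset.range n, if j < q + 1 then invSqrtCoeff (q - j) else 0 := by
              refine Finset.sum_le_sum fun j _ => le_of_eq ?_
              rw [invSqrtShift, Nat.add_sub_add_left]
              simp only [Nat.add_le_add_iff_left, Nat.lt_succ_iff]
          _ = ∑ j ∈ (Finset.range n).filter (· < q + 1), invSqrtCoeff (q - j) := by
              rw [Finset.sum_filter]
          _ ≤ ∑ j ∈ Finset.range (q + 1), invSqrtCoeff (q - j) := by
              refine Finset.sum_le_sum_of_subset_of_nonneg (fun j hj => ?_)
                fun j _ _ => (invSqrtCoeff_pos _).le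
              exact Finset.mem_range.2 (Finset.mem_filter.1 hj).2
          _ = ∑ j ∈ Finset.range (q + 1), invSqrtCoeff j :=
              Finset.sum_range_reflect invSqrtCoeff (q + 1)
          _ ≤ 2 * √((q + 1 : ℕ) : ℝ) := sum_invSqrtCoeff_le _
          _ ≤ 2 * √(2 ^ 2 * n) := by
              gcongr
              push_cast at hk' ⊢
              linarith
          _ = 4 * √n := by
              rw [Real.sqrt_mul (by positivity), Real.sqrt_sq (by norm_num)]
              ring
    have h0 : 0 ≤ ∑ j ∈ Finset.range n, invSqrtShift (n + j) k := by
      refine Finset.sum_nonneg fun j _ => ?_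
      rw [invSqrtShift]
      split_ifs
      · exact (invSqrtCoeff_pos _).le
      · exact le_rfl
    have h2 : (n : ℝ)⁻¹ * ∑ j ∈ Finset.range n, invSqrtShift (n + j) k ≤ 8 * (√(k + 1))⁻¹ := by
      calc _ ≤ (n : ℝ)⁻¹ * (4 * √n) := by gcongr
        _ = 4 * (√n)⁻¹ := by
          have := Real.mul_self_sqrt hn0.le
          have h3 : 0 < √(n : ℝ) := by positivity
          nth_rewrite 1 [← this]
          field_simp
        _ ≤ 4 * (2 * (√(k + 1))⁻¹) := by
          gcongr
          rw [← div_eq_mul_inv, le_div_iff₀ (by positivity), inv_mul_le_iff₀ (by positivity)]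
          calc √((k : ℝ) + 1) ≤ √(2 ^ 2 * n) := by gcongr; linarith
            _ = √n * 2 := by
              rw [Real.sqrt_mul (by positivity), Real.sqrt_sq (by norm_num), mul_comm]
        _ = _ := by ring
    have h3 : 0 ≤ (n : ℝ)⁻¹ * ∑ j ∈ Finset.range n, invSqrtShift (n + j) k := by positivity
    have h4 := invSqrtCoeff_le k
    have h5 : (1 / 4 : ℝ) ≤ min 1 ((n : ℝ) / (k + 1)) := by
      refine le_min (by norm_num) ?_
      rw [div_le_div_iff₀ (by norm_num) hk0]
      linarith
    calc |regCoeff n k| ≤ 9 * (√(k + 1))⁻¹ := by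
          rw [regCoeff, abs_le]
          constructor <;> linarith
      _ = 36 * (1 / 4 * (√(k + 1))⁻¹) := by ring
      _ ≤ _ := by gcongr
  · obtain ⟨q, rfl⟩ : ∃ q, k = q + 2 * n := ⟨k - 2 * n, by omega⟩
    have hq0 : (0 : ℝ) < (q : ℝ) + 1 := by positivity
    have hq : ((q + 2 * n : ℕ) : ℝ) + 1 ≤ 2 * (q + 1) := by
      have : q + 2 * n + 1 ≤ 2 * (q + 1) := by omega
      exact_mod_cast this
    set k := q + 2 * n with hkdef
    have h1 : ∀ j ∈ Finset.range n, invSqrtCoeff k ≤ invSqrtShift (n + j) k ∧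
        invSqrtShift (n + j) k ≤ invSqrtCoeff q := by
      intro j hj
      rw [Finset.mem_range] at hj
      rw [invSqrtShift, if_pos (by omega)]
      exact ⟨antitone_invSqrtCoeff (by omega), antitone_invSqrtCoeff (by omega)⟩
    have h2 : invSqrtCoeff k ≤ (n : ℝ)⁻¹ * ∑ j ∈ Finset.range n, invSqrtShift (n + j) k := by
      rw [← div_eq_inv_mul, le_div_iff₀ hn0, mul_comm]
      calc _ = ∑ j ∈ Finset.range n, invSqrtCoeff k := by simp
        _ ≤ _ := Finset.sum_le_sum fun j hj => (h1 j hj).1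
    have h3 : (n : ℝ)⁻¹ * ∑ j ∈ Finset.range n, invSqrtShift (n + j) k ≤ invSqrtCoeff q := by
      rw [inv_mul_le_iff₀ hn0]
      calc _ ≤ ∑ j ∈ Finset.range n, invSqrtCoeff q := Finset.sum_le_sum fun j hj => (h1 j hj).2
        _ = _ := by simp
    have h4 := invSqrtCoeff_sub_le q (2 * n)
    have h5 := invSqrtCoeff_le q
    have h6 : (√((q : ℝ) + 1))⁻¹ ≤ 2 * (√(k + 1))⁻¹ := by
      rw [← div_eq_mul_inv, le_div_iff₀ (by positivity), inv_mul_le_iff₀ (by positivity)]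
      calc √((k : ℝ) + 1) ≤ √(2 ^ 2 * (q + 1)) := by gcongr; linarith
        _ = √(q + 1) * 2 := by
          rw [Real.sqrt_mul (by positivity), Real.sqrt_sq (by norm_num), mul_comm]
    have h7 : min 1 ((n : ℝ) / (k + 1)) = n / (k + 1) := by
      refine min_eq_right ?_
      rw [div_le_one hk0]
      have : n ≤ k + 1 := by omega
      exact_mod_cast this
    rw [h7]
    calc |regCoeff n k| ≤ ((2 * n : ℕ) : ℝ) * (invSqrtCoeff q / (2 * (q + 1))) := by
          rw [regCoeff, abs_le]
          constructor <;> linarith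
      _ = n / (q + 1) * invSqrtCoeff q := by
          push_cast
          field_simp
      _ ≤ (2 * (n / (k + 1))) * (2 * (√(k + 1))⁻¹) := by
          have h8 : (n : ℝ) / (q + 1) ≤ 2 * (n / (k + 1)) := by
            rw [mul_div_assoc', div_le_div_iff₀ hq0 hk0]
            nlinarith
          have := (invSqrtCoeff_pos q).le
          gcongr
          exact h5.trans h6
      _ ≤ _ := by
          have : 0 ≤ (n : ℝ) / (k + 1) * (√(k + 1))⁻¹ := by positivity
          linarith

theorem summable_abs_regCoeff {n : ℕ} (hn : 1 ≤ n) : Summable fun k => |regCoeff n k| := by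
  have h : Summable fun k : ℕ => 36 * n * (1 / ((k : ℝ) + 1) ^ (3 / 2 : ℝ)) := by
    have h1 := (summable_nat_add_iff 1).2 (Real.summable_one_div_nat_rpow (p := 3 / 2) |>.2
      (by norm_num))
    push_cast at h1
    exact h1.mul_left _
  refine h.of_nonneg_of_le (fun k => abs_nonneg _) fun k => (abs_regCoeff_le hn k).trans ?_
  have hk0 : (0 : ℝ) < (k : ℝ) + 1 := by positivity
  have h2 : ((k : ℝ) + 1) ^ (3 / 2 : ℝ) = (k + 1) * √(k + 1) := by
    rw [Real.sqrt_eq_rpow, show (3 / 2 : ℝ) = 1 + 1 / 2 by norm_num, Real.rpow_add hk0,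
      Real.rpow_one]
  rw [h2]
  calc 36 * (min 1 ((n : ℝ) / (k + 1)) * (√(k + 1))⁻¹)
      ≤ 36 * ((n : ℝ) / (k + 1) * (√(k + 1))⁻¹) := by
        gcongr
        exact min_le_right _ _
    _ = _ := by field_simp

/-- The identity of power series extends from `(-1, 1)` to the end points by continuity. -/
theorem tsum_regCoeff_mul_sqrt {n : ℕ} (hn : 1 ≤ n) {z : ℝ} (hz : z ∈ Set.Icc (-1 : ℝ) 1) :
    √(1 - z) * ∑' k, regCoeff n k * z ^ k = 1 - powAverage n z := by
  have hcont : ContinuousOn (fun z : ℝ => ∑' k, regCoeff n k * z ^ k) (Set.Icc (-1) 1) := by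
    refine continuousOn_tsum (fun k => by fun_prop) (summable_abs_regCoeff hn) fun k x hx => ?_
    rw [norm_mul, norm_pow, Real.norm_eq_abs, Real.norm_eq_abs]
    exact mul_le_of_le_one_right (abs_nonneg _) (pow_le_one₀ (abs_nonneg _) (abs_le.2 hx))
  have heq : Set.EqOn (fun z : ℝ => √(1 - z) * ∑' k, regCoeff n k * z ^ k)
      (fun z => 1 - powAverage n z) (Set.Icc (-1) 1) := by
    refine Set.EqOn.of_subset_closure (s := Set.Ioo (-1) 1) ?_ ?_ ?_ Set.Ioo_subset_Icc_self ?_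
    · intro x hx
      have hx1 : 0 < 1 - x := by linarith [hx.2]
      simp only [(hasSum_regCoeff (abs_lt.2 hx) n).tsum_eq]
      rw [mul_comm, mul_assoc, inv_mul_cancel₀ (by positivity), mul_one]
    · exact ContinuousOn.mul (by fun_prop) hcont
    · unfold powAverage
      fun_prop
    · rw [closure_Ioo (by norm_num)]
  exact heq hz

/-! ### The functional calculus -/

theorem hasSum_cfc_powerSeries {A : Type*} [CStarAlgebra A] {a : A} (ha : IsSelfAdjoint a)
    (hspec : spectrum ℝ a ⊆ Set.Icc (-1) 1) {c : ℕ → ℝ} (hc : Summable fun k => |c k|) :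
    HasSum (fun k => c k • a ^ k) (cfc (fun z : ℝ => ∑' k, c k * z ^ k) a) := by
  have hu : TendstoUniformlyOn (fun (t : Finset ℕ) (z : ℝ) => ∑ k ∈ t, c k * z ^ k)
      (fun z => ∑' k, c k * z ^ k) Filter.atTop (spectrum ℝ a) := by
    refine tendstoUniformlyOn_tsum hc fun k z hz => ?_
    rw [norm_mul, norm_pow, Real.norm_eq_abs, Real.norm_eq_abs]
    exact mul_le_of_le_one_right (abs_nonneg _) (pow_le_one₀ (abs_nonneg _) (abs_le.2 (hspec hz)))
  have h := tendsto_cfc_fun hu (Filter.Eventually.of_forall fun t => by fun_prop)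
  refine h.congr fun t => ?_
  have e : (fun z : ℝ => ∑ k ∈ t, c k * z ^ k) = fun z =>
      (∑ k ∈ t, Polynomial.C (c k) * Polynomial.X ^ k).eval z := by
    funext z
    simp [Polynomial.eval_finsetSum]
  rw [e, cfc_polynomial _ _ ha]
  simp [Algebra.smul_def]

section Operator

variable {H : Type*} [NormedAddCommGroup H] [InnerProductSpace ℂ H] [CompleteSpace H]

theorem spectrum_subset_Icc_of_norm_le_one {P : H →L[ℂ] H} (hn : ‖P‖ ≤ 1) :
    spectrum ℝ P ⊆ Set.Icc (-1) 1 := fun z hz => by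
  have h := spectrum.norm_le_norm_mul_of_mem hz
  have h1 : ‖(1 : H →L[ℂ] H)‖ ≤ 1 := ContinuousLinearMap.norm_id_le
  rw [Real.norm_eq_abs] at h
  exact abs_le.1 (h.trans (mul_le_one₀ hn (norm_nonneg _) h1))

/-- The range of `(1 - P)^{1/2}` contains that of `1 - A`, for `A` the average of the powers `P ^ j`
with `n ≤ j < 2n`, and a preimage is given by a norm-convergent power series in `P`. -/
theorem operatorSqrt_mul_tsum_regCoeff {P : H →L[ℂ] H} (hP : IsSelfAdjoint P) (hn : ‖P‖ ≤ 1)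
    (hpos : 0 ≤ 1 - P) {n : ℕ} (h1n : 1 ≤ n) :
    operatorSqrt (1 - P) * ∑' k, regCoeff n k • P ^ k = 1 - powAverage n P := by
  have hspec := spectrum_subset_Icc_of_norm_le_one hn
  have hsum := hasSum_cfc_powerSeries hP hspec (summable_abs_regCoeff h1n)
  have hsqrt : operatorSqrt (1 - P) = cfc (fun z : ℝ => √(1 - z)) P := by
    have e : (1 : H →L[ℂ] H) - P = cfc (fun z : ℝ => 1 - z) P := by
      rw [cfc_sub (fun _ : ℝ => (1 : ℝ)) (fun z => z) P, cfc_const_one ℝ P, cfc_id' ℝ P]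
    rw [operatorSqrt, CFC.sqrt_eq_real_sqrt _ hpos, cfcₙ_eq_cfc, e,
      ← cfc_comp' (fun z => √z) (fun z : ℝ => 1 - z) P]
  have hcont : ContinuousOn (fun z : ℝ => ∑' k, regCoeff n k * z ^ k) (spectrum ℝ P) := by
    refine continuousOn_tsum (fun k => by fun_prop) (summable_abs_regCoeff h1n) fun k x hx => ?_
    rw [norm_mul, norm_pow, Real.norm_eq_abs, Real.norm_eq_abs]
    exact mul_le_of_le_one_right (abs_nonneg _) (pow_le_one₀ (abs_nonneg _) (abs_le.2 (hspec hx)))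
  rw [hsum.tsum_eq, hsqrt, ← cfc_mul (fun z : ℝ => √(1 - z)) _ P (by fun_prop) hcont,
    cfc_congr (g := fun z : ℝ => (1 - Polynomial.C ((n : ℝ)⁻¹) * ∑ j ∈ Finset.range n,
      Polynomial.X ^ (n + j) : Polynomial ℝ).eval z), cfc_polynomial _ _ hP]
  · simp [powAverage, Algebra.smul_def]
  · intro z hz
    simp only [tsum_regCoeff_mul_sqrt h1n (hspec hz)]
    simp [powAverage, Polynomial.eval_finsetSum]

end Operator

namespace WeightedGraph

variable {Γ : Type*} (G : WeightedGraph Γ)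

section Measure

variable [MeasurableSpace Γ] [Countable Γ] [DiscreteMeasurableSpace Γ]

/-! ### The Laplacian and the differential on `L²` -/

theorem eq_of_ae_eq (hw : ∀ x, 0 < G.weight x) {E : Type*} {f g : Γ → E}
    (h : f =ᵐ[G.measure] g) : f = g :=
  funext fun x => G.ae_measure_iff.1 h x (hw x).ne'

theorem ae_edgeMeasure_iff {q : Γ × Γ → Prop} :
    (∀ᵐ e ∂G.edgeMeasure, q e) ↔ ∀ e : Γ × Γ, G.mu e.1 e.2 ≠ 0 → q e := by
  rw [edgeMeasure, Measure.ae_sum_iff]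
  refine forall_congr' fun x => ?_
  by_cases h : G.mu x.1 x.2 = 0
  · simp [h]
  · rw [Measure.ae_ennreal_smul_measure_iff (by simpa using h),
      ae_dirac_iff MeasurableSet.of_discrete]
    simp [h]

theorem coe_toLp (hw : ∀ x, 0 < G.weight x) {f : Γ → ℂ} {q : ℝ≥0∞} (hf : MemLp f q G.measure) :
    (hf.toLp f : Γ → ℂ) = f := G.eq_of_ae_eq hw hf.coeFn_toLp

theorem coe_add (hw : ∀ x, 0 < G.weight x) (f g : G.L2) :
    ((f + g : G.L2) : Γ → ℂ) = f + g := G.eq_of_ae_eq hw (Lp.coeFn_add f g)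

theorem coe_zero (hw : ∀ x, 0 < G.weight x) : ((0 : G.L2) : Γ → ℂ) = 0 :=
  G.eq_of_ae_eq hw (Lp.coeFn_zero ..)

theorem coe_real_smul (hw : ∀ x, 0 < G.weight x) (c : ℝ) (f : G.L2) :
    ((c • f : G.L2) : Γ → ℂ) = c • (f : Γ → ℂ) := G.eq_of_ae_eq hw (Lp.coeFn_smul c f)

theorem coe_sum (hw : ∀ x, 0 < G.weight x) {ι : Type*} (s : Finset ι) (f : ι → G.L2) :
    ((∑ i ∈ s, f i : G.L2) : Γ → ℂ) = ∑ i ∈ s, (f i : Γ → ℂ) := by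
  classical
  induction s using Finset.induction_on with
  | empty => simpa using G.coe_zero hw
  | insert i s hi ih => rw [Finset.sum_insert hi, Finset.sum_insert hi, G.coe_add hw, ih]

theorem coe_markovL2 (hw : ∀ x, 0 < G.weight x) (f : G.L2) :
    (G.markovL2 f : Γ → ℂ) = G.markov f := G.coe_toLp hw (G.memLp_markov (Lp.memLp f))

theorem coe_markovL2_pow (hw : ∀ x, 0 < G.weight x) (k : ℕ) (f : G.L2) :
    ((G.markovL2 ^ k) f : Γ → ℂ) = G.markov^[k] f := by
  induction k with
  | zero => rfl
  | succ k ih =>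
    rw [pow_succ', mul_apply_eq_comp, G.coe_markovL2 hw, ih,
      Function.iterate_succ_apply']

theorem norm_markovL2_le : ‖G.markovL2‖ ≤ 1 := LinearMap.mkContinuous_norm_le _ zero_le_one _

theorem coe_differential (f : G.L2) :
    (G.differential f : Γ × Γ → ℂ) =ᵐ[G.edgeMeasure] fun e => f e.2 - f e.1 := by
  have h1 := Lp.coeFn_compMeasurePreserving f G.measurePreserving_snd
  have h2 := Lp.coeFn_compMeasurePreserving f G.measurePreserving_fst
  have h3 := Lp.coeFn_sub (Lp.compMeasurePreserving Prod.snd G.measurePreserving_snd f)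
    (Lp.compMeasurePreserving Prod.fst G.measurePreserving_fst f)
  refine Filter.EventuallyEq.trans h3 ?_
  filter_upwards [h1, h2] with e h1 h2
  rw [Pi.sub_apply, h1, h2]
  rfl

theorem differential_apply (f : G.L2) {x y : Γ} (hy : y ∈ G.neighbours x) :
    (G.differential f : Γ × Γ → ℂ) (x, y) = f y - f x :=
  G.ae_edgeMeasure_iff.1 (G.coe_differential f) (x, y) (G.mem_neighbours.1 hy).ne'

theorem measurePreserving_swap :
    MeasurePreserving (MeasurableEquiv.prodComm : Γ × Γ ≃ᵐ Γ × Γ) G.edgeMeasure G.edgeMeasure := by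
  refine ⟨MeasurableEquiv.measurable _, Measure.ext_of_lintegral _ fun f _ => ?_⟩
  rw [lintegral_map Measurable.of_discrete (MeasurableEquiv.measurable _), edgeMeasure,
    lintegral_sum_measure, lintegral_sum_measure, ← (Equiv.prodComm Γ Γ).tsum_eq]
  refine tsum_congr fun e => ?_
  simp only [Equiv.prodComm_apply, Prod.fst_swap, Prod.snd_swap, lintegral_smul_measure,
    lintegral_dirac, G.symm e.2 e.1]
  rfl

/-- The mixed terms of the Dirichlet form both give the Markov operator, the second one by the
symmetry of the weight. -/
theorem inner_snd_fst (hw : ∀ x, 0 < G.weight x) (f g : G.L2) :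
    inner ℂ (Lp.compMeasurePreserving Prod.fst G.measurePreserving_fst f)
      (Lp.compMeasurePreserving Prod.snd G.measurePreserving_snd g) = inner ℂ f (G.markovL2 g) ∧
    inner ℂ (Lp.compMeasurePreserving Prod.snd G.measurePreserving_snd f)
      (Lp.compMeasurePreserving Prod.fst G.measurePreserving_fst g) = inner ℂ f (G.markovL2 g) := by
  set F : Γ × Γ → ℂ := fun e => inner ℂ (f e.1) (g e.2) with hF
  have hae : (fun e => inner ℂ ((Lp.compMeasurePreserving Prod.fst G.measurePreserving_fst f) e)
      ((Lp.compMeasurePreserving Prod.snd G.measurePreserving_snd g) e)) =ᵐ[G.edgeMeasure] F := by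
    filter_upwards [Lp.coeFn_compMeasurePreserving f G.measurePreserving_fst,
      Lp.coeFn_compMeasurePreserving g G.measurePreserving_snd] with e h1 h2
    rw [h1, h2]
    rfl
  have hae' : (fun e => inner ℂ ((Lp.compMeasurePreserving Prod.snd G.measurePreserving_snd f) e)
      ((Lp.compMeasurePreserving Prod.fst G.measurePreserving_fst g) e)) =ᵐ[G.edgeMeasure]
      fun e => F (MeasurableEquiv.prodComm e) := by
    filter_upwards [Lp.coeFn_compMeasurePreserving f G.measurePreserving_snd,
      Lp.coeFn_compMeasurePreserving g G.measurePreserving_fst] with e h1 h2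
    rw [h1, h2]
    rfl
  have hint : Integrable F G.edgeMeasure := (L2.integrable_inner _ _).congr hae
  have key : ∫ e, F e ∂G.edgeMeasure = inner ℂ f (G.markovL2 g) := by
    have h1 : HasSum (fun e : Γ × Γ => (G.mu e.1 e.2 : ℝ) • F e) (∫ e, F e ∂G.edgeMeasure) := by
      have := hasSum_integral_measure hint
      simp only [integral_smul_measure, integral_dirac, ENNReal.coe_toReal] at this
      exact this
    have h2 : HasSum (fun x => (G.weight x : ℝ) • inner ℂ (f x) (G.markovL2 g x))
        (∫ x, inner ℂ (f x) (G.markovL2 g x) ∂G.measure) := by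
      have := hasSum_integral_measure (L2.integrable_inner (𝕜 := ℂ) f (G.markovL2 g))
      simp only [integral_smul_measure, integral_dirac, ENNReal.coe_toReal] at this
      exact this
    rw [L2.inner_def]
    refine (h1.prod_fiberwise fun x => ?_).unique h2
    have h3 : (G.weight x : ℝ) • inner ℂ (f x) (G.markovL2 g x) =
        ∑ y ∈ G.neighbours x, (G.mu x y : ℝ) • F (x, y) := by
      have h4 : ((G.weight x : ℝ) : ℂ) ≠ 0 := by exact_mod_cast (hw x).ne'
      rw [G.coe_markovL2 hw, markov, inner_sum, Finset.smul_sum]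
      refine Finset.sum_congr rfl fun y _ => ?_
      simp only [hF, p, RCLike.inner_apply, Complex.real_smul]
      push_cast
      field_simp
    rw [h3]
    exact hasSum_sum_of_ne_finset_zero fun y hy => by simp [G.mu_eq_zero hy]
  constructor
  · rw [L2.inner_def, integral_congr_ae hae, key]
  · rw [L2.inner_def, integral_congr_ae hae', G.measurePreserving_swap.integral_comp', key]

/-- Integration by parts. -/
theorem inner_differential (hw : ∀ x, 0 < G.weight x) (f g : G.L2) :
    inner ℂ (G.differential f) (G.differential g) = 2 * inner ℂ f (G.laplacian g) := by
  obtain ⟨h1, h2⟩ := G.inner_snd_fst hw f g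
  have e : ∀ f : G.L2, G.differential f =
      Lp.compMeasurePreserving Prod.snd G.measurePreserving_snd f -
      Lp.compMeasurePreserving Prod.fst G.measurePreserving_fst f := fun f => rfl
  have h3 : inner ℂ (Lp.compMeasurePreserving Prod.snd G.measurePreserving_snd f)
      (Lp.compMeasurePreserving Prod.snd G.measurePreserving_snd g) = inner ℂ f g :=
    (Lp.compMeasurePreservingₗᵢ ℂ Prod.snd G.measurePreserving_snd).inner_map_map f g
  have h4 : inner ℂ (Lp.compMeasurePreserving Prod.fst G.measurePreserving_fst f)
      (Lp.compMeasurePreserving Prod.fst G.measurePreserving_fst g) = inner ℂ f g :=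
    (Lp.compMeasurePreservingₗᵢ ℂ Prod.fst G.measurePreserving_fst).inner_map_map f g
  rw [e, e, inner_sub_left, inner_sub_right, inner_sub_right, h1, h2, h3, h4, laplacian,
    sub_apply, one_apply_eq_self, inner_sub_right]
  ring

theorem laplacian_nonneg (hw : ∀ x, 0 < G.weight x) : 0 ≤ G.laplacian := by
  rw [ContinuousLinearMap.nonneg_iff_isPositive, ContinuousLinearMap.isPositive_def]
  constructor
  · intro f g
    have h1 := G.inner_differential hw f g
    have h2 := congrArg (starRingEnd ℂ) (G.inner_differential hw g f)
    rw [map_mul, inner_conj_symm, inner_conj_symm, h1, map_ofNat] at h2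
    exact (mul_left_cancel₀ two_ne_zero h2).symm
  · intro f
    have h1 := congrArg (starRingEnd ℂ) (G.inner_differential hw f f)
    rw [map_mul, inner_conj_symm, inner_conj_symm, map_ofNat] at h1
    rw [ContinuousLinearMap.reApplyInnerSelf_apply]
    have h2 : 0 ≤ RCLike.re (inner ℂ (G.differential f) (G.differential f)) :=
      inner_self_nonneg
    rw [h1] at h2
    simpa using h2

theorem isSelfAdjoint_markovL2 (hw : ∀ x, 0 < G.weight x) : IsSelfAdjoint G.markovL2 := by
  have h : G.markovL2 = 1 - G.laplacian := by rw [laplacian, sub_sub_cancel]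
  rw [h]
  exact (IsSelfAdjoint.one _).sub (IsSelfAdjoint.of_nonneg (G.laplacian_nonneg hw))

theorem sqrtLaplacian_sqrtLaplacian (hw : ∀ x, 0 < G.weight x) (f : G.L2) :
    G.sqrtLaplacian (G.sqrtLaplacian f) = G.laplacian f := by
  have h : G.sqrtLaplacian * G.sqrtLaplacian = G.laplacian :=
    CFC.sqrt_mul_sqrt_self _ (G.laplacian_nonneg hw)
  rw [← h, mul_apply_eq_comp]

theorem norm_differential_le (hw : ∀ x, 0 < G.weight x) (f : G.L2) :
    ‖G.differential f‖ ≤ √2 * ‖G.sqrtLaplacian f‖ := by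
  have hs : IsSelfAdjoint G.sqrtLaplacian := IsSelfAdjoint.of_nonneg (CFC.sqrt_nonneg _)
  have h1 : ((‖G.differential f‖ ^ 2 : ℝ) : ℂ) = ((2 * ‖G.sqrtLaplacian f‖ ^ 2 : ℝ) : ℂ) := by
    have e1 := inner_self_eq_norm_sq_to_K (𝕜 := ℂ) (G.differential f)
    have e2 := inner_self_eq_norm_sq_to_K (𝕜 := ℂ) (G.sqrtLaplacian f)
    have e3 := hs.isSymmetric f (G.sqrtLaplacian f)
    rw [G.inner_differential hw, ← G.sqrtLaplacian_sqrtLaplacian hw] at e1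
    push_cast
    refine e1.symm.trans (Eq.trans ?_ (congrArg (2 * ·) e2))
    exact congrArg (2 * ·) e3.symm
  have h2 : ‖G.differential f‖ ^ 2 = 2 * ‖G.sqrtLaplacian f‖ ^ 2 := by exact_mod_cast h1
  refine le_of_eq ?_
  rw [← Real.sqrt_sq (norm_nonneg (G.differential f)), h2, Real.sqrt_mul two_pos.le,
    Real.sqrt_sq (norm_nonneg _)]

/-- As the total mass is infinite, no nonzero constant is square integrable, and `Δ^{1/2}` has dense
range. -/
theorem denseRange_sqrtLaplacian (hw : ∀ x, 0 < G.weight x) (hinf : G.measure Set.univ = ∞) :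
    DenseRange (G.sqrtLaplacian : G.L2 →ₗ[ℂ] G.L2) := by
  have h : Dense ((LinearMap.range (G.sqrtLaplacian : G.L2 →ₗ[ℂ] G.L2) : Submodule ℂ G.L2) :
      Set G.L2) := by
    rw [Submodule.dense_iff_topologicalClosure_eq_top, Submodule.topologicalClosure_eq_top_iff,
      Submodule.eq_bot_iff]
    intro f hf
    have h1 : inner ℂ (G.laplacian f) f = 0 := by
      rw [← G.sqrtLaplacian_sqrtLaplacian hw]
      exact hf _ ⟨G.sqrtLaplacian f, rfl⟩
    have h2 : G.differential f = 0 := by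
      rw [← inner_self_eq_zero (𝕜 := ℂ), G.inner_differential hw, inner_eq_zero_symm.1 h1, mul_zero]
    have h3 : ∀ x, ∀ y ∈ G.neighbours x, f y = f x := by
      intro x y hy
      have h4 := G.differential_apply f hy
      rw [h2, G.ae_edgeMeasure_iff.1 (Lp.coeFn_zero ..) (x, y) (G.mem_neighbours.1 hy).ne'] at h4
      exact sub_eq_zero.1 h4.symm
    have h4 : ∀ x y, f x = f y := by
      intro x y
      obtain ⟨w⟩ := G.connected x y
      induction w with
      | nil => rfl
      | cons hadj _ ih =>
        rw [← ih]
        rw [SimpleGraph.fromRel_adj] at hadj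
        rcases hadj.2 with h | h
        · exact (h3 _ _ (G.mem_neighbours.2 h)).symm
        · exact h3 _ _ (G.mem_neighbours.2 h)
    rcases isEmpty_or_nonempty Γ with hΓ | ⟨⟨x⟩⟩
    · exact Lp.ext (by rw [Subsingleton.elim (f : Γ → ℂ) ((0 : G.L2) : Γ → ℂ)])
    have h5 : MemLp (fun _ : Γ => f x) 2 G.measure := by
      have h6 : (fun _ : Γ => f x) = f := funext fun y => h4 x y
      rw [h6]
      exact Lp.memLp f
    rw [memLp_const_iff two_ne_zero ENNReal.ofNat_ne_top, hinf] at h5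
    have h6 : f x = 0 := h5.resolve_right (lt_irrefl _)
    refine Lp.ext ?_
    rw [G.coe_zero hw]
    exact Filter.Eventually.of_forall fun y => by rw [h4 y x, h6, Pi.zero_apply]
  exact h

theorem rieszField_sqrtLaplacian (hw : ∀ x, 0 < G.weight x) (hinf : G.measure Set.univ = ∞)
    (g : G.L2) : G.rieszField (G.sqrtLaplacian g) = G.differential g :=
  LinearMap.extendOfNorm_eq (f := (G.differential : G.L2 →ₗ[ℂ] G.EdgeL2))
    (e := (G.sqrtLaplacian : G.L2 →ₗ[ℂ] G.L2)) (G.denseRange_sqrtLaplacian hw hinf)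
    ⟨√2, G.norm_differential_le hw⟩ g

theorem norm_rieszField_le (hw : ∀ x, 0 < G.weight x) (hinf : G.measure Set.univ = ∞)
    (f : G.L2) : ‖G.rieszField f‖ ≤ √2 * ‖f‖ :=
  LinearMap.norm_extendOfNorm_apply_le (f := (G.differential : G.L2 →ₗ[ℂ] G.EdgeL2))
    (e := (G.sqrtLaplacian : G.L2 →ₗ[ℂ] G.L2)) (G.denseRange_sqrtLaplacian hw hinf) (√2)
    (G.norm_differential_le hw) f

/-- The primitive of `b - A b` under `Δ^{1/2}`, for `A` an average of powers of `P`. -/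
def regPrimitive (n : ℕ) (b : G.L2) : G.L2 := (∑' k, regCoeff n k • G.markovL2 ^ k) b

theorem sqrtLaplacian_regPrimitive (hw : ∀ x, 0 < G.weight x) {n : ℕ} (hn : 1 ≤ n) (b : G.L2) :
    G.sqrtLaplacian (G.regPrimitive n b) = b - powAverage n G.markovL2 b := by
  have h := operatorSqrt_mul_tsum_regCoeff (G.isSelfAdjoint_markovL2 hw) G.norm_markovL2_le
    (G.laplacian_nonneg hw) hn
  have h1 := congrArg (fun T : G.L2 →L[ℂ] G.L2 => T b) h
  exact h1

end Measure

end WeightedGraph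

/-! ### Evaluation at an atom -/

section Eval

variable {α : Type*} [MeasurableSpace α] [MeasurableSingletonClass α] {μ : Measure α}

theorem MeasureTheory.enorm_apply_mul_measure_singleton_le (f : α → ℂ) (x : α) :
    ‖f x‖ₑ * μ {x} ^ (1 / 2 : ℝ) ≤ eLpNorm f 2 μ := by
  have h1 := eLpNorm_indicator_const (μ := μ) (p := 2) (c := f x) (measurableSet_singleton x)
    two_ne_zero ENNReal.ofNat_ne_top
  rw [ENNReal.toReal_ofNat] at h1
  rw [← h1]
  refine eLpNorm_mono fun y => ?_
  by_cases hy : y = x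
  · subst hy; simp
  · simp [hy]

theorem MeasureTheory.of_ae_of_measure_singleton_ne_zero {q : α → Prop} (h : ∀ᵐ a ∂μ, q a) {x : α}
    (hx : μ {x} ≠ 0) : q x := by
  by_contra hq
  exact hx (measure_mono_null (Set.singleton_subset_iff.2 hq) (ae_iff.1 h))

/-- Evaluation at an atom, as a continuous linear form on `L²`. -/
def MeasureTheory.evalL2 (x : α) (hx : μ {x} ≠ 0) (hx' : μ {x} ≠ ∞) : Lp ℂ 2 μ →L[ℂ] ℂ :=
  LinearMap.mkContinuous
    { toFun := fun f => f x
      map_add' := fun f g => of_ae_of_measure_singleton_ne_zero (Lp.coeFn_add f g) hx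
      map_smul' := fun c f => of_ae_of_measure_singleton_ne_zero (Lp.coeFn_smul c f) hx }
    ((μ {x} ^ (1 / 2 : ℝ))⁻¹).toReal (by
      intro f
      have h := enorm_apply_mul_measure_singleton_le (μ := μ) f x
      have h0 : μ {x} ^ (1 / 2 : ℝ) ≠ 0 := by simp [hx, hx']
      have h1 : μ {x} ^ (1 / 2 : ℝ) ≠ ∞ := by simp [hx, hx']
      rw [← ENNReal.le_div_iff_mul_le (Or.inl h0) (Or.inl h1), div_eq_mul_inv, mul_comm] at h
      have h2 := ENNReal.toReal_mono (ENNReal.mul_ne_top (ENNReal.inv_ne_top.2 h0)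
        (Lp.eLpNorm_ne_top f)) h
      rwa [ENNReal.toReal_mul, toReal_enorm, ← Lp.norm_def] at h2)

theorem MeasureTheory.evalL2_apply (x : α) (hx : μ {x} ≠ 0) (hx' : μ {x} ≠ ∞) (f : Lp ℂ 2 μ) :
    evalL2 x hx hx' f = f x := rfl

theorem MeasureTheory.Lp.enorm_sq_eq_lintegral (f : Lp ℂ 2 μ) :
    ‖f‖ₑ ^ 2 = ∫⁻ x, ‖f x‖ₑ ^ 2 ∂μ := by
  have h := eLpNorm_nnreal_pow_eq_lintegral (f := (f : α → ℂ)) (μ := μ) (p := 2) two_ne_zero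
  rw [Lp.enorm_def]
  simpa using h

end Eval

/-! ### Dyadic summation -/

/-- The blocks are `2 ^ j ≤ k + 1 < 2 ^ (j + 1)`. -/
theorem ENNReal.tsum_le_tsum_dyadic (F : ℕ → ℝ≥0∞) :
    ∑' k, F k ≤ ∑' j, ∑ i ∈ Finset.range (2 ^ j), F (2 ^ j - 1 + i) := by
  have key : ∀ J : ℕ, ∑ k ∈ Finset.range (2 ^ J - 1), F k =
      ∑ j ∈ Finset.range J, ∑ i ∈ Finset.range (2 ^ j), F (2 ^ j - 1 + i) := by
    intro J
    induction J with
    | zero => simp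
    | succ J ih =>
      rw [Finset.sum_range_succ, ← ih, ← Finset.sum_range_add]
      congr 2
      have := Nat.one_le_two_pow (n := J)
      rw [pow_succ]
      omega
  refine ENNReal.tsum_le_of_sum_range_le fun n => ?_
  calc ∑ k ∈ Finset.range n, F k ≤ ∑ k ∈ Finset.range (2 ^ n - 1), F k := by
        refine Finset.sum_le_sum_of_subset (Finset.range_mono ?_)
        have := Nat.lt_two_pow_self (n := n)
        omega
    _ ≤ _ := by
        rw [key]
        exact ENNReal.sum_le_tsum _

/-- A series that decays geometrically on both sides of the scale `2 ^ j = n` is bounded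
independently of `n`. -/
theorem exists_tsum_min_mul_min_le {δ : ℝ} (hδ : 0 < δ) (hδ1 : δ ≤ 1) :
    ∃ C : ℝ, 0 < C ∧ ∀ n : ℕ, 1 ≤ n →
      ∑' j : ℕ, ENNReal.ofReal (min 1 ((n : ℝ) / 2 ^ j) * min 1 ((2 ^ (j + 1) / (n : ℝ)) ^ δ)) ≤
        ENNReal.ofReal C := by
  set q : ℝ := (1 / 2 : ℝ) ^ δ with hq
  have hq0 : 0 < q := by positivity
  have hq1 : q < 1 := Real.rpow_lt_one (by norm_num) (by norm_num) hδ
  refine ⟨2 * (1 - q)⁻¹ + 2, by have := sub_pos.2 hq1; positivity, fun n hn => ?_⟩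
  have hn0 : (0 : ℝ) < n := by exact_mod_cast hn
  set J := Nat.log 2 n with hJ
  have hJ1 : (2 : ℝ) ^ J ≤ n := by exact_mod_cast Nat.pow_log_le_self 2 (by omega)
  have hJ2 : (n : ℝ) ≤ 2 ^ (J + 1) := by
    exact_mod_cast (Nat.lt_pow_succ_log_self one_lt_two n).le
  rw [← ENNReal.summable.sum_add_tsum_nat_add' (k := J + 1),
    ENNReal.ofReal_add (by have := sub_pos.2 hq1; positivity) two_pos.le]
  refine add_le_add ?_ ?_
  · calc _ ≤ ∑ j ∈ Finset.range (J + 1), ENNReal.ofReal (2 * q ^ (J - j)) := by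
          refine Finset.sum_le_sum fun j hj => ENNReal.ofReal_le_ofReal ?_
          have hj' : j ≤ J := Nat.lt_succ_iff.1 (Finset.mem_range.1 hj)
          have h1 : (2 ^ (j + 1) / (n : ℝ)) ^ δ ≤ 2 * q ^ (J - j) := by
            have h2 : (2 ^ (j + 1) / (n : ℝ)) ≤ 2 * (1 / 2) ^ (J - j) := by
              rw [div_le_iff₀ hn0]
              calc (2 : ℝ) ^ (j + 1) = 2 * (1 / 2) ^ (J - j) * 2 ^ J := by
                    have h3 : (2 : ℝ) ^ J = 2 ^ (J - j) * 2 ^ j := by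
                      rw [← pow_add, Nat.sub_add_cancel hj']
                    rw [h3, mul_assoc, ← mul_assoc ((1 / 2 : ℝ) ^ (J - j)), ← mul_pow]
                    norm_num
                    ring
                _ ≤ _ := by gcongr
            calc _ ≤ (2 * (1 / 2 : ℝ) ^ (J - j)) ^ δ := by gcongr
              _ = 2 ^ δ * q ^ (J - j) := by
                rw [Real.mul_rpow two_pos.le (by positivity), hq, ← Real.rpow_natCast,
                  ← Real.rpow_natCast, ← Real.rpow_mul (by norm_num), ← Real.rpow_mul (by norm_num),
                  mul_comm δ]
              _ ≤ 2 * q ^ (J - j) := by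
                gcongr
                calc (2 : ℝ) ^ δ ≤ 2 ^ (1 : ℝ) :=
                      Real.rpow_le_rpow_of_exponent_le one_le_two hδ1
                  _ = 2 := Real.rpow_one 2
          calc _ ≤ 1 * (2 ^ (j + 1) / (n : ℝ)) ^ δ := by
                gcongr
                · exact min_le_left _ _
                · exact min_le_right _ _
            _ ≤ _ := by rw [one_mul]; exact h1
      _ = ∑ j ∈ Finset.range (J + 1), ENNReal.ofReal (2 * q ^ j) :=
          Finset.sum_range_reflect (fun j => ENNReal.ofReal (2 * q ^ j)) (J + 1)
      _ ≤ ∑' j, ENNReal.ofReal (2 * q ^ j) := ENNReal.sum_le_tsum _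
      _ = _ := by
          rw [← ENNReal.ofReal_tsum_of_nonneg (fun j => by positivity)
            ((summable_geometric_of_lt_one hq0.le hq1).mul_left _), tsum_mul_left,
            tsum_geometric_of_lt_one hq0.le hq1]
  · calc _ ≤ ∑' j : ℕ, ENNReal.ofReal ((1 / 2) ^ j) := by
          refine ENNReal.tsum_le_tsum fun j => ENNReal.ofReal_le_ofReal ?_
          calc _ ≤ ((n : ℝ) / 2 ^ (j + (J + 1))) * 1 := by
                gcongr
                · exact min_le_right _ _
                · exact min_le_left _ _
            _ ≤ (1 / 2) ^ j := by
                rw [mul_one, div_le_iff₀ (by positivity), pow_add, ← mul_assoc, ← mul_pow]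
                norm_num
                exact hJ2
      _ = _ := by
          rw [← ENNReal.ofReal_tsum_of_nonneg (fun j => by positivity) summable_geometric_two,
            tsum_geometric_two]

namespace WeightedGraph

variable {Γ : Type*} (G : WeightedGraph Γ)

section Measure

variable [MeasurableSpace Γ] [Countable Γ] [DiscreteMeasurableSpace Γ]

/-! ### The Riesz transform on `L²` -/

theorem enorm_fieldLength_sq (h : Γ × Γ → ℂ) (x : Γ) :
    ‖G.fieldLength h x‖ₑ ^ 2 =
      2⁻¹ * ∑ y ∈ G.neighbours x, ENNReal.ofReal (G.p x y) * ‖h (x, y)‖ₑ ^ 2 := by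
  have h0 : ∀ y ∈ G.neighbours x, 0 ≤ G.p x y * ‖h (x, y)‖ ^ 2 := fun y _ =>
    mul_nonneg (G.p_nonneg x y) (sq_nonneg _)
  rw [fieldLength, Real.enorm_eq_ofReal (Real.sqrt_nonneg _),
    ← ENNReal.ofReal_pow (Real.sqrt_nonneg _), Real.sq_sqrt
      (mul_nonneg (by norm_num) (Finset.sum_nonneg h0)), ENNReal.ofReal_mul (by norm_num),
    ENNReal.ofReal_sum_of_nonneg h0]
  congr 1
  · rw [one_div, ENNReal.ofReal_inv_of_pos two_pos, ENNReal.ofReal_ofNat]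
  · refine Finset.sum_congr rfl fun y _ => ?_
    rw [ENNReal.ofReal_mul (G.p_nonneg x y), ENNReal.ofReal_pow (norm_nonneg _),
      ofReal_norm]

theorem lintegral_riesz_sq_le (hw : ∀ x, 0 < G.weight x) (hinf : G.measure Set.univ = ∞)
    (f : G.L2) : ∫⁻ x, ‖G.riesz f x‖ₑ ^ 2 ∂G.measure ≤ ∫⁻ x, ‖f x‖ₑ ^ 2 ∂G.measure := by
  have h1 : ‖G.rieszField f‖ₑ ^ 2 ≤ 2 * ‖f‖ₑ ^ 2 := by
    rw [← ofReal_norm, ← ofReal_norm, ← ENNReal.ofReal_pow (norm_nonneg _),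
      ← ENNReal.ofReal_pow (norm_nonneg _)]
    have h2 : (2 : ℝ≥0∞) * ENNReal.ofReal (‖f‖ ^ 2) = ENNReal.ofReal (2 * ‖f‖ ^ 2) := by
      rw [ENNReal.ofReal_mul two_pos.le, ENNReal.ofReal_ofNat]
    rw [h2]
    refine ENNReal.ofReal_le_ofReal ?_
    calc ‖G.rieszField f‖ ^ 2 ≤ (√2 * ‖f‖) ^ 2 := by
          gcongr
          exact G.norm_rieszField_le hw hinf f
      _ = _ := by rw [mul_pow, Real.sq_sqrt two_pos.le]
  simp only [riesz, enorm_fieldLength_sq]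
  rw [lintegral_const_mul _ Measurable.of_discrete,
    ← G.lintegral_edgeMeasure hw fun e => ‖G.rieszField f e‖ₑ ^ 2,
    ← Lp.enorm_sq_eq_lintegral, ← Lp.enorm_sq_eq_lintegral]
  calc _ ≤ 2⁻¹ * (2 * ‖f‖ₑ ^ 2) := by gcongr
    _ = _ := by
      rw [← mul_assoc, ENNReal.inv_mul_cancel two_ne_zero ENNReal.ofNat_ne_top, one_mul]

theorem measure_singleton_ne_zero (hw : ∀ x, 0 < G.weight x) (x : Γ) : G.measure {x} ≠ 0 := by
  rw [measure_singleton]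
  exact_mod_cast (hw x).ne'

theorem measure_singleton_ne_top (x : Γ) : G.measure {x} ≠ ∞ :=
  (G.measure_lt_top_of_finite (Set.finite_singleton x)).ne

/-! ### Powers of the Markov operator on finitely supported functions -/

theorem iterate_markov_eq_sum {s : Finset Γ} {b : Γ → ℂ} (hb : ∀ y ∉ s, b y = 0) (k : ℕ) (x : Γ) :
    G.markov^[k] b x = ∑ y ∈ s, (G.kernel k x y : ℂ) * b y := by
  induction k generalizing x with
  | zero =>
    simp only [Function.iterate_zero, id_eq, kernel]
    by_cases hx : x ∈ s
    · rw [Finset.sum_eq_single_of_mem x hx fun y _ hy => by simp [hy.symm]]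
      simp
    · rw [hb x hx, Finset.sum_eq_zero]
      intro y hy
      have : x ≠ y := fun h => hx (h ▸ hy)
      simp [this]
  | succ k ih =>
    rw [Function.iterate_succ_apply', markov]
    simp only [ih, kernel, Complex.ofReal_sum, Complex.ofReal_mul, Finset.mul_sum, Finset.sum_mul]
    rw [Finset.sum_comm]
    exact Finset.sum_congr rfl fun y _ => Finset.sum_congr rfl fun z _ => by ring

theorem iterate_markov_eq_sum_heat (hw : ∀ x, 0 < G.weight x) {s : Finset Γ} {b : Γ → ℂ}
    (hb : ∀ y ∉ s, b y = 0) (k : ℕ) (x : Γ) :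
    G.markov^[k] b x = ∑ y ∈ s, ((G.weight y : ℝ) * b y) * (G.heat k y x : ℂ) := by
  rw [G.iterate_markov_eq_sum hb]
  refine Finset.sum_congr rfl fun y _ => ?_
  have : ((G.weight y : ℝ) : ℂ) ≠ 0 := by exact_mod_cast (hw y).ne'
  rw [heat]
  push_cast
  field_simp

theorem hasSum_regPrimitive_apply (hw : ∀ x, 0 < G.weight x) {n : ℕ} (hn : 1 ≤ n) (b : G.L2)
    (x : Γ) : HasSum (fun k => (regCoeff n k : ℂ) * G.markov^[k] b x) (G.regPrimitive n b x) := by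
  have h1 := (hasSum_cfc_powerSeries (G.isSelfAdjoint_markovL2 hw)
    (spectrum_subset_Icc_of_norm_le_one G.norm_markovL2_le)
    (summable_abs_regCoeff hn)).summable.hasSum
  have h2 := (h1.mapL (ContinuousLinearMap.apply ℂ G.L2 b)).mapL
    (evalL2 x (G.measure_singleton_ne_zero hw x) (G.measure_singleton_ne_top x))
  refine h2.congr_fun fun k => ?_
  rw [evalL2_apply, ContinuousLinearMap.apply_apply]
  change _ = ((regCoeff n k • (G.markovL2 ^ k) b : G.L2) : Γ → ℂ) x
  rw [G.coe_real_smul hw, G.coe_markovL2_pow hw, Pi.smul_apply, Complex.real_smul]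

/-- The kernel of the operator that sends `b` to its primitive is `∑_k c_k p_k`, so that its gradient
is bounded by the gradients of the heat kernels. -/
theorem gradSum_regPrimitive_le (hw : ∀ x, 0 < G.weight x) {n : ℕ} (hn : 1 ≤ n) (b : G.L2)
    {s : Finset Γ} (hb : ∀ y ∉ s, b y = 0) (x : Γ) :
    G.gradSum (G.regPrimitive n b) x ≤ ∑ y ∈ s, (G.weight y : ℝ≥0∞) * ‖b y‖ₑ *
      ∑' k, ‖regCoeff n k‖ₑ * G.gradSum (G.heat k y) x := by
  have hC : ∀ a : ℝ, ‖(a : ℂ)‖ₑ = ‖a‖ₑ := fun a => by simp [enorm_eq_nnnorm]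
  have h1 : ∀ z, ‖G.regPrimitive n b z - G.regPrimitive n b x‖ₑ ≤
      ∑' k, ∑ y ∈ s, ‖regCoeff n k‖ₑ * ((G.weight y : ℝ≥0∞) * ‖b y‖ₑ *
        ‖G.heat k y z - G.heat k y x‖ₑ) := by
    intro z
    have h2 := (G.hasSum_regPrimitive_apply hw hn b z).sub (G.hasSum_regPrimitive_apply hw hn b x)
    rw [← h2.tsum_eq]
    refine (enorm_tsum_le_tsum_enorm ..).trans (ENNReal.tsum_le_tsum fun k => ?_)
    rw [← mul_sub, G.iterate_markov_eq_sum_heat hw hb, G.iterate_markov_eq_sum_heat hw hb,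
      ← Finset.sum_sub_distrib, enorm_mul, ← Finset.mul_sum]
    gcongr
    · exact (hC _).le
    · refine (enorm_sum_le _ _).trans (Finset.sum_le_sum fun y _ => ?_)
      rw [← mul_sub, enorm_mul, enorm_mul, ← Complex.ofReal_sub, hC, hC,
        Real.enorm_eq_ofReal (NNReal.coe_nonneg _), ENNReal.ofReal_coe_nnreal]
  calc G.gradSum (G.regPrimitive n b) x
      ≤ ∑ z ∈ G.neighbours x, ENNReal.ofReal √(G.p x z) * ∑' k, ∑ y ∈ s, ‖regCoeff n k‖ₑ *
        ((G.weight y : ℝ≥0∞) * ‖b y‖ₑ * ‖G.heat k y z - G.heat k y x‖ₑ) :=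
        Finset.sum_le_sum fun z _ => by gcongr; exact h1 z
    _ = ∑ z ∈ G.neighbours x, ∑ y ∈ s, (G.weight y : ℝ≥0∞) * ‖b y‖ₑ *
        ∑' k, ‖regCoeff n k‖ₑ * (ENNReal.ofReal √(G.p x z) *
          ‖G.heat k y z - G.heat k y x‖ₑ) := by
        refine Finset.sum_congr rfl fun z _ => ?_
        rw [Summable.tsum_finsetSum fun y _ => ENNReal.summable, Finset.mul_sum]
        refine Finset.sum_congr rfl fun y _ => ?_
        rw [← ENNReal.tsum_mul_left, ← ENNReal.tsum_mul_left]
        exact tsum_congr fun k => by ring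
    _ = _ := by
        rw [Finset.sum_comm]
        refine Finset.sum_congr rfl fun y _ => ?_
        rw [← Finset.mul_sum, ← Summable.tsum_finsetSum fun y _ => ENNReal.summable]
        simp only [gradSum, Finset.mul_sum]

/-! ### Off-diagonal estimates -/

theorem le_two_mul_rpow_of_ceil {r m : ℝ} (hr : 1 ≤ r) (hm : 0 ≤ m) :
    ((⌈r ^ m⌉₊ : ℕ) : ℝ) ≤ 2 * r ^ m := by
  have h1 : 1 ≤ r ^ m := Real.one_le_rpow hr hm
  have h2 := Nat.ceil_lt_add_one (by linarith : 0 ≤ r ^ m)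
  linarith

theorem one_le_ceil_rpow {r m : ℝ} (hr : 1 ≤ r) : 1 ≤ ⌈r ^ m⌉₊ :=
  Nat.one_le_ceil_iff.2 (Real.rpow_pos_of_pos (by linarith) _)

theorem enorm_regCoeff_dyadic_le {n : ℕ} (hn : 1 ≤ n) (j i : ℕ) :
    ‖regCoeff n (2 ^ j - 1 + i)‖ₑ ≤
      ENNReal.ofReal (36 * (min 1 ((n : ℝ) / 2 ^ j) * (√(2 ^ j))⁻¹)) := by
  rw [Real.enorm_eq_ofReal_abs]
  refine ENNReal.ofReal_le_ofReal ((abs_regCoeff_le hn _).trans ?_)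
  have h1 : (2 : ℝ) ^ j ≤ ((2 ^ j - 1 + i : ℕ) : ℝ) + 1 := by
    have := Nat.one_le_two_pow (n := j)
    have h2 : 2 ^ j ≤ 2 ^ j - 1 + i + 1 := by omega
    exact_mod_cast h2
  gcongr

/-- The gradient of the kernel of `Δ^{-1/2} (1 - A)`, for `A` the average of the `P ^ j` with
`n ≤ j < 2n` and `n` of the order of `r ^ m`, is integrable at distance at least `r` of the pole,
uniformly. -/
theorem lintegral_tsum_regCoeff_gradSum_heat_le {ε : ℝ} (hε : 0 < ε)
    (hLB : ∀ x, ε < G.p x x) {M : ℕ} (hM : ∀ x, (G.neighbours x).card ≤ M)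
    {D : ℝ} (hD0 : 0 ≤ D)
    (hD : ∀ (x : Γ) (r : ℝ), 0 < r → G.vol x (2 * r) ≤ D * G.vol x r)
    {m : ℝ} (hm : 2 < m) (hUE : G.UE m) :
    ∃ C : ℝ, 0 < C ∧ ∀ (y : Γ) (r : ℝ), 1 ≤ r →
      ∫⁻ x in {x | r ≤ G.dist x y}, ∑' k, ‖regCoeff ⌈r ^ m⌉₊ k‖ₑ * G.gradSum (G.heat k y) x
        ∂G.measure ≤ ENNReal.ofReal C := by
  obtain ⟨C, hC, h⟩ := G.sum_lintegral_gradSum_heat_le (G.weight_pos_of_LB hε hLB) hε hLB hM hD0 hD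
    hm hUE
  have hm0 : 0 < m := by linarith
  obtain ⟨C', hC', h'⟩ := exists_tsum_min_mul_min_le (δ := 1 / (2 * m)) (by positivity)
    (by rw [div_le_one (by positivity)]; linarith)
  refine ⟨36 * C * C', by positivity, fun y r hr => ?_⟩
  set n := ⌈r ^ m⌉₊ with hn
  have hn1 : 1 ≤ n := one_le_ceil_rpow hr
  have hn0 : (0 : ℝ) < n := by exact_mod_cast hn1
  set I : ℕ → ℝ≥0∞ := fun k => ∫⁻ x in {x | r ≤ G.dist x y}, G.gradSum (G.heat k y) x ∂G.measure
    with hI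
  have hblock : ∀ j : ℕ, ∑ i ∈ Finset.range (2 ^ j), ‖regCoeff n (2 ^ j - 1 + i)‖ₑ *
      I (2 ^ j - 1 + i) ≤ ENNReal.ofReal (36 * C) *
        ENNReal.ofReal (min 1 ((n : ℝ) / 2 ^ j) * min 1 ((2 ^ (j + 1) / (n : ℝ)) ^ (1 / (2 * m)))) := by
    intro j
    have hb := h y (2 ^ j) r Nat.one_le_two_pow (by linarith)
    push_cast at hb
    set s : ℝ := 1 + r / (2 ^ j : ℝ) ^ (1 / m) with hs
    have hs1 : 1 ≤ s := by
      have : 0 ≤ r / (2 ^ j : ℝ) ^ (1 / m) := by positivity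
      linarith
    have hs2 : (√s)⁻¹ ≤ min 1 ((2 ^ (j + 1) / (n : ℝ)) ^ (1 / (2 * m))) := by
      refine le_min (inv_le_one_of_one_le₀ (Real.one_le_sqrt.2 hs1)) ?_
      have h1 : (n : ℝ) / 2 ^ (j + 1) ≤ r ^ m / 2 ^ j := by
        rw [div_le_div_iff₀ (by positivity) (by positivity), pow_succ]
        have h2 := le_two_mul_rpow_of_ceil hr hm0.le
        have h3 : (0 : ℝ) < 2 ^ j := by positivity
        nlinarith
      have h4 : ((n : ℝ) / 2 ^ (j + 1)) ^ (1 / m) ≤ s := by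
        calc _ ≤ (r ^ m / 2 ^ j) ^ (1 / m) := by gcongr
          _ = r / (2 ^ j : ℝ) ^ (1 / m) := by
            rw [Real.div_rpow (by positivity) (by positivity), ← Real.rpow_mul (by positivity),
              mul_one_div_cancel hm0.ne', Real.rpow_one]
          _ ≤ s := by rw [hs]; linarith
      have h5 : ((n : ℝ) / 2 ^ (j + 1)) ^ (1 / (2 * m)) ≤ √s := by
        refine Real.le_sqrt_of_sq_le ?_
        rw [← Real.rpow_natCast, ← Real.rpow_mul (by positivity)]
        refine le_trans (le_of_eq ?_) h4
        congr 1
        push_cast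
        field_simp
      rw [← inv_div, Real.inv_rpow (by positivity)]
      gcongr
    calc _ ≤ ∑ i ∈ Finset.range (2 ^ j),
          ENNReal.ofReal (36 * (min 1 ((n : ℝ) / 2 ^ j) * (√(2 ^ j))⁻¹)) * I (2 ^ j - 1 + i) :=
          Finset.sum_le_sum fun i _ => by gcongr; exact enorm_regCoeff_dyadic_le hn1 j i
      _ ≤ ENNReal.ofReal (36 * (min 1 ((n : ℝ) / 2 ^ j) * (√(2 ^ j))⁻¹)) *
          ENNReal.ofReal (C * (√(2 ^ j) * (√s)⁻¹)) := by
          rw [← Finset.mul_sum]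
          gcongr
      _ = ENNReal.ofReal (36 * C * (min 1 ((n : ℝ) / 2 ^ j) * (√s)⁻¹)) := by
          rw [← ENNReal.ofReal_mul (by positivity)]
          congr 1
          have : (0 : ℝ) < √(2 ^ j) := by positivity
          field_simp
      _ ≤ _ := by
          rw [← ENNReal.ofReal_mul (by positivity)]
          refine ENNReal.ofReal_le_ofReal ?_
          gcongr
  calc _ = ∑' k, ‖regCoeff n k‖ₑ * I k := by
        rw [lintegral_tsum fun k => Measurable.of_discrete.aemeasurable]
        exact tsum_congr fun k => lintegral_const_mul _ Measurable.of_discrete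
    _ ≤ _ := ENNReal.tsum_le_tsum_dyadic _
    _ ≤ _ := ENNReal.tsum_le_tsum hblock
    _ ≤ ENNReal.ofReal (36 * C) * ENNReal.ofReal C' := by
        rw [ENNReal.tsum_mul_left]
        gcongr
        exact h' n hn1
    _ = _ := by rw [← ENNReal.ofReal_mul (by positivity)]

theorem lintegral_eq_sum_of_support {s : Finset Γ} {b : Γ → ℂ} (hb : ∀ y ∉ s, b y = 0) :
    ∫⁻ x, ‖b x‖ₑ ∂G.measure = ∑ y ∈ s, (G.weight y : ℝ≥0∞) * ‖b y‖ₑ := by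
  rw [lintegral_measure, tsum_eq_sum (s := s)]
  intro y hy
  simp [hb y hy]

theorem coe_powAverage_apply (hw : ∀ x, 0 < G.weight x) (n : ℕ) (b : G.L2) (x : Γ) :
    (powAverage n G.markovL2 b : Γ → ℂ) x =
      ((n : ℝ)⁻¹ : ℝ) * ∑ j ∈ Finset.range n, G.markov^[n + j] b x := by
  have h1 : powAverage n G.markovL2 b =
      (n : ℝ)⁻¹ • ∑ j ∈ Finset.range n, (G.markovL2 ^ (n + j)) b := by
    rw [powAverage]
    change (n : ℝ)⁻¹ • (∑ j ∈ Finset.range n, G.markovL2 ^ (n + j)) b = _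
    rw [sum_apply]
  rw [h1, G.coe_real_smul hw, G.coe_sum hw, Pi.smul_apply, Finset.sum_apply, Complex.real_smul]
  simp only [G.coe_markovL2_pow hw]

/-- Averages of powers of `P` at the scale `r` spread a function supported near `z` over the ball of
radius `r`, with a polynomial tail. -/
theorem enorm_powAverage_apply_le (hw : ∀ x, 0 < G.weight x)
    {D : ℝ} (hD0 : 0 ≤ D)
    (hD : ∀ (x : Γ) (r : ℝ), 0 < r → G.vol x (2 * r) ≤ D * G.vol x r)
    {m : ℝ} (hm : 2 < m) (hUE : G.UE m) (N : ℕ) :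
    ∃ C : ℝ, 0 < C ∧ ∀ (z : Γ) (r : ℝ) (b : G.L2) (s : Finset Γ), 1 ≤ r →
      (∀ y ∉ s, b y = 0) → (∀ y, b y ≠ 0 → (G.dist y z : ℝ) ≤ 3 * r) → ∀ x,
      ‖powAverage ⌈r ^ m⌉₊ G.markovL2 b x‖ₑ ≤
        ENNReal.ofReal (C / G.vol z r * ((1 + (G.dist x z : ℝ) / r) ^ N)⁻¹) *
          ∫⁻ x, ‖b x‖ₑ ∂G.measure := by
  obtain ⟨C, hC, h⟩ := G.heat_le hw hm hUE N
  refine ⟨C * (D ^ 2 + 1) * 8 ^ N, by positivity, fun z r b s hr hs hb x => ?_⟩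
  have hm0 : 0 < m := by linarith
  have hr0 : 0 < r := by linarith
  set n := ⌈r ^ m⌉₊ with hn
  have hn1 : 1 ≤ n := one_le_ceil_rpow hr
  have hn0 : (0 : ℝ) < n := by exact_mod_cast hn1
  have hvz := G.vol_pos hw z hr0
  set ρ : ℝ := (n : ℝ) ^ (1 / m) with hρ
  have hrρ : r ≤ ρ := by
    calc r = (r ^ m) ^ (1 / m) := by
          rw [← Real.rpow_mul hr0.le, mul_one_div_cancel hm0.ne', Real.rpow_one]
      _ ≤ ρ := Real.rpow_le_rpow (by positivity) (Nat.le_ceil _) (by positivity)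
  have hρr : ρ ≤ 2 * r := by
    calc ρ ≤ ((2 * r) ^ m) ^ (1 / m) := by
          refine Real.rpow_le_rpow hn0.le ?_ (by positivity)
          rw [Real.mul_rpow two_pos.le hr0.le]
          refine (le_two_mul_rpow_of_ceil hr hm0.le).trans ?_
          gcongr
          calc (2 : ℝ) = 2 ^ (1 : ℝ) := (Real.rpow_one 2).symm
            _ ≤ 2 ^ m := Real.rpow_le_rpow_of_exponent_le one_le_two (by linarith)
      _ = 2 * r := by
          rw [← Real.rpow_mul (by positivity), mul_one_div_cancel hm0.ne', Real.rpow_one]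
  have hρ0 : 0 < ρ := by linarith
  set Q : ℝ := C * (D ^ 2 + 1) * 8 ^ N / G.vol z r * ((1 + (G.dist x z : ℝ) / r) ^ N)⁻¹ with hQ
  have hQ0 : 0 ≤ Q := by positivity
  have hheat : ∀ y, b y ≠ 0 → ∀ j ∈ Finset.range n, G.heat (n + j) y x ≤ Q := by
    intro y hy j hj
    rw [Finset.mem_range] at hj
    refine (h x y n (n + j) hn1 (by omega) (by omega)).trans ?_
    have hyz := hb y hy
    have h1 : G.vol z r ≤ (D ^ 2 + 1) * G.vol y ρ := by
      have h2 : G.vol z r ≤ G.vol y (2 ^ 2 * r) :=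
        G.vol_le_vol (by rw [G.dist_comm]; linarith)
      have h3 := G.vol_two_pow hD0 hD y hr0 2
      have h4 := G.vol_mono y hrρ
      have h5 := G.vol_nonneg y ρ
      nlinarith [sq_nonneg D]
    have h2 : 1 + (G.dist x z : ℝ) / r ≤ 8 * (1 + (G.dist x y : ℝ) / ρ) := by
      have h3 := G.dist_triangle_real x y z
      have h4 : (G.dist x z : ℝ) / r ≤ (G.dist x y : ℝ) / r + 3 := by
        rw [div_add' _ _ _ hr0.ne']
        gcongr
        linarith
      have h5 : (G.dist x y : ℝ) / r ≤ 2 * ((G.dist x y : ℝ) / ρ) := by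
        rw [mul_div_assoc', div_le_div_iff₀ hr0 hρ0]
        have : (0 : ℝ) ≤ G.dist x y := Nat.cast_nonneg _
        nlinarith
      have h6 : (0 : ℝ) ≤ (G.dist x y : ℝ) / ρ := by positivity
      linarith
    have hvy : 0 < G.vol y ρ := G.vol_pos hw y hρ0
    have h3 : C / G.vol y ρ ≤ C * (D ^ 2 + 1) / G.vol z r := by
      rw [div_le_div_iff₀ hvy hvz, mul_assoc]
      gcongr
    have h4 : ((1 + (G.dist x y : ℝ) / ρ) ^ N)⁻¹ ≤
        8 ^ N * ((1 + (G.dist x z : ℝ) / r) ^ N)⁻¹ := by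
      rw [← div_eq_mul_inv, le_div_iff₀ (by positivity), inv_mul_le_iff₀ (by positivity), mul_comm,
        ← mul_pow]
      exact pow_le_pow_left₀ (by positivity) h2 N
    calc _ ≤ C * (D ^ 2 + 1) / G.vol z r * (8 ^ N * ((1 + (G.dist x z : ℝ) / r) ^ N)⁻¹) := by
          gcongr
      _ = Q := by rw [hQ]; ring
  have hmk : ∀ j ∈ Finset.range n, ‖G.markov^[n + j] b x‖ₑ ≤
      ENNReal.ofReal Q * ∫⁻ x, ‖b x‖ₑ ∂G.measure := by
    intro j hj
    rw [G.iterate_markov_eq_sum_heat hw hs, G.lintegral_eq_sum_of_support hs, Finset.mul_sum]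
    refine (enorm_sum_le _ _).trans (Finset.sum_le_sum fun y _ => ?_)
    have hC : ∀ a : ℝ, ‖(a : ℂ)‖ₑ = ‖a‖ₑ := fun a => by simp [enorm_eq_nnnorm]
    by_cases hy : b y = 0
    · simp [hy]
    · rw [enorm_mul, enorm_mul, hC, hC, Real.enorm_eq_ofReal (NNReal.coe_nonneg _),
        ENNReal.ofReal_coe_nnreal, mul_comm, Real.enorm_eq_ofReal (G.heat_nonneg _ _ _)]
      gcongr
      exact hheat y hy j hj
  rw [G.coe_powAverage_apply hw, enorm_mul]
  calc _ ≤ ENNReal.ofReal (n : ℝ)⁻¹ * (n * (ENNReal.ofReal Q * ∫⁻ x, ‖b x‖ₑ ∂G.measure)) := by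
        gcongr
        · have : ‖(((n : ℝ)⁻¹ : ℝ) : ℂ)‖ₑ = ‖(n : ℝ)⁻¹‖ₑ := by simp [enorm_eq_nnnorm]
          rw [this, Real.enorm_eq_ofReal (by positivity)]
        · refine (enorm_sum_le _ _).trans ((Finset.sum_le_sum hmk).trans (le_of_eq ?_))
          rw [Finset.sum_const, Finset.card_range, nsmul_eq_mul]
    _ = _ := by
        rw [← mul_assoc, ENNReal.ofReal_inv_of_pos hn0, ENNReal.ofReal_natCast,
          ENNReal.inv_mul_cancel (by exact_mod_cast (by omega : n ≠ 0)) (ENNReal.natCast_ne_top n),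
          one_mul]

/-! ### Almost orthogonality of bumps adapted to disjoint balls -/

/-- In a product of two bumps, the one at the larger scale may be evaluated at any point of the ball
of the smaller one, at the cost of half of the decay. -/
theorem decay_mul_decay_le {z w x x' : Γ} {rz rw : ℝ} (hrw : 0 < rw) (hr : rw ≤ rz)
    (hx' : x' ∈ G.ball w rw) (N : ℕ) :
    ((1 + (G.dist x z : ℝ) / rz) ^ (2 * N))⁻¹ * ((1 + (G.dist x w : ℝ) / rw) ^ (2 * N))⁻¹ ≤
      2 ^ N * ((1 + (G.dist x' z : ℝ) / rz) ^ N)⁻¹ * ((1 + (G.dist x w : ℝ) / rw) ^ N)⁻¹ := by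
  have hrz : 0 < rz := by linarith
  set a := 1 + (G.dist x z : ℝ) / rz with ha
  set b := 1 + (G.dist x w : ℝ) / rw with hb
  set e := 1 + (G.dist x' z : ℝ) / rz with he
  have ha0 : (0 : ℝ) ≤ (G.dist x z : ℝ) / rz := by positivity
  have hb0 : (0 : ℝ) ≤ (G.dist x w : ℝ) / rw := by positivity
  have he0 : (0 : ℝ) ≤ (G.dist x' z : ℝ) / rz := by positivity
  have h1 : e ≤ 2 * (a * b) := by
    have h2 := G.dist_triangle_real x' w z
    have h3 := G.dist_triangle_real w x z
    rw [G.mem_ball, G.dist_comm] at hx'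
    rw [G.dist_comm w x] at h3
    have h4 : (G.dist x' z : ℝ) / rz ≤ 1 + (G.dist x w : ℝ) / rw + (G.dist x z : ℝ) / rz := by
      have h5 : (G.dist x w : ℝ) / rz ≤ (G.dist x w : ℝ) / rw := by gcongr
      have h6 : (G.dist x' z : ℝ) / rz ≤ 1 + (G.dist x w : ℝ) / rz + (G.dist x z : ℝ) / rz := by
        rw [one_add_div hrz.ne', ← add_div]
        gcongr
        linarith
      linarith
    nlinarith [mul_nonneg ha0 hb0]
  have h2 : e ^ N ≤ 2 ^ N * (a ^ N * b ^ N) := by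
    rw [← mul_pow, ← mul_pow]
    exact pow_le_pow_left₀ (by positivity) h1 N
  have ha1 : 1 ≤ a ^ N := one_le_pow₀ (by linarith)
  have hbN : 0 < b ^ N := by positivity
  have heN : 0 < e ^ N := by positivity
  rw [two_mul, pow_add, pow_add, ← mul_inv, mul_assoc (2 ^ N : ℝ), ← mul_inv, ← div_eq_mul_inv,
    le_div_iff₀ (by positivity), inv_mul_le_iff₀ (by positivity)]
  calc e ^ N * b ^ N ≤ 2 ^ N * (a ^ N * b ^ N) * b ^ N := by gcongr
    _ = 1 * (2 ^ N * (a ^ N * b ^ N) * b ^ N) := (one_mul _).symm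
    _ ≤ a ^ N * (2 ^ N * (a ^ N * b ^ N) * b ^ N) := by gcongr
    _ = _ := by ring

/-- The square of a sum of bumps adapted to disjoint balls has integral controlled by the total
volume of the balls. In a product of two bumps, the one adapted to the larger ball is almost
constant on the smaller ball, so that the sum over the smaller balls is bounded by one integral. -/
theorem lintegral_sq_sum_decay_le (hw : ∀ x, 0 < G.weight x) {D : ℝ} (hD0 : 0 ≤ D)
    (hD : ∀ (x : Γ) (r : ℝ), 0 < r → G.vol x (2 * r) ≤ D * G.vol x r)
    {N : ℕ} (hN : 2 * D ≤ 2 ^ N) (u : Finset Γ) (r : Γ → ℝ) (hr : ∀ z ∈ u, 0 < r z)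
    (hu : (u : Set Γ).PairwiseDisjoint fun z => G.ball z (r z)) :
    ∫⁻ x, (∑ z ∈ u, ENNReal.ofReal (((1 + (G.dist x z : ℝ) / r z) ^ (2 * N))⁻¹)) ^ 2 ∂G.measure ≤
      ENNReal.ofReal (2 * 2 ^ N * (2 ^ (N + 1)) ^ 2) * ∑ z ∈ u, G.measure (G.ball z (r z)) := by
  classical
  set ψ : Γ → Γ → ℝ≥0∞ :=
    fun z x => ENNReal.ofReal (((1 + (G.dist x z : ℝ) / r z) ^ (2 * N))⁻¹) with hψ
  set φ : Γ → Γ → ℝ≥0∞ :=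
    fun z x => ENNReal.ofReal (((1 + (G.dist x z : ℝ) / r z) ^ N)⁻¹) with hφ
  have hφint : ∀ z ∈ u, ∫⁻ x, φ z x ∂G.measure ≤
      ENNReal.ofReal (2 ^ (N + 1)) * G.measure (G.ball z (r z)) := fun z hz => by
    refine (G.lintegral_decay_le hD0 hD hN z (hr z hz)).trans (le_of_eq ?_)
    rw [ENNReal.ofReal_mul (by positivity), ofReal_vol]
  set c : ℝ≥0∞ := ENNReal.ofReal (2 ^ N * 2 ^ (N + 1)) with hc
  have hpair : ∀ z ∈ u, ∀ w ∈ u, r w ≤ r z → ∫⁻ x, ψ z x * ψ w x ∂G.measure ≤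
      c * ∫⁻ x in G.ball w (r w), φ z x ∂G.measure := by
    intro z hz w hw' hwz
    set Q := ∫⁻ x, ψ z x * ψ w x ∂G.measure with hQ
    have h1 : ∀ x' ∈ G.ball w (r w), Q ≤ c * G.measure (G.ball w (r w)) * φ z x' := by
      intro x' hx'
      calc Q ≤ ∫⁻ x, ENNReal.ofReal (2 ^ N) * φ z x' * φ w x ∂G.measure := by
            refine lintegral_mono fun x => ?_
            simp only [hψ, hφ]
            have hrz := hr z hz
            have hrw := hr w hw'
            rw [← ENNReal.ofReal_mul (by positivity), ← ENNReal.ofReal_mul (by positivity),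
              ← ENNReal.ofReal_mul (by positivity)]
            exact ENNReal.ofReal_le_ofReal (G.decay_mul_decay_le (hr w hw') hwz hx' N)
        _ ≤ ENNReal.ofReal (2 ^ N) * φ z x' *
            (ENNReal.ofReal (2 ^ (N + 1)) * G.measure (G.ball w (r w))) := by
            rw [lintegral_const_mul _ Measurable.of_discrete]
            gcongr
            exact hφint w hw'
        _ = _ := by
            rw [hc, ENNReal.ofReal_mul (by positivity)]
            ring
    have hBpos : G.measure (G.ball w (r w)) ≠ 0 := fun h0 =>
      G.measure_singleton_ne_zero hw w (measure_mono_null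
        (Set.singleton_subset_iff.2 (G.mem_ball_self w (hr w hw'))) h0)
    have hBtop := (G.measure_lt_top_of_finite (G.finite_ball w (r w))).ne
    have h2 : G.measure (G.ball w (r w)) * Q ≤ G.measure (G.ball w (r w)) *
        (c * ∫⁻ x in G.ball w (r w), φ z x ∂G.measure) := by
      calc _ = ∫⁻ x' in G.ball w (r w), Q ∂G.measure := by
            rw [setLIntegral_const, mul_comm]
        _ ≤ ∫⁻ x' in G.ball w (r w), c * G.measure (G.ball w (r w)) * φ z x' ∂G.measure :=
            setLIntegral_mono Measurable.of_discrete h1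
        _ = _ := by
            rw [lintegral_const_mul _ Measurable.of_discrete]
            ring
    exact (ENNReal.mul_le_mul_iff_right hBpos hBtop).1 h2
  have hrow : ∀ z ∈ u, ∑ w ∈ u with r w ≤ r z, ∫⁻ x, ψ z x * ψ w x ∂G.measure ≤
      c * ENNReal.ofReal (2 ^ (N + 1)) * G.measure (G.ball z (r z)) := by
    intro z hz
    calc _ ≤ ∑ w ∈ u with r w ≤ r z, c * ∫⁻ x in G.ball w (r w), φ z x ∂G.measure :=
          Finset.sum_le_sum fun w hw' =>
            hpair z hz w (Finset.mem_filter.1 hw').1 (Finset.mem_filter.1 hw').2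
      _ ≤ ∑ w ∈ u, c * ∫⁻ x in G.ball w (r w), φ z x ∂G.measure :=
          Finset.sum_le_sum_of_subset (Finset.filter_subset _ _)
      _ = c * ∫⁻ x in ⋃ w ∈ u, G.ball w (r w), φ z x ∂G.measure := by
          rw [← Finset.mul_sum, lintegral_biUnion_finset hu fun _ _ => MeasurableSet.of_discrete]
      _ ≤ c * ∫⁻ x, φ z x ∂G.measure := by
          gcongr
          exact Measure.restrict_le_self
      _ ≤ c * (ENNReal.ofReal (2 ^ (N + 1)) * G.measure (G.ball z (r z))) := by
          gcongr
          exact hφint z hz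
      _ = _ := by ring
  have hsq : ∀ x, (∑ z ∈ u, ψ z x) ^ 2 ≤ 2 * ∑ z ∈ u, ∑ w ∈ u with r w ≤ r z, ψ z x * ψ w x := by
    intro x
    calc (∑ z ∈ u, ψ z x) ^ 2 = ∑ z ∈ u, ∑ w ∈ u, ψ z x * ψ w x := by
          rw [sq, Finset.sum_mul_sum]
      _ ≤ ∑ z ∈ u, ∑ w ∈ u, ((if r w ≤ r z then ψ z x * ψ w x else 0) +
          (if r z ≤ r w then ψ w x * ψ z x else 0)) := by
          refine Finset.sum_le_sum fun z _ => Finset.sum_le_sum fun w _ => ?_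
          rcases le_total (r w) (r z) with h | h
          · rw [if_pos h]; exact le_self_add
          · rw [if_pos h, mul_comm]; exact le_add_self
      _ = _ := by
          simp only [Finset.sum_add_distrib, Finset.sum_filter]
          rw [Finset.sum_comm (f := fun z w => if r z ≤ r w then ψ w x * ψ z x else 0), two_mul]
  calc _ ≤ ∫⁻ x, 2 * ∑ z ∈ u, ∑ w ∈ u with r w ≤ r z, ψ z x * ψ w x ∂G.measure :=
        lintegral_mono hsq
    _ = 2 * ∑ z ∈ u, ∑ w ∈ u with r w ≤ r z, ∫⁻ x, ψ z x * ψ w x ∂G.measure := by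
        rw [lintegral_const_mul _ Measurable.of_discrete,
          lintegral_finsetSum _ fun _ _ => Measurable.of_discrete]
        congr 1
        exact Finset.sum_congr rfl fun z _ =>
          lintegral_finsetSum _ fun _ _ => Measurable.of_discrete
    _ ≤ 2 * ∑ z ∈ u, c * ENNReal.ofReal (2 ^ (N + 1)) * G.measure (G.ball z (r z)) := by
        gcongr with z hz
        exact hrow z hz
    _ = _ := by
        rw [← Finset.mul_sum, ← mul_assoc, hc, ← ENNReal.ofReal_mul (by positivity),
          ← ENNReal.ofReal_ofNat 2, ← ENNReal.ofReal_mul two_pos.le]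
        congr 2
        ring

/-! ### The Calderón–Zygmund covering -/

/-- The set where `|f| > t` is covered by the enlargements of disjoint balls on which the mean of
`|f|` is at least `t`, and at most `t` after a further enlargement. -/
theorem exists_calderonZygmund_covering (hw : ∀ x, 0 < G.weight x)
    (hinf : G.measure Set.univ = ∞) {f : Γ → ℂ}
    (hf : (Function.support f).Finite) {t : ℝ} (ht : 0 < t) :
    ∃ (u : Finset Γ) (r : Γ → ℝ) (c : Γ → Γ), (∀ z ∈ u, 1 ≤ r z) ∧
      ((u : Set Γ).PairwiseDisjoint fun z => G.ball z (r z)) ∧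
      (∀ y, t < ‖f y‖ → c y ∈ u ∧ (G.dist y (c y) : ℝ) ≤ 3 * r (c y)) ∧
      ∀ z ∈ u, ENNReal.ofReal t * G.measure (G.ball z (r z)) ≤
          ∫⁻ x in G.ball z (r z), ‖f x‖ₑ ∂G.measure ∧
        ∫⁻ x in G.ball z (4 * r z), ‖f x‖ₑ ∂G.measure ≤
          ENNReal.ofReal t * G.measure (G.ball z (4 * r z)) := by
  have hI : ∫⁻ x, ‖f x‖ₑ ∂G.measure < ∞ := by
    rw [G.lintegral_eq_sum_of_support (s := hf.toFinset) fun y hy => by simpa using hy]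
    exact ENNReal.sum_lt_top.2 fun y _ => ENNReal.mul_lt_top ENNReal.coe_lt_top enorm_lt_top
  have hmax : ∀ x, t < ‖f x‖ → ∃ R : ℕ, 1 ≤ R ∧
      ENNReal.ofReal t * G.measure (G.ball x R) < ∫⁻ y in G.ball x R, ‖f y‖ₑ ∂G.measure ∧
      ∀ R' : ℕ, R < R' → ∫⁻ y in G.ball x R', ‖f y‖ₑ ∂G.measure ≤
        ENNReal.ofReal t * G.measure (G.ball x R') := by
    intro x hx
    set S : Set ℕ := {R | ENNReal.ofReal t * G.measure (G.ball x R) <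
      ∫⁻ y in G.ball x R, ‖f y‖ₑ ∂G.measure} with hS
    have h1 : 1 ∈ S := by
      rw [hS, Set.mem_ofPred_eq, Nat.cast_one, ball_one, lintegral_singleton]
      refine (ENNReal.mul_lt_mul_iff_left (G.measure_singleton_ne_zero hw x)
        (G.measure_singleton_ne_top x)).2 ?_
      rw [← ofReal_norm]
      exact (ENNReal.ofReal_lt_ofReal_iff (ht.trans hx)).2 hx
    -- large balls are excluded, as their volume tends to infinity while `f` is integrable
    have h2 : BddAbove S := by
      obtain ⟨R₀, hR₀⟩ := Filter.eventually_atTop.1 ((G.tendsto_vol_atTop hinf x).eventually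
        (Filter.eventually_ge_atTop ((∫⁻ x, ‖f x‖ₑ ∂G.measure).toReal / t)))
      refine ⟨R₀, fun R hR => le_of_not_gt fun hlt => ?_⟩
      have h3 := hR₀ R hlt.le
      rw [div_le_iff₀ ht] at h3
      have h4 : ∫⁻ x, ‖f x‖ₑ ∂G.measure ≤ ENNReal.ofReal t * G.measure (G.ball x R) := by
        rw [← ofReal_vol, ← ENNReal.ofReal_mul ht.le, ← ENNReal.ofReal_toReal hI.ne]
        exact ENNReal.ofReal_le_ofReal (by linarith)
      exact absurd (lt_of_lt_of_le hR (setLIntegral_le_lintegral _ _)) (not_lt.2 h4)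
    refine ⟨sSup S, le_csSup h2 h1, Nat.sSup_mem ⟨1, h1⟩ h2, fun R' hR' => ?_⟩
    exact not_lt.1 fun h3 => absurd (le_csSup h2 h3) (not_le.2 hR')
  choose! R hR1 hR2 hR3 using hmax
  -- a Vitali selection among the balls of maximal radius
  set T : Set Γ := {x | t < ‖f x‖} with hT
  have hTfin : T.Finite := hf.subset fun x hx hx0 => by
    rw [hT, Set.mem_ofPred_eq, hx0, norm_zero] at hx
    linarith
  obtain ⟨B, hB⟩ := (hTfin.image fun x => (R x : ℝ)).bddAbove
  obtain ⟨u, huT, hdisj, hcov⟩ := Vitali.exists_disjoint_subfamily_covering_enlargement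
    (fun x => G.ball x (R x)) T (fun x => (R x : ℝ)) 2 one_lt_two (fun x _ => Nat.cast_nonneg _) B
    (fun x hx => hB ⟨x, hx, rfl⟩) fun x hx => ⟨x, G.mem_ball_self x (by
      have := hR1 x hx
      exact_mod_cast this)⟩
  choose! c hc1 hc2 hc3 using hcov
  have hufin : u.Finite := hTfin.subset huT
  refine ⟨hufin.toFinset, fun z => R z, c, fun z hz => ?_, ?_, fun y hy => ⟨?_, ?_⟩,
    fun z hz => ⟨?_, ?_⟩⟩
  · exact Nat.one_le_cast.2 (hR1 z (huT (hufin.mem_toFinset.1 hz)))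
  · rwa [hufin.coe_toFinset]
  · exact hufin.mem_toFinset.2 (hc1 y hy)
  · obtain ⟨w, hw1, hw2⟩ := hc2 y hy
    have h1 := G.dist_triangle_real y w (c y)
    have h2 := hc3 y hy
    rw [mem_ball] at hw1 hw2
    rw [G.dist_comm w] at h1
    linarith
  · exact (hR2 z (huT (hufin.mem_toFinset.1 hz))).le
  · have h1 := hR1 z (huT (hufin.mem_toFinset.1 hz))
    have h2 := hR3 z (huT (hufin.mem_toFinset.1 hz)) (4 * R z) (by omega)
    push_cast at h2
    exact h2

/-! ### Pointwise bounds for the length of a field -/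

theorem fieldLength_nonneg (h : Γ × Γ → ℂ) (x : Γ) : 0 ≤ G.fieldLength h x := Real.sqrt_nonneg _

theorem enorm_fieldLength_le_sum (h : Γ × Γ → ℂ) (x : Γ) :
    ‖G.fieldLength h x‖ₑ ≤ ∑ z ∈ G.neighbours x, ENNReal.ofReal √(G.p x z) * ‖h (x, z)‖ₑ := by
  have h1 : ‖G.fieldLength h x‖ₑ ^ 2 ≤
      (∑ z ∈ G.neighbours x, ENNReal.ofReal √(G.p x z) * ‖h (x, z)‖ₑ) ^ 2 := by
    rw [enorm_fieldLength_sq]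
    calc _ ≤ 1 * ∑ z ∈ G.neighbours x, ENNReal.ofReal (G.p x z) * ‖h (x, z)‖ₑ ^ 2 := by
          gcongr
          exact ENNReal.inv_le_one.2 one_le_two
      _ = ∑ z ∈ G.neighbours x, (ENNReal.ofReal √(G.p x z) * ‖h (x, z)‖ₑ) *
          (ENNReal.ofReal √(G.p x z) * ‖h (x, z)‖ₑ) := by
          rw [one_mul]
          refine Finset.sum_congr rfl fun z _ => ?_
          rw [mul_mul_mul_comm, ← ENNReal.ofReal_mul (Real.sqrt_nonneg _),
            Real.mul_self_sqrt (G.p_nonneg x z), sq]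
      _ ≤ ∑ z ∈ G.neighbours x, (∑ z ∈ G.neighbours x,
          ENNReal.ofReal √(G.p x z) * ‖h (x, z)‖ₑ) *
          (ENNReal.ofReal √(G.p x z) * ‖h (x, z)‖ₑ) := by
          refine Finset.sum_le_sum fun z hz => ?_
          gcongr
          exact Finset.single_le_sum (f := fun z => ENNReal.ofReal √(G.p x z) * ‖h (x, z)‖ₑ)
            (fun _ _ => zero_le) hz
      _ = _ := by rw [← Finset.mul_sum, sq]
  exact (ENNReal.pow_le_pow_left_iff two_ne_zero).1 h1

/-- Consequence of `|a + b|² ≤ 2 |a|² + 2 |b|²`, in the form in which level sets are split. -/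
theorem lt_fieldLength_add {h h₁ h₂ : Γ × Γ → ℂ} {x : Γ} {t : ℝ} (ht : 0 < t)
    (hadd : ∀ z ∈ G.neighbours x, h (x, z) = h₁ (x, z) + h₂ (x, z)) (hlt : t < G.fieldLength h x) :
    t / 2 < G.fieldLength h₁ x ∨ t / 2 < G.fieldLength h₂ x := by
  by_contra! hcon
  have hsq : ∀ h : Γ × Γ → ℂ, G.fieldLength h x ^ 2 =
      1 / 2 * ∑ y ∈ G.neighbours x, G.p x y * ‖h (x, y)‖ ^ 2 := fun h =>
    Real.sq_sqrt (mul_nonneg (by norm_num) (Finset.sum_nonneg fun y _ =>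
      mul_nonneg (G.p_nonneg x y) (sq_nonneg _)))
  have h1 : G.fieldLength h x ^ 2 ≤ 2 * G.fieldLength h₁ x ^ 2 + 2 * G.fieldLength h₂ x ^ 2 := by
    rw [hsq, hsq, hsq]
    have : ∑ y ∈ G.neighbours x, G.p x y * ‖h (x, y)‖ ^ 2 ≤
        ∑ y ∈ G.neighbours x, (2 * (G.p x y * ‖h₁ (x, y)‖ ^ 2) +
          2 * (G.p x y * ‖h₂ (x, y)‖ ^ 2)) := by
      refine Finset.sum_le_sum fun y hy => ?_
      have h2 : ‖h (x, y)‖ ^ 2 ≤ 2 * ‖h₁ (x, y)‖ ^ 2 + 2 * ‖h₂ (x, y)‖ ^ 2 := by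
        rw [hadd y hy]
        have h3 := norm_add_le (h₁ (x, y)) (h₂ (x, y))
        have h4 := norm_nonneg (h₁ (x, y) + h₂ (x, y))
        nlinarith [sq_nonneg (‖h₁ (x, y)‖ - ‖h₂ (x, y)‖)]
      calc _ ≤ G.p x y * (2 * ‖h₁ (x, y)‖ ^ 2 + 2 * ‖h₂ (x, y)‖ ^ 2) :=
            mul_le_mul_of_nonneg_left h2 (G.p_nonneg x y)
        _ = _ := by ring
    rw [Finset.sum_add_distrib, ← Finset.mul_sum, ← Finset.mul_sum] at this
    linarith
  have h2 := G.fieldLength_nonneg h₁ x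
  have h3 := G.fieldLength_nonneg h₂ x
  nlinarith

theorem measure_lt_le_lintegral_sq (F : Γ → ℝ) {s : ℝ} (hs : 0 < s) :
    G.measure {x | s < F x} ≤ ENNReal.ofReal ((s ^ 2)⁻¹) * ∫⁻ x, ‖F x‖ₑ ^ 2 ∂G.measure := by
  have h := meas_ge_le_lintegral_div (μ := G.measure) (f := fun x => ‖F x‖ₑ ^ 2)
    Measurable.of_discrete.aemeasurable (ε := ENNReal.ofReal (s ^ 2))
    (by simpa using by positivity) ENNReal.ofReal_ne_top
  rw [div_eq_mul_inv, mul_comm, ← ENNReal.ofReal_inv_of_pos (by positivity)] at h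
  refine (measure_mono fun x hx => ?_).trans h
  rw [Set.mem_ofPred_eq] at hx ⊢
  rw [Real.enorm_eq_ofReal (hs.trans hx).le, ← ENNReal.ofReal_pow (hs.trans hx).le]
  refine ENNReal.ofReal_le_ofReal ?_
  gcongr

/-- The restriction of `f` to a set of vertices. -/
def restrictL2 (f : G.L2) (s : Set Γ) : G.L2 :=
  ((Lp.memLp f).indicator (MeasurableSet.of_discrete (s := s))).toLp _

theorem coe_restrictL2 (hw : ∀ x, 0 < G.weight x) (f : G.L2) (s : Set Γ) :
    (G.restrictL2 f s : Γ → ℂ) = s.indicator f := G.coe_toLp hw _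

theorem riesz_nonneg (f : G.L2) (x : Γ) : 0 ≤ G.riesz f x := Real.sqrt_nonneg _

theorem riesz_add_lt {f g : G.L2} {x : Γ} {t : ℝ} (ht : 0 < t)
    (h : t < G.riesz (f + g) x) : t / 2 < G.riesz f x ∨ t / 2 < G.riesz g x := by
  refine G.lt_fieldLength_add ht (fun z hz => ?_) h
  rw [map_add]
  exact G.ae_edgeMeasure_iff.1 (Lp.coeFn_add _ _) (x, z) (G.mem_neighbours.1 hz).ne'

/-! ### The weak type estimate for finitely supported functions -/

theorem measure_riesz_gt_le (hw : ∀ x, 0 < G.weight x) (hinf : G.measure Set.univ = ∞) (f : G.L2)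
    {s : ℝ} (hs : 0 < s) : G.measure {x | s < G.riesz f x} ≤
      ENNReal.ofReal ((s ^ 2)⁻¹) * ∫⁻ x, ‖f x‖ₑ ^ 2 ∂G.measure :=
  (G.measure_lt_le_lintegral_sq _ hs).trans (mul_le_mul_right (G.lintegral_riesz_sq_le hw hinf f) _)

theorem measure_riesz_bounded_part_le (hw : ∀ x, 0 < G.weight x) (hinf : G.measure Set.univ = ∞)
    (f : G.L2) {t s : ℝ} (hs : 0 < s) (hf : ∀ x, ‖f x‖ ≤ t) :
    G.measure {x | s < G.riesz f x} ≤
      ENNReal.ofReal ((s ^ 2)⁻¹ * t) * ∫⁻ x, ‖f x‖ₑ ∂G.measure := by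
  refine (G.measure_riesz_gt_le hw hinf f hs).trans ?_
  rw [ENNReal.ofReal_mul (by positivity), mul_assoc,
    ← lintegral_const_mul (ENNReal.ofReal t) Measurable.of_discrete]
  refine mul_le_mul_right (lintegral_mono fun x => ?_) _
  simp only [sq]
  refine mul_le_mul_left ?_ _
  rw [← ofReal_norm]
  exact ENNReal.ofReal_le_ofReal (hf x)

/-- Decompose `f = g + ∑ b_z` at height `t`, with `|g| ≤ t` and `b_z` supported near a ball of the
Calderón–Zygmund covering, and write `b_z = A_z b_z + Δ^{1/2} S_z` with `A_z` the average of the powers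
of `P` at the scale of the ball. The `L²` bound settles `g` and `∑ A_z b_z`, and the off-diagonal
estimate settles `∑ Δ^{1/2} S_z` away from the enlarged balls. -/
theorem exists_measure_riesz_gt_le_of_finite {ε : ℝ} (hε : 0 < ε)
    (hLB : ∀ x, ε < G.p x x) (hinf : G.measure Set.univ = ∞)
    {M : ℕ} (hM : ∀ x, (G.neighbours x).card ≤ M) {D : ℝ} (hD0 : 0 ≤ D)
    (hD : ∀ (x : Γ) (r : ℝ), 0 < r → G.vol x (2 * r) ≤ D * G.vol x r)
    {m : ℝ} (hm : 2 < m) (hUE : G.UE m) :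
    ∃ C : ℝ, 0 < C ∧ ∀ f : G.L2, (Function.support f).Finite → ∀ t : ℝ, 0 < t →
      G.measure {x | t < G.riesz f x} ≤ ENNReal.ofReal (C / t) * ∫⁻ x, ‖f x‖ₑ ∂G.measure := by
  classical
  have hw := G.weight_pos_of_LB hε hLB
  obtain ⟨N, hN⟩ := pow_unbounded_of_one_lt (2 * D) one_lt_two
  obtain ⟨C₁, hC₁, hA⟩ := G.enorm_powAverage_apply_le hw hD0 hD hm hUE (2 * N)
  obtain ⟨C₂, hC₂, hS⟩ := G.lintegral_tsum_regCoeff_gradSum_heat_le hε hLB hM hD0 hD hm hUE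
  set E : ℝ := 2 * 2 ^ N * (2 ^ (N + 1)) ^ 2 with hE
  refine ⟨4 + 16 * (C₁ * D ^ 2) ^ 2 * E + D ^ 2 + 4 * C₂, by positivity, fun f hf t ht => ?_⟩
  set I := ∫⁻ x, ‖f x‖ₑ ∂G.measure with hI
  obtain ⟨u, r, c, hr1, hdisj, hc, hball⟩ := G.exists_calderonZygmund_covering hw hinf hf ht
  have hr0 : ∀ z ∈ u, 0 < r z := fun z hz => by linarith [hr1 z hz]
  -- the decomposition into a bounded part and parts supported near the balls
  set g := G.restrictL2 f {y | ‖f y‖ ≤ t} with hg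
  set b : Γ → G.L2 := fun z => G.restrictL2 f {y | t < ‖f y‖ ∧ c y = z} with hb
  set n : Γ → ℕ := fun z => ⌈r z ^ m⌉₊ with hn
  have hn1 : ∀ z ∈ u, 1 ≤ n z := fun z hz => one_le_ceil_rpow (hr1 z hz)
  have hb_apply : ∀ z y, b z y = if t < ‖f y‖ ∧ c y = z then f y else 0 := fun z y => by
    rw [hb, G.coe_restrictL2 hw, Set.indicator_apply]
    rfl
  have hg_apply : ∀ y, g y = if ‖f y‖ ≤ t then f y else 0 := fun y => by
    rw [hg, G.coe_restrictL2 hw, Set.indicator_apply]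
    rfl
  have hb_supp : ∀ z, ∀ y ∉ hf.toFinset, b z y = 0 := fun z y hy => by
    have : f y = 0 := by simpa using hy
    rw [hb_apply, this, ite_self]
  have hb_near : ∀ z y, b z y ≠ 0 → (G.dist y z : ℝ) ≤ 3 * r z := fun z y hy => by
    rw [hb_apply] at hy
    have h1 : t < ‖f y‖ ∧ c y = z := by
      by_contra hcon
      exact hy (if_neg hcon)
    have h2 := (hc y h1.1).2
    rwa [h1.2] at h2
  have hfdec : f = g + ∑ z ∈ u, b z := by
    refine Lp.ext (Filter.Eventually.of_forall fun y => ?_)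
    rw [G.coe_add hw, Pi.add_apply, G.coe_sum hw, Finset.sum_apply, hg_apply]
    simp only [hb_apply]
    rcases le_or_gt ‖f y‖ t with h | h
    · simp [h, not_lt.2 h]
    · simp [h, not_le.2 h, (hc y h).1]
  have hb_sum : ∑ z ∈ u, ∫⁻ y, ‖b z y‖ₑ ∂G.measure ≤ I := by
    rw [← lintegral_finsetSum _ fun _ _ => Measurable.of_discrete]
    refine lintegral_mono fun y => ?_
    simp only [hb_apply]
    rcases le_or_gt ‖f y‖ t with h | h
    · simp [not_lt.2 h]
    · simp [h, (hc y h).1, apply_ite]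
  have hVD : ∀ z ∈ u, G.measure (G.ball z (4 * r z)) ≤
      ENNReal.ofReal (D ^ 2) * G.measure (G.ball z (r z)) := fun z hz => by
    rw [← ofReal_vol, ← ofReal_vol, ← ENNReal.ofReal_mul (by positivity)]
    refine ENNReal.ofReal_le_ofReal ?_
    have := G.vol_two_pow hD0 hD z (hr0 z hz) 2
    norm_num at this
    exact this
  have hVsum : ∑ z ∈ u, G.measure (G.ball z (r z)) ≤ ENNReal.ofReal t⁻¹ * I := by
    have h1 : ENNReal.ofReal t * ∑ z ∈ u, G.measure (G.ball z (r z)) ≤ I := by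
      calc _ ≤ ∑ z ∈ u, ∫⁻ x in G.ball z (r z), ‖f x‖ₑ ∂G.measure := by
            rw [Finset.mul_sum]
            exact Finset.sum_le_sum fun z hz => (hball z hz).1
        _ = ∫⁻ x in ⋃ z ∈ u, G.ball z (r z), ‖f x‖ₑ ∂G.measure :=
            (lintegral_biUnion_finset hdisj (fun _ _ => MeasurableSet.of_discrete) _).symm
        _ ≤ I := setLIntegral_le_lintegral _ _
    rw [ENNReal.ofReal_inv_of_pos ht]
    rwa [← ENNReal.mul_le_iff_le_inv (by simpa using ht) ENNReal.ofReal_ne_top]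
  have hb_int : ∀ z ∈ u, ∫⁻ y, ‖b z y‖ₑ ∂G.measure ≤
      ENNReal.ofReal (t * D ^ 2) * ENNReal.ofReal (G.vol z (r z)) := fun z hz => by
    calc _ ≤ ∫⁻ x in G.ball z (4 * r z), ‖f x‖ₑ ∂G.measure := by
          rw [← lintegral_indicator MeasurableSet.of_discrete]
          refine lintegral_mono fun y => ?_
          by_cases hy : b z y = 0
          · simp [hy]
          · have h1 := hb_near z y hy
            have h2 : y ∈ G.ball z (4 * r z) := by
              rw [mem_ball, G.dist_comm]
              linarith [hr0 z hz]
            rw [Set.indicator_of_mem h2]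
            rw [hb_apply] at hy ⊢
            split_ifs with h3
            · exact le_rfl
            · exact absurd (if_neg h3) hy
      _ ≤ _ := (hball z hz).2
      _ ≤ _ := by
          rw [ENNReal.ofReal_mul ht.le, ofReal_vol, mul_assoc]
          gcongr
          exact hVD z hz
  -- the smooth part of the functions `b z`
  set a : G.L2 := ∑ z ∈ u, powAverage (n z) G.markovL2 (b z) with ha
  have ha_sq : ∫⁻ x, ‖a x‖ₑ ^ 2 ∂G.measure ≤
      ENNReal.ofReal ((C₁ * (t * D ^ 2)) ^ 2 * E * t⁻¹) * I := by
    have h1 : ∀ x, ‖a x‖ₑ ≤ ENNReal.ofReal (C₁ * (t * D ^ 2)) *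
        ∑ z ∈ u, ENNReal.ofReal (((1 + (G.dist x z : ℝ) / r z) ^ (2 * N))⁻¹) := by
      intro x
      rw [ha, G.coe_sum hw, Finset.sum_apply, Finset.mul_sum]
      refine (enorm_sum_le _ _).trans (Finset.sum_le_sum fun z hz => ?_)
      refine (hA z (r z) (b z) hf.toFinset (hr1 z hz) (hb_supp z) (hb_near z) x).trans ?_
      have hv := G.vol_pos hw z (hr0 z hz)
      have hrz := hr0 z hz
      refine (mul_le_mul_right (hb_int z hz) _).trans (le_of_eq ?_)
      rw [← ENNReal.ofReal_mul (by positivity), ← ENNReal.ofReal_mul (by positivity),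
        ← ENNReal.ofReal_mul (by positivity)]
      congr 1
      field_simp
    calc _ ≤ ∫⁻ x, (ENNReal.ofReal (C₁ * (t * D ^ 2)) *
          ∑ z ∈ u, ENNReal.ofReal (((1 + (G.dist x z : ℝ) / r z) ^ (2 * N))⁻¹)) ^ 2 ∂G.measure := by
          gcongr with x
          exact h1 x
      _ = ENNReal.ofReal (C₁ * (t * D ^ 2)) ^ 2 * ∫⁻ x, (∑ z ∈ u,
          ENNReal.ofReal (((1 + (G.dist x z : ℝ) / r z) ^ (2 * N))⁻¹)) ^ 2 ∂G.measure := by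
          simp only [mul_pow]
          exact lintegral_const_mul _ Measurable.of_discrete
      _ ≤ ENNReal.ofReal (C₁ * (t * D ^ 2)) ^ 2 *
          (ENNReal.ofReal E * (ENNReal.ofReal t⁻¹ * I)) := by
          gcongr
          refine (G.lintegral_sq_sum_decay_le hw hD0 hD hN.le u r hr0 hdisj).trans ?_
          gcongr
      _ = _ := by
          rw [← ENNReal.ofReal_pow (by positivity), ← mul_assoc, ← mul_assoc,
            ← ENNReal.ofReal_mul (by positivity), ← ENNReal.ofReal_mul (by positivity)]
  -- the primitive of the remaining part
  set S : G.L2 := ∑ z ∈ u, G.regPrimitive (n z) (b z) with hSdef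
  have hsplit : f = g + (a + G.sqrtLaplacian S) := by
    rw [hSdef, map_sum, ha, ← Finset.sum_add_distrib, Finset.sum_congr rfl fun z hz => by
      rw [G.sqrtLaplacian_regPrimitive hw (hn1 z hz), add_sub_cancel]]
    exact hfdec
  have hgrad : ∀ x, ‖G.riesz (G.sqrtLaplacian S) x‖ₑ ≤ ∑ z ∈ u,
      G.gradSum (G.regPrimitive (n z) (b z)) x := by
    intro x
    refine (G.enorm_fieldLength_le_sum _ x).trans ?_
    simp only [gradSum]
    rw [Finset.sum_comm]
    refine Finset.sum_le_sum fun y hy => ?_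
    rw [G.rieszField_sqrtLaplacian hw hinf, G.differential_apply _ hy, hSdef, G.coe_sum hw,
      Finset.sum_apply, Finset.sum_apply, ← Finset.sum_sub_distrib, ← Finset.mul_sum]
    gcongr
    exact enorm_sum_le _ _
  set Ω : Set Γ := ⋃ z ∈ u, G.ball z (4 * r z) with hΩ
  have hΩm : G.measure Ω ≤ ENNReal.ofReal (D ^ 2 * t⁻¹) * I := by
    calc _ ≤ ∑ z ∈ u, G.measure (G.ball z (4 * r z)) := measure_biUnion_finset_le _ _
      _ ≤ ∑ z ∈ u, ENNReal.ofReal (D ^ 2) * G.measure (G.ball z (r z)) := Finset.sum_le_sum hVD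
      _ ≤ ENNReal.ofReal (D ^ 2) * (ENNReal.ofReal t⁻¹ * I) := by
          rw [← Finset.mul_sum]
          gcongr
      _ = _ := by rw [← mul_assoc, ← ENNReal.ofReal_mul (by positivity)]
  have hoff : ∫⁻ x in Ωᶜ, ‖G.riesz (G.sqrtLaplacian S) x‖ₑ ∂G.measure ≤
      ENNReal.ofReal C₂ * I := by
    calc _ ≤ ∫⁻ x in Ωᶜ, ∑ z ∈ u, G.gradSum (G.regPrimitive (n z) (b z)) x ∂G.measure := by
          gcongr with x
          exact hgrad x
      _ = ∑ z ∈ u, ∫⁻ x in Ωᶜ, G.gradSum (G.regPrimitive (n z) (b z)) x ∂G.measure :=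
          lintegral_finsetSum _ fun _ _ => Measurable.of_discrete
      _ ≤ ∑ z ∈ u, ENNReal.ofReal C₂ * ∫⁻ y, ‖b z y‖ₑ ∂G.measure := by
          refine Finset.sum_le_sum fun z hz => ?_
          calc _ ≤ ∫⁻ x in Ωᶜ, ∑ y ∈ hf.toFinset, (G.weight y : ℝ≥0∞) * ‖b z y‖ₑ *
                ∑' k, ‖regCoeff (n z) k‖ₑ * G.gradSum (G.heat k y) x ∂G.measure := by
                gcongr with x
                exact G.gradSum_regPrimitive_le hw (hn1 z hz) (b z) (hb_supp z) x
            _ = ∑ y ∈ hf.toFinset, (G.weight y : ℝ≥0∞) * ‖b z y‖ₑ * ∫⁻ x in Ωᶜ,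
                ∑' k, ‖regCoeff (n z) k‖ₑ * G.gradSum (G.heat k y) x ∂G.measure := by
                rw [lintegral_finsetSum _ fun _ _ => Measurable.of_discrete]
                exact Finset.sum_congr rfl fun y _ => lintegral_const_mul _ Measurable.of_discrete
            _ ≤ ∑ y ∈ hf.toFinset, (G.weight y : ℝ≥0∞) * ‖b z y‖ₑ * ENNReal.ofReal C₂ := by
                refine Finset.sum_le_sum fun y _ => ?_
                by_cases hy : b z y = 0
                · simp [hy]
                gcongr
                refine le_trans (lintegral_mono_set ?_) (hS y (r z) (hr1 z hz))
                intro x hx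
                rw [hΩ, Set.mem_compl_iff, Set.mem_iUnion₂, not_exists] at hx
                have h1 : ¬ x ∈ G.ball z (4 * r z) := fun h => hx z ⟨hz, h⟩
                rw [mem_ball, not_lt] at h1
                have h2 := hb_near z y hy
                have h3 := G.dist_triangle_real z y x
                rw [G.dist_comm z y, G.dist_comm y x] at h3
                rw [Set.mem_ofPred_eq]
                linarith
            _ = _ := by
                rw [← Finset.sum_mul, ← G.lintegral_eq_sum_of_support (hb_supp z), mul_comm]
      _ ≤ _ := by
          rw [← Finset.mul_sum]
          gcongr
  have hthird : G.measure {x | t / 2 / 2 < G.riesz (G.sqrtLaplacian S) x} ≤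
      ENNReal.ofReal (D ^ 2 * t⁻¹) * I + ENNReal.ofReal (4 * t⁻¹ * C₂) * I := by
    have h1 := meas_ge_le_lintegral_div (μ := G.measure.restrict Ωᶜ)
      (f := fun x => ‖G.riesz (G.sqrtLaplacian S) x‖ₑ)
      Measurable.of_discrete.aemeasurable (ε := ENNReal.ofReal (t / 2 / 2))
      (by simpa using ht) ENNReal.ofReal_ne_top
    rw [Measure.restrict_apply MeasurableSet.of_discrete] at h1
    calc _ ≤ G.measure (Ω ∪ {x | ENNReal.ofReal (t / 2 / 2) ≤
            ‖G.riesz (G.sqrtLaplacian S) x‖ₑ} ∩ Ωᶜ) := by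
          refine measure_mono fun x hx => ?_
          rw [Set.mem_ofPred_eq] at hx
          by_cases hxΩ : x ∈ Ω
          · exact Or.inl hxΩ
          · refine Or.inr ⟨?_, hxΩ⟩
            rw [Set.mem_ofPred_eq, Real.enorm_eq_ofReal (G.riesz_nonneg _ _)]
            exact ENNReal.ofReal_le_ofReal hx.le
      _ ≤ _ := measure_union_le _ _
      _ ≤ _ := by
          refine add_le_add hΩm (h1.trans ?_)
          rw [div_eq_mul_inv, mul_comm, ← ENNReal.ofReal_inv_of_pos (by positivity)]
          refine (mul_le_mul_right hoff _).trans (le_of_eq ?_)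
          rw [← mul_assoc, ← ENNReal.ofReal_mul (by positivity)]
          congr 2
          field_simp
          norm_num
  have hfirst : G.measure {x | t / 2 < G.riesz g x} ≤ ENNReal.ofReal (4 * t⁻¹) * I := by
    refine (G.measure_riesz_bounded_part_le hw hinf g (half_pos ht) (t := t) fun x => ?_).trans ?_
    · rw [hg_apply]
      split_ifs with h
      · exact h
      · simpa using ht.le
    · have h1 : ((t / 2) ^ 2)⁻¹ * t = 4 * t⁻¹ := by field_simp; norm_num
      rw [h1]
      refine mul_le_mul_right (lintegral_mono fun x => ?_) _
      simp only [hg_apply]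
      split_ifs <;> simp
  have hsecond : G.measure {x | t / 2 / 2 < G.riesz a x} ≤
      ENNReal.ofReal (16 * (C₁ * D ^ 2) ^ 2 * E * t⁻¹) * I := by
    refine (G.measure_riesz_gt_le hw hinf a (half_pos (half_pos ht))).trans ?_
    refine (mul_le_mul_right ha_sq _).trans (le_of_eq ?_)
    rw [← mul_assoc, ← ENNReal.ofReal_mul (by positivity)]
    congr 2
    field_simp
    norm_num
    ring
  calc G.measure {x | t < G.riesz f x} ≤ G.measure ({x | t / 2 < G.riesz g x} ∪
        ({x | t / 2 / 2 < G.riesz a x} ∪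
          {x | t / 2 / 2 < G.riesz (G.sqrtLaplacian S) x})) := by
        refine measure_mono fun x hx => ?_
        rw [Set.mem_ofPred_eq, hsplit] at hx
        rcases G.riesz_add_lt ht hx with h | h
        · exact Or.inl h
        · exact Or.inr (G.riesz_add_lt (half_pos ht) h)
    _ ≤ _ := (measure_union_le _ _).trans (add_le_add le_rfl (measure_union_le _ _))
    _ ≤ ENNReal.ofReal (4 * t⁻¹) * I + (ENNReal.ofReal (16 * (C₁ * D ^ 2) ^ 2 * E * t⁻¹) * I +
        (ENNReal.ofReal (D ^ 2 * t⁻¹) * I + ENNReal.ofReal (4 * t⁻¹ * C₂) * I)) :=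
        add_le_add hfirst (add_le_add hsecond hthird)
    _ = _ := by
        rw [← add_mul, ← add_mul, ← add_mul, ← ENNReal.ofReal_add (by positivity) (by positivity),
          ← ENNReal.ofReal_add (by positivity) (by positivity),
          ← ENNReal.ofReal_add (by positivity) (by positivity)]
        congr 2
        ring

end Measure

end WeightedGraph

/-! ### The Marcinkiewicz kernel -/

/-- The function of `t` that results from splitting a value of size `a` at height `t`, estimating
large values by a weak type `(1,1)` inequality and small values by an `L²` inequality. -/
def marcinkiewiczKernel (C q a t : ℝ) : ℝ :=
  if t < a then C * a * t ^ (q - 2) else 4 * a ^ 2 * t ^ (q - 3)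

theorem measurable_marcinkiewiczKernel (C q a : ℝ) : Measurable (marcinkiewiczKernel C q a) := by
  unfold marcinkiewiczKernel
  exact Measurable.ite measurableSet_Iio (by fun_prop) (by fun_prop)

theorem lintegral_marcinkiewiczKernel_le {C q : ℝ} (hC : 0 < C) (hq1 : 1 < q) (hq2 : q < 2)
    {a : ℝ} (ha : 0 ≤ a) :
    ∫⁻ t in Set.Ioi 0, ENNReal.ofReal (marcinkiewiczKernel C q a t) ≤
      ENNReal.ofReal (((C + 4) / (q - 1) + 4 / (2 - q)) * a ^ q) := by
  have hq1' := sub_pos.2 hq1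
  have hq2' := sub_pos.2 hq2
  rcases ha.eq_or_lt with rfl | ha
  · rw [setLIntegral_congr_fun (g := 0) measurableSet_Ioi]
    · simp
    · intro t ht
      simp [marcinkiewiczKernel, not_lt.2 (Set.mem_Ioi.1 ht).le]
  rw [← Set.Ioc_union_Ioi_eq_Ioi ha.le, lintegral_union measurableSet_Ioi
    (Set.Ioc_disjoint_Ioi le_rfl), add_mul, ENNReal.ofReal_add (by positivity) (by positivity)]
  refine add_le_add ?_ ?_
  · calc _ ≤ ∫⁻ t in Set.Ioc 0 a, ENNReal.ofReal ((C + 4) * a * t ^ (q - 2)) := by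
          refine setLIntegral_mono (by fun_prop) fun t ht => ENNReal.ofReal_le_ofReal ?_
          have ht0 : 0 < t := ht.1
          rw [marcinkiewiczKernel]
          split_ifs with h
          · gcongr
            linarith
          · have h1 : t = a := le_antisymm ht.2 (not_lt.1 h)
            have h2 : t ^ (q - 2) = t * t ^ (q - 3) := by
              rw [← Real.rpow_one_add' ht0.le (by linarith)]
              congr 1
              ring
            rw [h2, ← h1]
            have h3 : 0 ≤ C * t * (t * t ^ (q - 3)) := by positivity
            linarith
      _ = _ := by
          rw [← ofReal_integral_eq_lintegral_ofReal, ← intervalIntegral.integral_of_le ha.le,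
            intervalIntegral.integral_const_mul, integral_rpow (Or.inl (by linarith))]
          · congr 1
            have h2 : a ^ q = a * a ^ (q - 2 + 1) := by
              rw [← Real.rpow_one_add' ha.le (by linarith)]
              congr 1
              ring
            have h3 : q - 2 + 1 = q - 1 := by ring
            rw [h2, h3, Real.zero_rpow hq1'.ne']
            field_simp
            ring
          · exact ((intervalIntegrable_iff_integrableOn_Ioc_of_le ha.le).1
              (intervalIntegral.intervalIntegrable_rpow' (by linarith))).const_mul _
          · refine (ae_restrict_iff' measurableSet_Ioc).2 (Filter.Eventually.of_forall fun t ht => ?_)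
            have ht0 : 0 < t := ht.1
            simp only [Pi.zero_apply]
            positivity
  · calc _ = ∫⁻ t in Set.Ioi a, ENNReal.ofReal (4 * a ^ 2 * t ^ (q - 3)) := by
          refine setLIntegral_congr_fun measurableSet_Ioi fun t ht => ?_
          simp only [marcinkiewiczKernel, if_neg (not_lt.2 (Set.mem_Ioi.1 ht).le)]
      _ = ENNReal.ofReal (4 / (2 - q) * a ^ q) := by
          rw [← ofReal_integral_eq_lintegral_ofReal, integral_const_mul,
            integral_Ioi_rpow_of_lt (by linarith) ha]
          · congr 1
            have h2 : a ^ q = a ^ 2 * a ^ (q - 3 + 1) := by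
              rw [← Real.rpow_natCast, ← Real.rpow_add ha]
              congr 1
              push_cast
              ring
            have h3 : q - 3 + 1 = -(2 - q) := by ring
            rw [h2, h3, neg_div_neg_eq]
            ring
          · exact (integrableOn_Ioi_rpow_of_lt (by linarith) ha).const_mul _
          · refine (ae_restrict_iff' measurableSet_Ioi).2 (Filter.Eventually.of_forall fun t ht => ?_)
            have ht0 : 0 < t := ha.trans ht
            simp only [Pi.zero_apply]
            positivity
      _ ≤ _ := le_rfl

namespace WeightedGraph

variable {Γ : Type*} (G : WeightedGraph Γ)

section Measure

variable [MeasurableSpace Γ] [Countable Γ] [DiscreteMeasurableSpace Γ]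

/-! ### Weak type `(1,1)` -/

theorem restrictL2_add_compl (hw : ∀ x, 0 < G.weight x) (f : G.L2) (s : Set Γ) :
    G.restrictL2 f s + G.restrictL2 f sᶜ = f := by
  refine Lp.ext (Filter.Eventually.of_forall fun x => ?_)
  rw [G.coe_add hw, G.coe_restrictL2 hw, G.coe_restrictL2 hw, Set.indicator_self_add_compl]

theorem measure_riesz_gt_le_add (hw : ∀ x, 0 < G.weight x) (f : G.L2) (s : Set Γ) {t : ℝ}
    (ht : 0 < t) : G.measure {x | t < G.riesz f x} ≤
      G.measure {x | t / 2 < G.riesz (G.restrictL2 f s) x} +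
        G.measure {x | t / 2 < G.riesz (G.restrictL2 f sᶜ) x} := by
  refine (measure_mono fun x hx => ?_).trans (measure_union_le _ _)
  refine G.riesz_add_lt ht ?_
  rwa [G.restrictL2_add_compl hw]

/-- The `L²` bound makes the part of `f` outside a large finite set negligible, so that the weak
type estimate need only be known for finitely supported functions. -/
theorem exists_measure_riesz_gt_le {ε : ℝ} (hε : 0 < ε)
    (hLB : ∀ x, ε < G.p x x) (hinf : G.measure Set.univ = ∞)
    {M : ℕ} (hM : ∀ x, (G.neighbours x).card ≤ M) {D : ℝ} (hD0 : 0 ≤ D)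
    (hD : ∀ (x : Γ) (r : ℝ), 0 < r → G.vol x (2 * r) ≤ D * G.vol x r)
    {m : ℝ} (hm : 2 < m) (hUE : G.UE m) :
    ∃ C : ℝ, 0 < C ∧ ∀ f : G.L2, ∀ t : ℝ, 0 < t →
      G.measure {x | t < G.riesz f x} ≤ ENNReal.ofReal (C / t) * ∫⁻ x, ‖f x‖ₑ ∂G.measure := by
  have hw := G.weight_pos_of_LB hε hLB
  obtain ⟨C, hC, h⟩ := G.exists_measure_riesz_gt_le_of_finite hε hLB hinf hM hD0 hD hm hUE
  refine ⟨2 * C, by positivity, fun f t ht => ?_⟩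
  set a := ENNReal.ofReal (((t / 2) ^ 2)⁻¹)
  have htail : Filter.Tendsto (fun s : Finset Γ =>
      a * ∫⁻ x, ‖G.restrictL2 f (s : Set Γ)ᶜ x‖ₑ ^ 2 ∂G.measure) Filter.atTop (nhds 0) := by
    have h1 : ∑' x, (G.weight x : ℝ≥0∞) * ‖f x‖ₑ ^ 2 ≠ ∞ := by
      rw [← lintegral_measure, ← Lp.enorm_sq_eq_lintegral]
      simp
    have h2 := ENNReal.Tendsto.const_mul (a := a) (ENNReal.tendsto_tsum_compl_atTop_zero h1)
      (Or.inr ENNReal.ofReal_ne_top)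
    rw [mul_zero] at h2
    refine h2.congr fun s => ?_
    rw [lintegral_measure]
    congr 1
    refine (tsum_subtype (s := {x | x ∉ s})
      (fun x => (G.weight x : ℝ≥0∞) * ‖f x‖ₑ ^ 2)).trans (tsum_congr fun x => ?_)
    rw [G.coe_restrictL2 hw]
    by_cases hx : x ∈ s <;> simp [hx]
  have hmain : ∀ s : Finset Γ, G.measure {x | t < G.riesz f x} ≤
      ENNReal.ofReal (2 * C / t) * ∫⁻ x, ‖f x‖ₑ ∂G.measure +
        a * ∫⁻ x, ‖G.restrictL2 f (s : Set Γ)ᶜ x‖ₑ ^ 2 ∂G.measure := by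
    intro s
    refine (G.measure_riesz_gt_le_add hw f s ht).trans (add_le_add ?_
      (G.measure_riesz_gt_le hw hinf _ (half_pos ht)))
    have hfin : (Function.support (G.restrictL2 f (s : Set Γ))).Finite := by
      rw [G.coe_restrictL2 hw]
      exact s.finite_toSet.subset Set.support_indicator_subset
    refine (h _ hfin _ (half_pos ht)).trans ?_
    have h1 : C / (t / 2) = 2 * C / t := by field_simp
    rw [h1]
    refine mul_le_mul_right (lintegral_mono fun x => ?_) _
    rw [G.coe_restrictL2 hw]
    exact enorm_indicator_le_enorm_self _ _
  have := ge_of_tendsto' (htail.const_add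
    (ENNReal.ofReal (2 * C / t) * ∫⁻ x, ‖f x‖ₑ ∂G.measure)) hmain
  rwa [add_zero] at this

/-! ### Interpolation -/

/-- Marcinkiewicz interpolation between the weak type `(1,1)` estimate and the `L²` bound, splitting
`f` at height `t` for each `t`. -/
theorem lintegral_riesz_rpow_le (hw : ∀ x, 0 < G.weight x) (hinf : G.measure Set.univ = ∞)
    {C : ℝ} (hC : 0 < C) (h : ∀ f : G.L2, ∀ t : ℝ, 0 < t →
      G.measure {x | t < G.riesz f x} ≤ ENNReal.ofReal (C / t) * ∫⁻ x, ‖f x‖ₑ ∂G.measure)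
    {q : ℝ} (hq1 : 1 < q) (hq2 : q < 2) (f : G.L2) :
    ∫⁻ x, ‖G.riesz f x‖ₑ ^ q ∂G.measure ≤
      ENNReal.ofReal (q * ((2 * C + 4) / (q - 1) + 4 / (2 - q))) *
        ∫⁻ x, ‖f x‖ₑ ^ q ∂G.measure := by
  set B := (2 * C + 4) / (q - 1) + 4 / (2 - q)
  have hweak : ∀ t : ℝ, 0 < t → G.measure {x | t < G.riesz f x} * ENNReal.ofReal (t ^ (q - 1)) ≤
      ∑' x, (G.weight x : ℝ≥0∞) * ENNReal.ofReal (marcinkiewiczKernel (2 * C) q ‖f x‖ t) := by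
    intro t ht
    have h1 := (G.measure_riesz_gt_le_add hw f {x | t < ‖f x‖} ht).trans
      (add_le_add (h _ _ (half_pos ht)) (G.measure_riesz_gt_le hw hinf _ (half_pos ht)))
    refine (mul_le_mul_left h1 _).trans (le_of_eq ?_)
    rw [lintegral_measure, lintegral_measure, ← ENNReal.tsum_mul_left, ← ENNReal.tsum_mul_left,
      ← ENNReal.tsum_add, ← ENNReal.tsum_mul_right]
    refine tsum_congr fun x => ?_
    rw [G.coe_restrictL2 hw, G.coe_restrictL2 hw, marcinkiewiczKernel]
    by_cases hx : t < ‖f x‖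
    · have h2 : t ^ (q - 1) = t * t ^ (q - 2) := by
        rw [← Real.rpow_one_add' ht.le (by linarith)]
        congr 1
        ring
      have h3 : 2 * C * ‖f x‖ * t ^ (q - 2) = C / (t / 2) * ‖f x‖ * t ^ (q - 1) := by
        rw [h2]
        field_simp
      rw [if_pos hx, h3, ENNReal.ofReal_mul (by positivity), ENNReal.ofReal_mul (by positivity),
        ofReal_norm]
      simp only [Set.indicator_apply, Set.mem_compl_iff, Set.mem_ofPred_eq, hx, not_true, if_true,
        if_false, enorm_zero]
      ring
    · have h2 : t ^ (q - 1) = t ^ 2 * t ^ (q - 3) := by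
        rw [← Real.rpow_natCast, ← Real.rpow_add ht]
        congr 1
        push_cast
        ring
      have h3 : 4 * ‖f x‖ ^ 2 * t ^ (q - 3) = ((t / 2) ^ 2)⁻¹ * ‖f x‖ ^ 2 * t ^ (q - 1) := by
        rw [h2]
        field_simp
        norm_num
        ring
      rw [if_neg hx, h3, ENNReal.ofReal_mul (by positivity), ENNReal.ofReal_mul (by positivity),
        ENNReal.ofReal_pow (norm_nonneg _), ofReal_norm]
      simp only [Set.indicator_apply, Set.mem_compl_iff, Set.mem_ofPred_eq, hx, not_false_eq_true,
        if_true, if_false, enorm_zero]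
      ring
  calc _ = ∫⁻ x, ENNReal.ofReal (G.riesz f x ^ q) ∂G.measure := by
        refine lintegral_congr fun x => ?_
        rw [Real.enorm_eq_ofReal (G.riesz_nonneg f x),
          ENNReal.ofReal_rpow_of_nonneg (G.riesz_nonneg f x) (by linarith)]
    _ = ENNReal.ofReal q * ∫⁻ t in Set.Ioi 0, G.measure {x | t < G.riesz f x} *
          ENNReal.ofReal (t ^ (q - 1)) :=
        lintegral_rpow_eq_lintegral_meas_lt_mul _
          (Filter.Eventually.of_forall fun x => G.riesz_nonneg f x)
          Measurable.of_discrete.aemeasurable (by linarith)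
    _ ≤ ENNReal.ofReal q * ∫⁻ t in Set.Ioi 0, ∑' x, (G.weight x : ℝ≥0∞) *
          ENNReal.ofReal (marcinkiewiczKernel (2 * C) q ‖f x‖ t) :=
        mul_le_mul_right (setLIntegral_mono' measurableSet_Ioi fun t ht => hweak t ht) _
    _ = ENNReal.ofReal q * ∑' x, (G.weight x : ℝ≥0∞) *
          ∫⁻ t in Set.Ioi 0, ENNReal.ofReal (marcinkiewiczKernel (2 * C) q ‖f x‖ t) := by
        have hmeas : ∀ x, Measurable fun t =>
            ENNReal.ofReal (marcinkiewiczKernel (2 * C) q ‖f x‖ t) := fun x =>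
          (measurable_marcinkiewiczKernel _ _ _).ennreal_ofReal
        rw [lintegral_tsum fun x => ((hmeas x).const_mul _).aemeasurable]
        congr 1
        exact tsum_congr fun x => lintegral_const_mul _ (hmeas x)
    _ ≤ ENNReal.ofReal q * ∑' x, (G.weight x : ℝ≥0∞) * (ENNReal.ofReal B * ‖f x‖ₑ ^ q) := by
        refine mul_le_mul_right (ENNReal.tsum_le_tsum fun x => mul_le_mul_right ?_ _) _
        refine (lintegral_marcinkiewiczKernel_le (by positivity) hq1 hq2 (norm_nonneg _)).trans
          (le_of_eq ?_)
        have h1 := sub_pos.2 hq1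
        have h2 := sub_pos.2 hq2
        rw [ENNReal.ofReal_mul (by positivity), ← ofReal_norm,
          ENNReal.ofReal_rpow_of_nonneg (norm_nonneg _) (by linarith)]
    _ = _ := by
        rw [← lintegral_measure, lintegral_const_mul _ Measurable.of_discrete, ← mul_assoc,
          ← ENNReal.ofReal_mul (by linarith)]

theorem rieszWeakOneOne_of_measure_le {C : ℝ} (hC : 0 < C) (h : ∀ f : G.L2, ∀ t : ℝ, 0 < t →
    G.measure {x | t < G.riesz f x} ≤ ENNReal.ofReal (C / t) * ∫⁻ x, ‖f x‖ₑ ∂G.measure) :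
    G.RieszWeakOneOne := by
  refine ⟨C.toNNReal, fun f _ t ht => ?_⟩
  simp only [abs_of_nonneg (G.riesz_nonneg f _)]
  refine (h f t (by exact_mod_cast ht)).trans (le_of_eq ?_)
  rw [eLpNorm_one_eq_lintegral_enorm, ENNReal.ofReal, Real.toNNReal_div hC.le,
    Real.toNNReal_coe]

theorem rieszBounded_of_measure_le (hw : ∀ x, 0 < G.weight x) (hinf : G.measure Set.univ = ∞)
    {C : ℝ} (hC : 0 < C) (h : ∀ f : G.L2, ∀ t : ℝ, 0 < t →
      G.measure {x | t < G.riesz f x} ≤ ENNReal.ofReal (C / t) * ∫⁻ x, ‖f x‖ₑ ∂G.measure)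
    {q : ℝ≥0∞} (hq1 : 1 < q) (hq2 : q ≤ 2) : G.RieszBounded q := by
  have hq_top : q ≠ ∞ := (hq2.trans_lt ENNReal.ofNat_lt_top).ne
  have hq_zero : q ≠ 0 := (zero_lt_one.trans hq1).ne'
  have hr1 : 1 < q.toReal := by
    rw [← ENNReal.toReal_one]
    exact (ENNReal.toReal_lt_toReal ENNReal.one_ne_top hq_top).2 hq1
  -- it suffices to compare the integrals of the powers
  suffices hK : ∃ K : ℝ, 0 ≤ K ∧ ∀ f : G.L2, ∫⁻ x, ‖G.riesz f x‖ₑ ^ q.toReal ∂G.measure ≤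
      ENNReal.ofReal K * ∫⁻ x, ‖f x‖ₑ ^ q.toReal ∂G.measure by
    obtain ⟨K, hK0, hK⟩ := hK
    refine ⟨(K ^ (1 / q.toReal)).toNNReal, fun f _ => ?_⟩
    rw [eLpNorm_eq_lintegral_rpow_enorm_toReal hq_zero hq_top,
      eLpNorm_eq_lintegral_rpow_enorm_toReal hq_zero hq_top]
    change _ ≤ ENNReal.ofReal _ * _
    rw [← ENNReal.ofReal_rpow_of_nonneg hK0 (by positivity),
      ← ENNReal.mul_rpow_of_nonneg _ _ (by positivity)]
    gcongr
    exact hK f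
  rcases hq2.eq_or_lt with rfl | hq2
  · refine ⟨1, zero_le_one, fun f => ?_⟩
    simpa using G.lintegral_riesz_sq_le hw hinf f
  · have hr2 : q.toReal < 2 := by
      rw [← ENNReal.toReal_ofNat]
      exact (ENNReal.toReal_lt_toReal hq_top ENNReal.ofNat_ne_top).2 hq2
    have h1 := sub_pos.2 hr1
    have h2 := sub_pos.2 hr2
    exact ⟨_, by positivity, G.lintegral_riesz_rpow_le hw hinf hC h hr1 hr2⟩

theorem riesz_sqrtLaplacian (hw : ∀ x, 0 < G.weight x) (hinf : G.measure Set.univ = ∞) (g : G.L2) :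
    G.riesz (G.sqrtLaplacian g) = G.grad g := by
  funext x
  rw [riesz, G.rieszField_sqrtLaplacian hw hinf, fieldLength, grad,
    Finset.sum_congr rfl fun z hz => by rw [G.differential_apply _ hz]]

theorem RieszBounded.rieszInequality {G : WeightedGraph Γ} {q : ℝ≥0∞} (h : G.RieszBounded q)
    (hw : ∀ x, 0 < G.weight x) (hinf : G.measure Set.univ = ∞) : G.RieszInequality q := by
  obtain ⟨C, hC⟩ := h
  -- the added `1` makes the right-hand side infinite when `Δ^{1/2} g` is not in `L^q`
  refine ⟨C + 1, fun g _ => ?_⟩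
  rw [← G.riesz_sqrtLaplacian hw hinf]
  by_cases hg : MemLp (G.sqrtLaplacian g) q G.measure
  · refine (hC _ hg).trans ?_
    gcongr
    exact le_self_add
  · have : eLpNorm (G.sqrtLaplacian g) q G.measure = ∞ := by
      by_contra hne
      exact hg ⟨Lp.aestronglyMeasurable _, lt_top_iff_ne_top.2 hne⟩
    rw [this, ENNReal.mul_top (by simp)]
    exact le_top

end Measure

end WeightedGraph

theorem theorem4p2 {Γ : Type*} [Countable Γ] [Infinite Γ] [MeasurableSpace Γ]
    [DiscreteMeasurableSpace Γ] (G : WeightedGraph Γ) (hLB : G.LB) (hD : G.Doubling)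
    (m : ℝ) (hm : 2 < m) (hUE : G.UE m) :
    G.RieszWeakOneOne ∧
      ∀ q : ℝ≥0∞, 1 < q → q ≤ 2 → G.RieszBounded q ∧ G.RieszInequality q := by
  obtain ⟨ε, hε, hLB⟩ := hLB
  obtain ⟨D, hD⟩ := hD
  obtain ⟨M, hM⟩ := G.locUnifFinite
  have hw := G.weight_pos_of_LB hε hLB
  have hcard : ∀ x, (G.neighbours x).card ≤ M := fun x => by
    have h := hM x
    rwa [(G.finite_neighbours x).encard_eq_coe_toFinset_card, Nat.cast_le] at h
  have hD' : ∀ (x : Γ) (r : ℝ), 0 < r → G.vol x (2 * r) ≤ max D 1 * G.vol x r := fun x r hr =>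
    (hD x r hr).trans (mul_le_mul_of_nonneg_right (le_max_left _ _) measureReal_nonneg)
  have hD0 : 0 < max D 1 := lt_max_of_lt_right one_pos
  have hinf := G.measure_univ_eq_top hw hD0 hD'
  obtain ⟨C, hC, h⟩ := G.exists_measure_riesz_gt_le hε hLB hinf hcard hD0.le hD' hm hUE
  refine ⟨G.rieszWeakOneOne_of_measure_le hC h, fun q hq1 hq2 => ?_⟩
  have hq := G.rieszBounded_of_measure_le hw hinf hC h hq1 hq2
  exact ⟨hq, hq.rieszInequality hw hinf⟩

end
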